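/- Let $r\ge 0$ be an integer, $\mathfrak g=\mathfrak{sl}_{r+1}(\mathbb C)$, and let $\mathfrak g[t]=\mathfrak g\otimes\mathbb C[t]$ be its current algebra, with bracket $[x\otimes f,y\otimes g]=[x,y]\otimes fg$. Let $\mathfrak h\subset\mathfrak g$ be the diagonal matrices, $\omega_1,\dots,\omega_r\in\mathfrak h^*$ the fundamental weights ($\omega_i(\mathrm{diag}(a_1,\dots,a_{r+1}))=a_1+\cdots+a_i$), and $\alpha_1,\dots,\alpha_r$ the simple roots ($\alpha_i(\mathrm{diag}(a_1,\dots,a_{r+1}))=a_i-a_{i+1}$). For $1\le i\le j\le r$ let $\alpha_{i,j}=\alpha_i+\cdots+\alpha_j$, let $x^+_{i,j}$ (resp. $x^-_{i,j}$) be the matrix unit at position $(i,j+1)$ (resp. $(j+1,i)$), and let $\mathfrak n^\pm$ be the span of all $x^\pm_{i,j}$. For $\lambda=\sum_{i=1}^r m_i\omega_i$ with $m_1,\dots,m_r\in\mathbb Z_{\ge 0}$, the Weyl module $W(\lambda)$ is the $\mathfrak g[t]$-module generated by an element $w_\lambda$ with defining relations $$\mathfrak n^+[t]\,w_\lambda=0,\quad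 (\mathfrak h\otimes t\mathbb C[t])\,w_\lambda=0,\quad h\,w_\lambda=\lambda(h)w_\lambda\ (h\in\mathfrak h),\quad (x^-_{i,i}\otimes 1)^{m_i+1}w_\lambda=0\ (1\le i\le r).$$ Let $\mathbf F$ be the set of pairs $(\ell,\mathbf s)$ with $\ell\in\mathbb Z_{\ge0}$ and $\mathbf s=(\mathbf s(1)\le\cdots\le\mathbf s(\ell))$ a sequence of non-negative integers. For an integer $m\ge0$ let $\mathbf F(m)\subset\mathbf F$ consist of $(0,\emptyset)$ and of all $(\ell,\mathbf s)$ with $\ell>0$ and $\mathbf s(k)\le m-\ell$ for $1\le k\le\ell$; for $m<0$ let $\mathbf F(m)=\emptyset$. Put $\mathbf x^-_{i,j}(\ell,\mathbf s)=(x^-_{i,j}\otimes t^{\mathbf s(1)})\cdots(x^-_{i,j}\otimes t^{\mathbf s(\ell)})$, which is $1$ for $\ell=0$. Let $\mathcal B^r(\lambda)\subset U(\mathfrak n^-[t])$ be the set of all ordered monomials $$\prod_{j=1}^{r}\Bigl(\prod_{i=1}^{j}\mathbf x^-_{i,j}(\ell_{i,j},\mathbf s_{i,j})\Bigr)=\mathbf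 x^-_{1,1}(\ell_{1,1},\mathbf s_{1,1})\,\mathbf x^-_{1,2}(\ell_{1,2},\mathbf s_{1,2})\,\mathbf x^-_{2,2}(\ell_{2,2},\mathbf s_{2,2})\,\mathbf x^-_{1,3}(\ell_{1,3},\mathbf s_{1,3})\cdots\mathbf x^-_{r,r}(\ell_{r,r},\mathbf s_{r,r})$$ (factors in increasing order of $j$ and, for equal $j$, of $i$) with $(\ell_{i,j},\mathbf s_{i,j})\in\mathbf F$ such that, for all $1\le i\le j\le r$, $(\ell_{i,j},\mathbf s_{i,j})\in\mathbf F(m_{i,j})$, where $m_{i,j}$ is the coefficient of $\omega_i$ in $$\lambda-\sum_{s=j+1}^{r}\sum_{k=1}^{s}\ell_{k,s}\,\alpha_{k,s};$$ explicitly, $m_{i,j}=m_i+\sum_{s=j+1}^r(\ell_{i+1,s}-\ell_{i,s})$. Then the vectors $b\,w_\lambda$, $b\in\mathcal B^r(\lambda)$, form a basis of the complex vector space $W(\lambda)$: they are linearly independent (in particular pairwise distinct) and span $W(\lambda)$. -/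

import Mathlib

open scoped TensorProduct

noncomputable section

namespace WeylBasis

/-! ### The Lie algebra `sl_{r+1}` and its current algebra

The indices `1, …, r` of simple roots are represented by `Fin r` and the indices `1, …, r + 1` of
rows and columns by `Fin (r + 1)`, so that the index `i : Fin r` corresponds to the row `i.castSucc`
and its successor to the row `i.succ`. -/

/-- `sl_{r+1}`, the Lie algebra of complex matrices of trace zero. -/
abbrev Sl (r : ℕ) := LieAlgebra.SpecialLinear.sl (Fin (r + 1)) ℂ

/-- The current algebra `sl_{r+1}[t]`, with bracket `[f ⊗ x, g ⊗ y] = f g ⊗ [x, y]`. -/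
abbrev Current (r : ℕ) := Polynomial ℂ ⊗[ℂ] Sl r

/-- The universal enveloping algebra of the current algebra. -/
abbrev UCurrent (r : ℕ) := UniversalEnvelopingAlgebra ℂ (Current r)

/-- The element `x ⊗ f` of the current algebra, as an element of the enveloping algebra. -/
def cur {r : ℕ} (x : Sl r) (f : Polynomial ℂ) : UCurrent r :=
  UniversalEnvelopingAlgebra.ι ℂ (f ⊗ₜ[ℂ] x)

/-- `x⁺_{i,j}`: the matrix unit at the position `(i, j + 1)`. -/
def xPlus {r : ℕ} (i j : Fin r) (h : i ≤ j) : Sl r :=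
  LieAlgebra.SpecialLinear.single i.castSucc j.succ (Fin.castSucc_lt_succ_iff.mpr h).ne 1

/-- `x⁻_{i,j}`: the matrix unit at the position `(j + 1, i)`. -/
def xMinus {r : ℕ} (i j : Fin r) (h : i ≤ j) : Sl r :=
  LieAlgebra.SpecialLinear.single j.succ i.castSucc (Fin.castSucc_lt_succ_iff.mpr h).ne' 1

/-- `𝔫⁺`, the span of all `x⁺_{i,j}` with `i ≤ j`. -/
def nPlus (r : ℕ) : Submodule ℂ (Sl r) :=
  Submodule.span ℂ {x | ∃ (i j : Fin r) (h : i ≤ j), x = xPlus i j h}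

/-- The Cartan subalgebra `𝔥` of diagonal matrices. -/
def cartan (r : ℕ) : Set (Sl r) := {x | x.val.IsDiag}

/-! ### Weights -/

/-- The weight lattice `P`: the function `m` stands for `∑ i, m i • ω_i`. -/
abbrev Weight (r : ℕ) := Fin r → ℤ

/-- The fundamental weight `ω_i`, with `ω_i (diag (a_1, …, a_{r+1})) = a_1 + ⋯ + a_i`. -/
def fundWeight {r : ℕ} (i : Fin r) (x : Sl r) : ℂ :=
  ∑ k ∈ Finset.Iic i.castSucc, x.val k k

/-- The value `μ(h)` of the weight `μ = ∑ i, μ i • ω_i` at an element `h` of `𝔥`. -/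
def Weight.eval {r : ℕ} (μ : Weight r) (h : Sl r) : ℂ :=
  ∑ i, (μ i : ℂ) * fundWeight i h

/-- The simple root `α_i = ∑ k, α_i(h_k) ω_k`. -/
def simpleRoot {r : ℕ} (i : Fin r) : Weight r := fun k => CartanMatrix.A r k i

/-- `α_{i,j} = α_i + ⋯ + α_j`. -/
def posRoot {r : ℕ} (i j : Fin r) : Weight r := ∑ k ∈ Finset.Icc i j, simpleRoot k

/-! ### The Weyl module -/

/-- The dominant weight `λ = ∑ i, m i • ω_i`. -/
def dominant {r : ℕ} (m : Fin r → ℕ) : Weight r := fun i => (m i : ℤ)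

/-- The elements of the enveloping algebra which are imposed to annihilate `w_λ`:
`𝔫⁺[t]`, `𝔥t[t]`, all `h - λ(h)` with `h ∈ 𝔥`, and `(x⁻_{i,i} ⊗ 1) ^ (m_i + 1)`. -/
def weylRelations {r : ℕ} (m : Fin r → ℕ) : Set (UCurrent r) :=
  {u | ∃ x ∈ nPlus r, ∃ f : Polynomial ℂ, u = cur x f} ∪
  {u | ∃ h ∈ cartan r, ∃ f : Polynomial ℂ, u = cur h (Polynomial.X * f)} ∪
  {u | ∃ h ∈ cartan r, u = cur h 1 - algebraMap ℂ (UCurrent r) ((dominant m).eval h)} ∪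
  {u | ∃ i : Fin r, u = cur (xMinus i i le_rfl) 1 ^ (m i + 1)}

/-- The Weyl module `W(λ)`: the quotient of the enveloping algebra of `sl_{r+1}[t]` by the left
ideal generated by the defining relations. -/
abbrev WeylModule {r : ℕ} (m : Fin r → ℕ) :=
  UCurrent r ⧸ Submodule.span (UCurrent r) (weylRelations m)

/-- The generator `w_λ` of `W(λ)`. -/
def weylGenerator {r : ℕ} (m : Fin r → ℕ) : WeylModule m :=
  Submodule.Quotient.mk 1

/-! ### The monomials -/

/-- The set `𝐅` of pairs `(ℓ, s)` with `s = (s(1) ≤ ⋯ ≤ s(ℓ))`; here `ℓ` is the length of `s`. -/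
abbrev ExpF := {s : List ℕ // s.SortedLE}

/-- The length `ℓ`. -/
def ExpF.len (s : ExpF) : ℕ := s.val.length

/-- `(ℓ, s) ∈ 𝐅(m)`: every `s(i)` is at most `m - ℓ`; the set is empty for `m < 0`, and it contains
the empty sequence for `m ≥ 0`. -/
def ExpF.Mem (s : ExpF) (m : ℤ) : Prop :=
  0 ≤ m ∧ ∀ a ∈ s.val, (a : ℤ) ≤ m - s.len

/-- The index `i ≤ j`, given as an element of `Fin (j + 1)`, as an element of `Fin r`. -/
def idx {r : ℕ} (j : Fin r) (i : Fin (j.val + 1)) : Fin r := Fin.castLE j.isLt i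

theorem idx_le {r : ℕ} (j : Fin r) (i : Fin (j.val + 1)) : idx j i ≤ j :=
  Nat.le_of_lt_succ i.isLt

/-- `𝐱⁻_{i,j}(ℓ, s) = (x⁻_{i,j} ⊗ t^{s(1)}) ⋯ (x⁻_{i,j} ⊗ t^{s(ℓ)})`. -/
def xMono {r : ℕ} (i j : Fin r) (h : i ≤ j) (s : ExpF) : UCurrent r :=
  (s.val.map fun a => cur (xMinus i j h) (Polynomial.X ^ a)).prod

/-- The elements `(ℓ_j, s_j)` of `𝐅^j`. -/
abbrev ExpRow {r : ℕ} (j : Fin r) := Fin (j.val + 1) → ExpF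

/-- `𝐱⁻_j(ℓ_j, s_j) = 𝐱⁻_{1,j}(ℓ_{1,j}, s_{1,j}) ⋯ 𝐱⁻_{j,j}(ℓ_{j,j}, s_{j,j})`. -/
def rowMono {r : ℕ} (j : Fin r) (d : ExpRow j) : UCurrent r :=
  (List.ofFn fun i => xMono (idx j i) j (idx_le j i) (d i)).prod

/-- The ordered monomial `𝐱⁻_1(ℓ_1, s_1) ⋯ 𝐱⁻_r(ℓ_r, s_r)`. -/
def mono {r : ℕ} (d : (j : Fin r) → ExpRow j) : UCurrent r :=
  (List.ofFn fun j => rowMono j (d j)).prod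

/-- `η_j(ℓ_j) = ∑ i ≤ j, ℓ_{i,j} α_{i,j}`. -/
def eta {r : ℕ} (j : Fin r) (d : ExpRow j) : Weight r :=
  ∑ i, ((d i).len : ℤ) • posRoot (idx j i) j

/-- `(ℓ_j, s_j) ∈ 𝐅^j(μ)` for `μ = ∑ i, μ i • ω_i`. -/
def ExpRow.Mem {r : ℕ} {j : Fin r} (d : ExpRow j) (μ : Weight r) : Prop :=
  ∀ i, (d i).Mem (μ (idx j i))

/-- The set `𝓑^r(λ)` of the ordered monomials which satisfy
`(ℓ_j, s_j) ∈ 𝐅^j(λ - ∑_{s > j} η_s(ℓ_s))` for all `j`. -/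
def basisSet {r : ℕ} (m : Fin r → ℕ) : Set (UCurrent r) :=
  {b | ∃ d : (j : Fin r) → ExpRow j,
    (∀ j, (d j).Mem (dominant m - ∑ s ∈ Finset.Ioi j, eta s (d s))) ∧ b = mono d}

end WeylBasis

end

/-! The proof has three parts: the monomials span, there are at most `N = ∏ binom(r+1, i) ^ m_i` of
them, and `dim W(λ) ≥ N`. Together these force a spanning family of at most `dim W(λ)` vectors,
hence a basis.

Spanning goes by induction on the rank. The elements `E_{j+1,i} ⊗ t^a` of the last row commute, so
they act through a polynomial ring, on which the smaller algebra acts by derivations. In one column,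
Garland's relations say that the coefficient of `z^a` in `(∑ f_k z^k)^b` kills the highest weight
vector when `a + b > m`. Modulo these relations every monomial of degree `l` is a combination of
monomials with exponents at most `m - l` (`bihom_le_goodSpan_sup_relSpan`). Lowering operators
`E_{i+1,i} ⊗ t^a` carry the relations of the simple root `i` into column `i` of the last row, up to
monomials of smaller weight in column `i+1` (`rowHom_relSpan_mul_mem`). Raising operators increase
the sum of the column indices, and `E_{a,a} ⊗ t^{k+1}` increases the total exponent. So, modulo what
the row polynomials that come earlier in this order generate, each good last-row monomial yields a
highest weight vector for the smaller algebra, of weight `λ - η_j`, and induction applies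
(`levelAlg_mul_mem`).

The count is a sum over the last row: `binom(m, l)` sequences of length `l`, the binomial theorem
and Pascal's rule turn the bound for one rank into the bound for the next
(`exists_finset_basisMon`).

For the lower bound, exterior powers of the natural module, `m_i` copies of the `i`-th, are realised
by minors of matrices over `ℂ[X]`, with `t` acting on the `k`-th matrix by a power of `X`. These
powers are distinct, so the product of leading minors generates a nonzero multiple of every product
of minors; they all vanish at `X = 0`, so there the Weyl relations hold. A Nakayama-type iteration
and a determinant modulo `X^K` show that any spanning set of `W(λ)` has at least `N` elements
(`prod_choose_le_card`). -/

noncomputable section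
namespace WeylBasis

/-! ### Straightening in a single column. -/

open MvPolynomial

/-! ### Monomials and powers of the generating series -/

/-- The monomial `∏_{a ∈ s} X a`. -/
def monom {σ : Type*} (s : Multiset σ) : MvPolynomial σ ℂ := (s.map X).prod

@[simp] theorem monom_zero {σ : Type*} : monom (0 : Multiset σ) = 1 := by simp [monom]

@[simp] theorem monom_cons {σ : Type*} (a : σ) (s : Multiset σ) :
    monom (a ::ₘ s) = X a * monom s := by simp [monom]

theorem monom_add {σ : Type*} (s t : Multiset σ) : monom (s + t) = monom s * monom t := by
  simp [monom]

theorem monom_replicate {σ : Type*} (n : ℕ) (a : σ) : monom (Multiset.replicate n a) = X a ^ n := by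
  simp [monom]

theorem monom_map {σ τ : Type*} (f : σ → τ) (s : Multiset σ) :
    monom (s.map f) = rename f (monom s) := by
  simp [monom, map_multiset_prod, Multiset.map_map]

theorem monomial_eq_monom {σ : Type*} (u : σ →₀ ℕ) :
    monomial u (1 : ℂ) = monom (Finsupp.toMultiset u) := by
  induction u using Finsupp.induction with
  | zero => simp
  | single_add a n f _ _ ih =>
    rw [map_add, monom_add, ← ih, Finsupp.toMultiset_single, Multiset.nsmul_singleton,
      monom_replicate, X_pow_eq_monomial, monomial_mul, one_mul]

/-- The generating series `∑ₖ X k zᵏ`. -/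
def genSeries : PowerSeries (MvPolynomial ℕ ℂ) := PowerSeries.mk X

/-- The coefficient of `zᵃ` in the `b`-th power of the generating series `∑ₖ X k zᵏ`. -/
def genPow (b a : ℕ) : MvPolynomial ℕ ℂ := PowerSeries.coeff a (genSeries ^ b)

theorem genPow_zero (a : ℕ) : genPow 0 a = if a = 0 then 1 else 0 := by
  simp [genPow, PowerSeries.coeff_one]

@[simp] theorem genPow_one (a : ℕ) : genPow 1 a = X a := by simp [genPow, genSeries]

theorem genPow_succ (b a : ℕ) :
    genPow (b + 1) a = ∑ p ∈ Finset.HasAntidiagonal.antidiagonal a, X p.1 * genPow b p.2 := by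
  rw [genPow, pow_succ', PowerSeries.coeff_mul]
  simp [genPow, genSeries]

theorem genPow_zero_right (b : ℕ) : genPow b 0 = X 0 ^ b := by
  induction b with
  | zero => simp [genPow_zero]
  | succ b ih => simp [pow_succ', genPow_succ, ih]

/-- The coefficientwise extension of a map to power series. -/
def mapCoeff (D : Derivation ℂ (MvPolynomial ℕ ℂ) (MvPolynomial ℕ ℂ))
    (f : PowerSeries (MvPolynomial ℕ ℂ)) : PowerSeries (MvPolynomial ℕ ℂ) :=
  PowerSeries.mk fun n => D (PowerSeries.coeff n f)

theorem mapCoeff_mul (D : Derivation ℂ (MvPolynomial ℕ ℂ) (MvPolynomial ℕ ℂ))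
    (f g : PowerSeries (MvPolynomial ℕ ℂ)) :
    mapCoeff D (f * g) = f * mapCoeff D g + mapCoeff D f * g := by
  ext1 n
  simp only [mapCoeff, PowerSeries.coeff_mk, PowerSeries.coeff_mul, map_add, map_sum,
    Derivation.leibniz, smul_eq_mul, ← Finset.sum_add_distrib]
  refine Finset.sum_congr rfl fun p _ => by ring

theorem mapCoeff_pow (D : Derivation ℂ (MvPolynomial ℕ ℂ) (MvPolynomial ℕ ℂ))
    (f : PowerSeries (MvPolynomial ℕ ℂ)) (b : ℕ) :
    mapCoeff D (f ^ (b + 1)) = ((b + 1 : ℕ) : PowerSeries (MvPolynomial ℕ ℂ)) * (f ^ b * mapCoeff D f) := by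
  induction b with
  | zero => simp
  | succ b ih =>
    rw [pow_succ, mapCoeff_mul, ih]
    push_cast
    ring

theorem derivation_genPow (D : Derivation ℂ (MvPolynomial ℕ ℂ) (MvPolynomial ℕ ℂ)) (b a : ℕ) :
    D (genPow (b + 1) a) =
      ((b + 1 : ℕ) : MvPolynomial ℕ ℂ) * PowerSeries.coeff a (genSeries ^ b * mapCoeff D genSeries) := by
  have h := congrArg (PowerSeries.coeff a) (mapCoeff_pow D genSeries b)
  rw [← nsmul_eq_mul, map_nsmul, nsmul_eq_mul] at h
  rw [← h, mapCoeff, PowerSeries.coeff_mk, genPow]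

/-- The generating series is linear in `X 0` with coefficient `1`, so `∂/∂X₀` lowers the power and
keeps `a`. -/
theorem pderiv_zero_genPow (b a : ℕ) :
    pderiv 0 (genPow (b + 1) a) = ((b + 1 : ℕ) : MvPolynomial ℕ ℂ) * genPow b a := by
  have : mapCoeff (pderiv 0) genSeries = 1 := by
    ext1 n
    rw [mapCoeff, PowerSeries.coeff_mk, genSeries, PowerSeries.coeff_mk, PowerSeries.coeff_one,
      pderiv_X]
    by_cases h : n = 0 <;> simp [h]
  rw [derivation_genPow, this, mul_one, genPow]

/-- The shift `X k ↦ X (k + 1)`. -/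
def shift : MvPolynomial ℕ ℂ →ₐ[ℂ] MvPolynomial ℕ ℂ := rename Nat.succ

theorem shift_monom (s : Multiset ℕ) : shift (monom s) = monom (s.map Nat.succ) :=
  (monom_map _ _).symm

/-- If `G` is the generating series, then `G - X₀ = z · shift G`. Take `b`-th powers and compare
coefficients of `z^(a+b)`. -/
theorem shift_genPow (b a : ℕ) :
    shift (genPow b a) = ∑ i ∈ Finset.range (b + 1),
      ((-1) ^ i * b.choose i : ℂ) • (X 0 ^ i * genPow (b - i) (a + b)) := by
  have h1 : genSeries + PowerSeries.C (-X 0) =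
      PowerSeries.X * PowerSeries.map (shift : MvPolynomial ℕ ℂ →+* MvPolynomial ℕ ℂ) genSeries := by
    ext1 n
    cases n with
    | zero => simp [genSeries]
    | succ n => simp [genSeries, PowerSeries.coeff_succ_X_mul, shift]
  have h2 := congrArg (fun f => PowerSeries.coeff (a + b) (f ^ b)) h1
  simp only [mul_pow] at h2
  rw [PowerSeries.coeff_X_pow_mul, ← map_pow, PowerSeries.coeff_map] at h2
  change _ = shift (genPow b a) at h2
  rw [← h2, add_comm genSeries, add_pow, map_sum]
  refine Finset.sum_congr rfl fun i _ => ?_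
  rw [← map_pow, mul_assoc, PowerSeries.coeff_C_mul, mul_comm (genSeries ^ _), ← nsmul_eq_mul,
    map_nsmul, ← genPow, neg_pow, smul_eq_C_mul]
  simp
  ring

/-! ### The straightening law for one variable -/

/-- The span of the monomials of degree `l` and weight `d`. -/
def bihom (l d : ℕ) : Submodule ℂ (MvPolynomial ℕ ℂ) :=
  Submodule.span ℂ {p | ∃ s : Multiset ℕ, s.card = l ∧ s.sum = d ∧ p = monom s}

/-- The span of the monomials of degree `l` and weight `d` with all factors `X a`, `a ≤ m - l`. -/
def goodSpan (m l d : ℕ) : Submodule ℂ (MvPolynomial ℕ ℂ) :=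
  Submodule.span ℂ {p | ∃ s : Multiset ℕ, s.card = l ∧ s.sum = d ∧ (∀ a ∈ s, a + l ≤ m) ∧
    p = monom s}

/-- The bihomogeneous components of the ideal generated by the `genPow b a` with `a + b > m`. -/
def relSpan (m l d : ℕ) : Submodule ℂ (MvPolynomial ℕ ℂ) :=
  Submodule.span ℂ {p | ∃ (s : Multiset ℕ) (b a : ℕ), s.card + b = l ∧ s.sum + a = d ∧
    m < a + b ∧ p = monom s * genPow b a}

theorem X_mul_mem_bihom {l d a : ℕ} {p : MvPolynomial ℕ ℂ} (hp : p ∈ bihom l d) :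
    X a * p ∈ bihom (l + 1) (d + a) := by
  induction hp using Submodule.span_induction with
  | mem p hp =>
    obtain ⟨s, rfl, rfl, rfl⟩ := hp
    exact Submodule.subset_span ⟨a ::ₘ s, by simp, by simp [add_comm], by simp⟩
  | zero => simp
  | add p q _ _ h1 h2 => rw [mul_add]; exact add_mem h1 h2
  | smul c p _ h => rw [mul_smul_comm]; exact Submodule.smul_mem _ _ h

theorem genPow_mem_bihom (b a : ℕ) : genPow b a ∈ bihom b a := by
  induction b generalizing a with
  | zero =>
    rw [genPow_zero]
    split_ifs with h
    · subst h; exact Submodule.subset_span ⟨0, by simp, by simp, by simp⟩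
    · exact zero_mem _
  | succ b ih =>
    rw [genPow_succ]
    refine sum_mem fun p hp => ?_
    rw [Finset.HasAntidiagonal.mem_antidiagonal] at hp
    have := X_mul_mem_bihom (a := p.1) (ih p.2)
    rwa [show p.2 + p.1 = a by omega] at this

theorem monom_mul_mem_bihom (s : Multiset ℕ) {l d : ℕ} {p : MvPolynomial ℕ ℂ}
    (hp : p ∈ bihom l d) : monom s * p ∈ bihom (s.card + l) (s.sum + d) := by
  induction s using Multiset.induction_on with
  | empty => simpa using hp
  | cons a s ih =>
    have := X_mul_mem_bihom (a := a) ih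
    rw [monom_cons, mul_assoc]
    convert this using 1
    simp only [Multiset.card_cons, Multiset.sum_cons]
    congr 1 <;> omega

theorem relSpan_le_bihom (m l d : ℕ) : relSpan m l d ≤ bihom l d := by
  refine Submodule.span_le.2 ?_
  rintro _ ⟨s, b, a, rfl, rfl, -, rfl⟩
  exact monom_mul_mem_bihom s (genPow_mem_bihom b a)

theorem goodSpan_le_bihom (m l d : ℕ) : goodSpan m l d ≤ bihom l d :=
  Submodule.span_mono fun _ ⟨s, h1, h2, _, h3⟩ => ⟨s, h1, h2, h3⟩

theorem shift_mem_goodSpan {m l d : ℕ} {p : MvPolynomial ℕ ℂ} (hp : p ∈ goodSpan m l d) :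
    shift p ∈ goodSpan (m + 1) l (d + l) := by
  suffices goodSpan m l d ≤ (goodSpan (m + 1) l (d + l)).comap shift.toLinearMap from this hp
  refine Submodule.span_le.2 ?_
  rintro _ ⟨s, rfl, rfl, h, rfl⟩
  refine Submodule.subset_span ⟨s.map Nat.succ, by simp, by simp [Multiset.sum_map_add], ?_, shift_monom s⟩
  intro a ha
  obtain ⟨b, hb, rfl⟩ := Multiset.mem_map.1 ha
  have := h b hb
  omega

theorem shift_mem_relSpan {m l d : ℕ} {p : MvPolynomial ℕ ℂ} (hp : p ∈ relSpan m l d) :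
    shift p ∈ relSpan (m + 1) l (d + l) := by
  suffices relSpan m l d ≤ (relSpan (m + 1) l (d + l)).comap shift.toLinearMap from this hp
  refine Submodule.span_le.2 ?_
  rintro _ ⟨s, b, a, rfl, rfl, h, rfl⟩
  change shift (monom s * genPow b a) ∈ relSpan _ _ _
  rw [map_mul, shift_monom, shift_genPow, Finset.mul_sum]
  refine sum_mem fun i hi => ?_
  rw [mul_smul_comm]
  refine Submodule.smul_mem _ _ ?_
  have hi' : i ≤ b := Nat.lt_succ_iff.1 (Finset.mem_range.1 hi)
  rcases hi'.lt_or_eq with hi' | rfl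
  · refine Submodule.subset_span ⟨s.map Nat.succ + Multiset.replicate i 0, b - i, a + b, ?_, ?_, ?_, ?_⟩
    · simp; omega
    · simp [Multiset.sum_map_add]; omega
    · omega
    · rw [monom_add, monom_replicate, mul_assoc]
  -- The term `i = b` is a multiple of `genPow 0 (a + b)`, which vanishes because `a + b > m ≥ 0`.
  · rw [Nat.sub_self, genPow_zero, if_neg (by omega)]
    simp

theorem pderiv_zero_monom (s : Multiset ℕ) :
    pderiv 0 (monom s) = (s.count 0 : ℂ) • monom (s.erase 0) := by
  induction s using Multiset.induction_on with
  | empty => simp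
  | cons a s ih =>
    rw [monom_cons, pderiv_mul, ih, pderiv_X]
    rcases eq_or_ne a 0 with rfl | ha
    · by_cases h0 : 0 ∈ s
      · obtain ⟨t, rfl⟩ := Multiset.exists_cons_of_mem h0
        simp [smul_eq_C_mul]; ring
      · simp [Multiset.count_eq_zero_of_notMem h0]
    · rw [Multiset.count_cons_of_ne ha.symm, Multiset.erase_cons_tail _ ha, monom_cons]
      simp [ha]

theorem goodSpan_le_map_pderiv (m l d : ℕ) :
    goodSpan m l d ≤ (goodSpan (m + 1) (l + 1) d).map (pderiv 0).toLinearMap := by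
  refine Submodule.span_le.2 ?_
  rintro _ ⟨s, rfl, rfl, h, rfl⟩
  -- Adding one factor `X 0` integrates with respect to `X 0`, up to the new multiplicity of `0`.
  refine ⟨((s.count 0 + 1 : ℕ) : ℂ)⁻¹ • monom (0 ::ₘ s),
    Submodule.smul_mem _ _ (Submodule.subset_span ⟨_, by simp, by simp, ?_, rfl⟩), ?_⟩
  · intro a ha
    rcases Multiset.mem_cons.1 ha with rfl | ha
    · by_contra hc
      rcases Multiset.empty_or_exists_mem s with rfl | ⟨b, hb⟩
      · simp at hc
      · have := h b hb; omega
    · have := h a ha; omega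
  · change pderiv 0 _ = _
    rw [Derivation.map_smul, pderiv_zero_monom, smul_smul, Multiset.count_cons_self, Multiset.erase_cons_head,
      inv_mul_cancel₀ (Nat.cast_ne_zero.2 (Nat.succ_ne_zero _)), one_smul]

/-- Integration by parts: differentiating `X₀^(j+1) * genPow (b+1) a` gives the wanted term plus one
with a smaller power of `X₀` and a larger `b`. Hence the induction on `j` with `b` arbitrary. -/
theorem X_pow_mul_genPow_mem_map_pderiv (m j b a : ℕ) (t : Multiset ℕ) (ht : 0 ∉ t)
    (h : m < a + b) :
    monom t * (X 0 ^ j * genPow b a) ∈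
      (relSpan (m + 1) (t.card + j + b + 1) (t.sum + a)).map (pderiv 0).toLinearMap := by
  induction j generalizing b with
  | zero =>
    refine ⟨((b + 1 : ℕ) : ℂ)⁻¹ • (monom t * genPow (b + 1) a), Submodule.smul_mem _ _
      (Submodule.subset_span ⟨t, b + 1, a, by omega, rfl, by omega, rfl⟩), ?_⟩
    change pderiv 0 _ = _
    have h0 : ((b + 1 : ℕ) : ℂ) ≠ 0 := Nat.cast_ne_zero.2 (Nat.succ_ne_zero _)
    rw [Derivation.map_smul, pderiv_mul, pderiv_zero_monom, Multiset.count_eq_zero_of_notMem ht,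
      pderiv_zero_genPow, ← nsmul_eq_mul, mul_smul_comm, ← Nat.cast_smul_eq_nsmul ℂ]
    simp [smul_smul, inv_mul_cancel₀ (by exact_mod_cast h0 : (b + 1 : ℂ) ≠ 0)]
  | succ j ih =>
    have key : pderiv 0 (monom t * (X 0 ^ (j + 1) * genPow (b + 1) a)) =
        ((j + 1 : ℕ) : ℂ) • (monom t * (X 0 ^ j * genPow (b + 1) a)) +
        ((b + 1 : ℕ) : ℂ) • (monom t * (X 0 ^ (j + 1) * genPow b a)) := by
      rw [pderiv_mul, pderiv_mul, pderiv_pow, pderiv_X_self, pderiv_zero_monom,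
        Multiset.count_eq_zero_of_notMem ht, pderiv_zero_genPow]
      simp [smul_eq_C_mul]; ring
    have h1 := ih (b + 1) (by omega)
    have h2 : pderiv 0 (monom t * (X 0 ^ (j + 1) * genPow (b + 1) a)) ∈
        (relSpan (m + 1) (t.card + (j + 1) + b + 1) (t.sum + a)).map (pderiv 0).toLinearMap := by
      refine ⟨_, Submodule.subset_span ⟨t + Multiset.replicate (j + 1) 0, b + 1, a, ?_, ?_, ?_, rfl⟩, ?_⟩
      · simp; omega
      · simp
      · omega
      · rw [monom_add, monom_replicate, mul_assoc]; rfl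
    rw [show t.card + j + (b + 1) + 1 = t.card + (j + 1) + b + 1 by omega] at h1
    have h0 : ((b + 1 : ℕ) : ℂ) ≠ 0 := Nat.cast_ne_zero.2 (Nat.succ_ne_zero _)
    have h3 := Submodule.smul_mem _ (((b + 1 : ℕ) : ℂ)⁻¹) (sub_mem h2 (Submodule.smul_mem _ ((j + 1 : ℕ) : ℂ) h1))
    rwa [key, add_sub_cancel_left, smul_smul, inv_mul_cancel₀ h0, one_smul] at h3

theorem exists_eq_replicate_zero_add (s : Multiset ℕ) :
    ∃ (n : ℕ) (t : Multiset ℕ), 0 ∉ t ∧ s = Multiset.replicate n 0 + t := by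
  refine ⟨s.count 0, s.filter (· ≠ 0), by simp, ?_⟩
  rw [← Multiset.filter_eq' s 0]
  exact (Multiset.filter_add_not _ s).symm

theorem relSpan_le_map_pderiv (m l d : ℕ) :
    relSpan m l d ≤ (relSpan (m + 1) (l + 1) d).map (pderiv 0).toLinearMap := by
  refine Submodule.span_le.2 ?_
  rintro _ ⟨s, b, a, rfl, rfl, h, rfl⟩
  obtain ⟨n, t, ht, rfl⟩ := exists_eq_replicate_zero_add s
  have := X_pow_mul_genPow_mem_map_pderiv m n b a t ht h
  rw [monom_add, monom_replicate, mul_comm (X 0 ^ n), mul_assoc]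
  rw [show (Multiset.replicate n 0 + t : Multiset ℕ).card + b + 1 = t.card + n + b + 1 by
      simp only [Multiset.card_add, Multiset.card_replicate]; omega,
    show (Multiset.replicate n 0 + t : Multiset ℕ).sum + a = t.sum + a by simp]
  exact this

theorem mem_map_shift_of_pderiv_eq_zero {l d : ℕ} {p : MvPolynomial ℕ ℂ} (hp : p ∈ bihom l d)
    (h0 : pderiv 0 p = 0) :
    p ∈ Submodule.span ℂ {q | ∃ t : Multiset ℕ, t.card = l ∧ t.sum + l = d ∧ q = shift (monom t)} := by
  have hsupp : ∀ u ∈ p.support, (Finsupp.toMultiset u).card = l ∧ (Finsupp.toMultiset u).sum = d := by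
    clear h0
    induction hp using Submodule.span_induction with
    | mem p hp =>
      obtain ⟨s, hs, hd, rfl⟩ := hp
      intro u hu
      have : monom s = monomial (Multiset.toFinsupp s) (1 : ℂ) := by
        rw [monomial_eq_monom]; simp
      rw [this] at hu
      have := support_monomial_subset hu
      rw [Finset.mem_singleton] at this
      subst this
      simp [hs, hd]
    | zero => simp
    | add p q _ _ h1 h2 =>
      intro u hu
      rcases Finset.mem_union.1 (support_add hu) with h | h
      exacts [h1 u h, h2 u h]
    | smul c p _ h => exact fun u hu => h u (support_smul hu)
  rw [p.as_sum]
  refine sum_mem fun u hu => ?_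
  -- In characteristic zero a monomial of `p` containing `X 0` would survive in `pderiv 0 p`: its
  -- coefficient there is multiplied by `u 0 ≠ 0`.
  have hu0 : u 0 = 0 := by
    by_contra hne
    have h := coeff_pderiv (i := 0) p (u - Finsupp.single 0 1)
    have h' : u - Finsupp.single 0 1 + Finsupp.single 0 1 = u := by
      ext k
      rcases eq_or_ne k 0 with rfl | hk
      · simp; omega
      · simp [hk]
    rw [h0, h', coeff_zero] at h
    rcases mul_eq_zero.1 h.symm with h | h
    · exact (mem_support_iff.1 hu) h
    · norm_cast at h
  rw [← mul_one (coeff u p), ← smul_eq_mul, ← smul_monomial, monomial_eq_monom]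
  refine Submodule.smul_mem _ _ (Submodule.subset_span ?_)
  have hmem : ∀ a ∈ Finsupp.toMultiset u, a ≠ 0 := by
    rintro a ha rfl
    rw [Finsupp.mem_toMultiset, Finsupp.mem_support_iff] at ha
    exact ha hu0
  have hm : Finsupp.toMultiset u = ((Finsupp.toMultiset u).map Nat.pred).map Nat.succ := by
    rw [Multiset.map_map]
    conv_lhs => rw [← Multiset.map_id (Finsupp.toMultiset u)]
    exact Multiset.map_congr rfl fun a ha => (Nat.succ_pred (hmem a ha)).symm
  obtain ⟨h1, h2⟩ := hsupp u hu
  refine ⟨(Finsupp.toMultiset u).map Nat.pred, by simpa using h1, ?_, ?_⟩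
  · rw [hm] at h2 h1
    rw [← h2]
    conv_lhs => rw [← h1]
    simp [Multiset.sum_map_add]
  · rw [shift_monom, ← hm]

/-- Induction on `m` along `∂/∂X₀`. Its kernel is the image of `shift`, which carries good monomials
and relations for `m` to those for `m + 1`; and good monomials and relations for `m` have
antiderivatives of the same kind for `m + 1`. -/
theorem bihom_le_goodSpan_sup_relSpan (m l d : ℕ) : bihom l d ≤ goodSpan m l d ⊔ relSpan m l d := by
  induction m generalizing l d with
  | zero =>
    refine Submodule.span_le.2 ?_
    rintro _ ⟨s, rfl, rfl, rfl⟩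
    rcases Multiset.empty_or_exists_mem s with rfl | ⟨a, ha⟩
    · exact Submodule.mem_sup_left (Submodule.subset_span ⟨0, by simp, by simp, by simp, rfl⟩)
    -- For `m = 0` every variable is itself a relation, since `X a = genPow 1 a` and `a + 1 > 0`.
    · obtain ⟨t, rfl⟩ := Multiset.exists_cons_of_mem ha
      refine Submodule.mem_sup_right (Submodule.subset_span ⟨t, 1, a, by simp, by simp [add_comm], by omega, ?_⟩)
      rw [genPow_one, monom_cons, mul_comm]
  | succ m ih =>
    have hker : ∀ p ∈ bihom l d, pderiv 0 p = 0 → p ∈ goodSpan (m + 1) l d ⊔ relSpan (m + 1) l d := by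
      intro p hp h0
      refine Submodule.span_le.2 ?_ (mem_map_shift_of_pderiv_eq_zero hp h0)
      rintro _ ⟨t, rfl, rfl, rfl⟩
      obtain ⟨g, hg, q, hq, hgq⟩ := Submodule.mem_sup.1
        (ih t.card t.sum (Submodule.subset_span ⟨t, rfl, rfl, rfl⟩))
      rw [← hgq, map_add]
      exact add_mem (Submodule.mem_sup_left (shift_mem_goodSpan hg))
        (Submodule.mem_sup_right (shift_mem_relSpan hq))
    refine Submodule.span_le.2 ?_
    rintro _ ⟨s, rfl, rfl, rfl⟩
    by_cases h0 : 0 ∈ s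
    · obtain ⟨t, rfl⟩ := Multiset.exists_cons_of_mem h0
      obtain ⟨g, hg, q, hq, hgq⟩ := Submodule.mem_sup.1
        (ih t.card t.sum (Submodule.subset_span ⟨t, rfl, rfl, rfl⟩))
      obtain ⟨g', hg', rfl⟩ := goodSpan_le_map_pderiv _ _ _ hg
      obtain ⟨q', hq', rfl⟩ := relSpan_le_map_pderiv _ _ _ hq
      simp only [Multiset.card_cons, Multiset.sum_cons, zero_add]
      -- Differentiating `monom (0 ::ₘ t)` gives `c` times `monom t`, so subtracting `c` times the
      -- antiderivative of a decomposition of `monom t` leaves an element of the kernel.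
      set c : ℂ := ((0 ::ₘ t).count 0 : ℂ)
      have hmem : c • (g' + q') ∈ goodSpan (m + 1) (t.card + 1) t.sum ⊔
          relSpan (m + 1) (t.card + 1) t.sum :=
        Submodule.smul_mem _ _ (add_mem (Submodule.mem_sup_left hg') (Submodule.mem_sup_right hq'))
      have := hker (monom (0 ::ₘ t) - c • (g' + q')) (sub_mem
        (Submodule.subset_span ⟨_, by simp, by simp, rfl⟩)
        (Submodule.smul_mem _ _ (add_mem (goodSpan_le_bihom _ _ _ (by simpa using hg'))
          (relSpan_le_bihom _ _ _ (by simpa using hq'))))) (by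
          rw [map_sub, pderiv_zero_monom, Derivation.map_smul, map_add, Multiset.erase_cons_head, ← hgq]
          exact sub_self _)
      have h := add_mem this (by simpa only [Multiset.card_cons, Multiset.sum_cons, zero_add] using hmem)
      rw [sub_add_cancel] at h
      simpa using h
    · refine hker _ (Submodule.subset_span ⟨s, rfl, rfl, rfl⟩) ?_
      rw [pderiv_zero_monom, Multiset.count_eq_zero_of_notMem h0]
      simp

end WeylBasis
end

/-! ### Garland's relations for the current algebra of `sl₂`. -/

noncomputable section
namespace WeylBasis

open MvPolynomial

/-! ### Polynomials in commuting elements of an algebra -/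

section CommHom

variable {A : Type*} [Ring A] [Algebra ℂ A] {σ : Type*}

open scoped IsMulCommutative in
/-- The evaluation of polynomials at a family of commuting elements of an algebra. -/
def commHom (x : σ → A) (h : ∀ i j, x i * x j = x j * x i) : MvPolynomial σ ℂ →ₐ[ℂ] A :=
  have := Algebra.isMulCommutative_adjoin ℂ (s := Set.range x) (by
    rintro _ ⟨i, rfl⟩ _ ⟨j, rfl⟩; exact h i j)
  (Algebra.adjoin ℂ (Set.range x)).val.comp
    (aeval fun i => ⟨x i, Algebra.subset_adjoin ⟨i, rfl⟩⟩)

open scoped IsMulCommutative in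
@[simp] theorem commHom_X (x : σ → A) (h : ∀ i j, x i * x j = x j * x i) (i : σ) :
    commHom x h (X i) = x i := by
  have := Algebra.isMulCommutative_adjoin ℂ (s := Set.range x) (by
    rintro _ ⟨i, rfl⟩ _ ⟨j, rfl⟩; exact h i j)
  change ((aeval fun i => (⟨x i, Algebra.subset_adjoin ⟨i, rfl⟩⟩ :
    Algebra.adjoin ℂ (Set.range x))) (X i) : Algebra.adjoin ℂ (Set.range x)).val = x i
  rw [aeval_X]

theorem monom_commHom_mul_mem (x : σ → A) (h : ∀ i j, x i * x j = x j * x i) (Z : Submodule ℂ A)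
    (hZ : ∀ i, ∀ z ∈ Z, x i * z ∈ Z) (p : MvPolynomial σ ℂ) {z : A} (hz : z ∈ Z) :
    commHom x h p * z ∈ Z := by
  induction p using MvPolynomial.induction_on with
  | C a => rw [← algebraMap_eq, AlgHom.commutes, ← Algebra.smul_def]; exact Z.smul_mem _ hz
  | add p q h1 h2 => rw [map_add, add_mul]; exact add_mem h1 h2
  | mul_X p i ih => rw [mul_comm, map_mul, commHom_X, mul_assoc]; exact hZ _ _ ih

/-- An element which acts on generators as a derivation does so on all polynomials. -/
theorem mul_commHom_of_derivation (x : σ → A) (h : ∀ i j, x i * x j = x j * x i) (y : A)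
    (D : Derivation ℂ (MvPolynomial σ ℂ) (MvPolynomial σ ℂ))
    (hD : ∀ i, y * x i = x i * y + commHom x h (D (X i))) (p : MvPolynomial σ ℂ) :
    y * commHom x h p = commHom x h p * y + commHom x h (D p) := by
  induction p using MvPolynomial.induction_on with
  | C a =>
    rw [derivation_C, map_zero, add_zero, ← algebraMap_eq, AlgHom.commutes]
    exact (Algebra.commutes a y).symm
  | add p q h1 h2 => simp only [map_add, mul_add, add_mul, h1, h2]; abel
  | mul_X p i ih =>
    have hc : commHom x h p * x i = x i * commHom x h p := by
      rw [← commHom_X x h i, ← map_mul, mul_comm, map_mul]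
    rw [Derivation.leibniz, map_add, map_mul, smul_eq_mul, smul_eq_mul, map_mul, map_mul, commHom_X,
      ← mul_assoc, ih, add_mul, mul_assoc, hD, mul_add, ← mul_assoc]
    have hc2 : commHom x h (D p) * x i = x i * commHom x h (D p) := by
      rw [← commHom_X x h i, ← map_mul, mul_comm, map_mul]
    rw [hc2]
    abel

end CommHom

/-! ### Garland's relations -/

section Garland

variable {A : Type*} [Ring A] [Algebra ℂ A]

/-- The derivation `X s ↦ X (s + k)`. -/
def translate (k : ℕ) : Derivation ℂ (MvPolynomial ℕ ℂ) (MvPolynomial ℕ ℂ) :=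
  mkDerivation ℂ fun s => X (s + k)

@[simp] theorem translate_X (k s : ℕ) : translate k (X s) = X (s + k) := mkDerivation_X _ _ _

/-- The variable `X (n + 1)` arises from the `n + 1` ways to split `n` between the translation and
the power of `z`; this multiplicity is the factor in the derivative. -/
theorem genSeries_sum_translate (f : PowerSeries (MvPolynomial ℕ ℂ)) (a : ℕ) :
    ∑ p ∈ Finset.HasAntidiagonal.antidiagonal a,
      PowerSeries.coeff p.2 (f * mapCoeff (translate (p.1 + 1)) genSeries) =
    PowerSeries.coeff a (f * PowerSeries.derivative (MvPolynomial ℕ ℂ) genSeries) := by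
  simp only [PowerSeries.coeff_mul]
  rw [Finset.sum_sigma', Finset.sum_congr rfl
    (g := fun p : ℕ × ℕ => ∑ q ∈ Finset.HasAntidiagonal.antidiagonal p.2,
      PowerSeries.coeff p.1 f * X (a - p.1 + 1)) (s₁ := Finset.HasAntidiagonal.antidiagonal a)]
  · rw [Finset.sum_sigma']
    refine Finset.sum_nbij' (fun x => ⟨(x.2.1, x.1.1 + x.2.2), (x.1.1, x.2.2)⟩)
      (fun x => ⟨(x.2.1, x.1.1 + x.2.2), (x.1.1, x.2.2)⟩) ?_ ?_ ?_ ?_ ?_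
    · rintro ⟨⟨s, l⟩, k, n⟩ h
      simp at h ⊢
      omega
    · rintro ⟨⟨s, l⟩, k, n⟩ h
      simp at h ⊢
      omega
    · rintro ⟨⟨s, l⟩, k, n⟩ h
      simp at h ⊢
      omega
    · rintro ⟨⟨s, l⟩, k, n⟩ h
      simp at h ⊢
      omega
    · rintro ⟨⟨s, l⟩, k, n⟩ h
      simp at h
      simp [mapCoeff, genSeries]
      left
      rw [show n + (s + 1) = a - k + 1 by omega]
  · rintro ⟨k, l⟩ h
    rw [Finset.HasAntidiagonal.mem_antidiagonal] at h
    simp only at h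
    subst h
    simp [genSeries, PowerSeries.coeff_derivative, Finset.Nat.card_antidiagonal]
    ring

/-- The combinatorial identity that closes the induction on the degree for Garland's relations. Both
sides are multiples of the coefficient of `z^a` in `G^b G'`: the two sums contribute `(b+1) b` and
`2 (b+1)`, together `(b+1)(b+2)`. -/
theorem genPow_identity (b a : ℕ) :
    ∑ p ∈ Finset.HasAntidiagonal.antidiagonal a,
      (X p.1 * (((b + 1) * (p.2 + 1) : ℕ) : MvPolynomial ℕ ℂ) * genPow b (p.2 + 1) +
        2 * translate (p.1 + 1) (genPow (b + 1) p.2)) =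
      (((b + 2) * (a + 1) : ℕ) : MvPolynomial ℕ ℂ) * genPow (b + 1) (a + 1) := by
  set G' := PowerSeries.derivative (MvPolynomial ℕ ℂ) genSeries with hG'
  have hd : ∀ b a : ℕ, ((a + 1 : ℕ) : MvPolynomial ℕ ℂ) * genPow b (a + 1) =
      PowerSeries.coeff a (PowerSeries.derivative (MvPolynomial ℕ ℂ) (genSeries ^ b)) := by
    intro b a
    rw [PowerSeries.coeff_derivative, genPow]; push_cast; ring
  have h1 : ∑ p ∈ Finset.HasAntidiagonal.antidiagonal a,
      (X p.1 * (((b + 1) * (p.2 + 1) : ℕ) : MvPolynomial ℕ ℂ) * genPow b (p.2 + 1)) =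
      (b + 1 : ℕ) * PowerSeries.coeff a
        (genSeries * PowerSeries.derivative (MvPolynomial ℕ ℂ) (genSeries ^ b)) := by
    rw [PowerSeries.coeff_mul, Finset.mul_sum]
    refine Finset.sum_congr rfl fun p _ => ?_
    rw [← hd, genSeries, PowerSeries.coeff_mk]
    push_cast; ring
  have h2 : ∑ p ∈ Finset.HasAntidiagonal.antidiagonal a,
      (2 * translate (p.1 + 1) (genPow (b + 1) p.2)) =
      2 * ((b + 1 : ℕ) * PowerSeries.coeff a (genSeries ^ b * G')) := by
    rw [← genSeries_sum_translate, Finset.mul_sum, Finset.mul_sum]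
    refine Finset.sum_congr rfl fun p _ => ?_
    rw [derivation_genPow]
  rw [Finset.sum_add_distrib, h1, h2, Nat.cast_mul, mul_assoc, hd]
  have h3 : genSeries * PowerSeries.derivative (MvPolynomial ℕ ℂ) (genSeries ^ b) =
      (b : PowerSeries (MvPolynomial ℕ ℂ)) * (genSeries ^ b * G') := by
    rw [PowerSeries.derivative_pow]
    cases b with
    | zero => simp
    | succ b => simp only [Nat.add_sub_cancel, pow_succ]; ring
  have hn : ∀ (n : ℕ) (F : PowerSeries (MvPolynomial ℕ ℂ)),
      PowerSeries.coeff a ((n : PowerSeries (MvPolynomial ℕ ℂ)) * F) =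
        (n : MvPolynomial ℕ ℂ) * PowerSeries.coeff a F := fun n F => by
    rw [← nsmul_eq_mul, map_nsmul, nsmul_eq_mul]
  rw [h3, PowerSeries.derivative_pow, ← hG', Nat.add_sub_cancel, mul_assoc, hn, hn]
  push_cast; ring

variable (f : ℕ → A) (hf : ∀ i j, f i * f j = f j * f i)

/-- If `v` behaves modulo `Z` like a highest weight vector of the current algebra of `sl₂` and
`f₀ ^ (m + 1)` annihilates it, then so do all elements of `relSpan m`. -/
theorem commHom_relSpan_mul_mem (e : A) (h : ℕ → A)
    (hef : ∀ s, e * f s = f s * e + h (s + 1))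
    (hhf : ∀ k s, h k * f s = f s * h k - (2 : ℂ) • f (s + k))
    (Z : Submodule ℂ A) (hZe : ∀ z ∈ Z, e * z ∈ Z) (hZf : ∀ s, ∀ z ∈ Z, f s * z ∈ Z)
    (v : A) (hev : e * v ∈ Z) (hhv : ∀ k, h (k + 1) * v ∈ Z) {m : ℕ} (hm : f 0 ^ (m + 1) * v ∈ Z)
    {l d : ℕ} {p : MvPolynomial ℕ ℂ} (hp : p ∈ relSpan m l d) : commHom f hf p * v ∈ Z := by
  have hD : ∀ k p, h (k + 1) * (commHom f hf p * v) +
      (2 : ℂ) • (commHom f hf (translate (k + 1) p) * v) ∈ Z := by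
    intro k p
    have := mul_commHom_of_derivation f hf (h (k + 1)) (-(2 : ℂ) • translate (k + 1))
      (fun i => by simp [hhf, sub_eq_add_neg]) p
    rw [← mul_assoc, this, add_mul, mul_assoc]
    have h2 := monom_commHom_mul_mem f hf Z hZf p (hhv k)
    convert h2 using 1
    simp
  -- Modulo `Z`, the element `e` trades one factor for one unit of weight: it sends `genPow (b+1) a`
  -- to `-(b+1)(a+1)` times `genPow b (a+1)`.
  have he : ∀ b a, e * (commHom f hf (genPow (b + 1) a) * v) +
      commHom f hf ((((b + 1) * (a + 1) : ℕ) : MvPolynomial ℕ ℂ) * genPow b (a + 1)) * v ∈ Z := by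
    intro b
    induction b with
    | zero =>
      intro a
      rw [zero_add, genPow_one, commHom_X, genPow_zero, if_neg (Nat.succ_ne_zero _), mul_zero,
        map_zero, zero_mul, add_zero, ← mul_assoc, hef, add_mul, mul_assoc]
      exact add_mem (hZf _ _ hev) (hhv _)
    | succ b ih =>
      intro a
      rw [← genPow_identity, genPow_succ]
      simp only [map_sum, Finset.sum_mul, Finset.mul_sum]
      rw [← Finset.sum_add_distrib]
      refine sum_mem fun p _ => ?_
      have h1 := hZf p.1 _ (ih p.2)
      have h2 := hD p.1 (genPow (b + 1) p.2)
      have h3 := add_mem h1 h2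
      convert h3 using 1
      rw [mul_assoc (X p.1)]
      simp only [map_mul, map_add, commHom_X, add_mul, mul_add, map_ofNat]
      rw [mul_assoc (f _) _ v, ← mul_assoc e (f _), hef, add_mul, ofNat_smul_eq_nsmul ℂ 2, nsmul_eq_mul]
      simp only [mul_assoc]
      push_cast
      abel
  -- The trade preserves `a + b`, so every such relation descends from `f₀^(a+b)`, which kills `v`
  -- because `a + b > m`.
  have hg : ∀ a b, m < a + b → commHom f hf (genPow b a) * v ∈ Z := by
    intro a
    induction a with
    | zero =>
      intro b hb
      rw [genPow_zero_right, map_pow, commHom_X, show b = (b - (m + 1)) + (m + 1) by omega, pow_add,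
        mul_assoc]
      have := monom_commHom_mul_mem f hf Z hZf (X 0 ^ (b - (m + 1))) hm
      rwa [map_pow, commHom_X] at this
    | succ a ih =>
      intro b hb
      have h1 := hZe _ (ih (b + 1) (by omega))
      have h2 := sub_mem (he b a) h1
      rw [add_sub_cancel_left, ← nsmul_eq_mul, map_nsmul, ← Nat.cast_smul_eq_nsmul ℂ,
        smul_mul_assoc] at h2
      have h0 : (((b + 1) * (a + 1) : ℕ) : ℂ) ≠ 0 :=
        Nat.cast_ne_zero.2 (Nat.mul_ne_zero (Nat.succ_ne_zero _) (Nat.succ_ne_zero _))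
      have h3 := Z.smul_mem (((b + 1) * (a + 1) : ℕ) : ℂ)⁻¹ h2
      rwa [smul_smul, inv_mul_cancel₀ h0, one_smul] at h3
  induction hp using Submodule.span_induction with
  | mem p hp =>
    obtain ⟨s, b, a, -, -, hab, rfl⟩ := hp
    rw [map_mul, mul_assoc]
    exact monom_commHom_mul_mem f hf Z hZf _ (hg a b hab)
  | zero => simp
  | add p q _ _ h1 h2 => rw [map_add, add_mul]; exact add_mem h1 h2
  | smul c p _ h => rw [map_smul, smul_mul_assoc]; exact Z.smul_mem _ h

end Garland

end WeylBasis
end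

/-! ### Highest weight vectors modulo a subspace, and the last row as a polynomial ring. -/

noncomputable section
namespace WeylBasis

open MvPolynomial

variable {A : Type*} [Ring A] [Algebra ℂ A]

/-! ### The relations of the current algebra of `gl` -/

/-- The elements `E a b k` with `a, b ≤ r` satisfy the relations of the elements `E_{a,b} ⊗ tᵏ` of
the current algebra of `gl_{r+1}`. -/
def IsCurrent (E : ℕ → ℕ → ℕ → A) (r : ℕ) : Prop :=
  ∀ a b c d, a ≤ r → b ≤ r → c ≤ r → d ≤ r → ∀ k l, E a b k * E c d l = E c d l * E a b k +
    ((if b = c then E a d (k + l) else 0) - if d = a then E c b (k + l) else 0)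

/-- The subspace `Z` is stable under left multiplication by the current algebra of `gl_{j+1}`. -/
def IsStable (E : ℕ → ℕ → ℕ → A) (j : ℕ) (Z : Submodule ℂ A) : Prop :=
  ∀ a b k, a ≤ j → b ≤ j → ∀ z ∈ Z, E a b k * z ∈ Z

/-- Modulo `Z`, the element `v` satisfies the defining relations of the generator of the Weyl module
of highest weight `∑_{i < j} m i • ω_i` of the current algebra of `gl_{j+1}`. -/
structure IsHighest (E : ℕ → ℕ → ℕ → A) (j : ℕ) (m : ℕ → ℕ) (Z : Submodule ℂ A) (v : A) : Prop where
  raise : ∀ a b k, a < b → b ≤ j → E a b k * v ∈ Z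
  diag : ∀ a k, a ≤ j → E a a (k + 1) * v ∈ Z
  weight : ∃ μ : ℕ → ℂ, (∀ a ≤ j, E a a 0 * v - μ a • v ∈ Z) ∧ ∀ i < j, μ i - μ (i + 1) = m i
  nilp : ∀ i < j, E (i + 1) i 0 ^ (m i + 1) * v ∈ Z

/-- Garland's relations for the simple root `i`. The raising element is `E_{i,i+1} ⊗ t`, not
`E_{i,i+1} ⊗ 1`: its brackets with the `f_s` only produce `h ⊗ t^(s+1)`, which kill the vector. -/
theorem IsHighest.mul_relSpan_mem {E : ℕ → ℕ → ℕ → A} {r j : ℕ} (hE : IsCurrent E r) (hj : j ≤ r)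
    {m : ℕ → ℕ} {Z : Submodule ℂ A} {v : A} (hZ : IsStable E j Z) (hv : IsHighest E j m Z v)
    {i : ℕ} (hi : i < j) (hc : ∀ a b, E (i + 1) i a * E (i + 1) i b = E (i + 1) i b * E (i + 1) i a)
    {l d : ℕ} {p : MvPolynomial ℕ ℂ} (hp : p ∈ relSpan (m i) l d) :
    commHom (E (i + 1) i) hc p * v ∈ Z := by
  refine commHom_relSpan_mul_mem _ hc (E i (i + 1) 1) (fun k => E i i k - E (i + 1) (i + 1) k)
    ?_ ?_ Z (hZ _ _ _ (by omega) (by omega)) (fun s => hZ _ _ _ (by omega) (by omega)) v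
    (hv.raise _ _ _ (by omega) (by omega)) ?_ (hv.nilp i hi) hp
  · intro s
    rw [hE _ _ _ _ (by omega) (by omega) (by omega) (by omega), if_pos rfl, if_pos rfl, add_comm 1 s]
  · intro k s
    rw [sub_mul, hE i i (i + 1) i (by omega) (by omega) (by omega) (by omega),
      hE (i + 1) (i + 1) (i + 1) i (by omega) (by omega) (by omega) (by omega), if_neg (by omega),
      if_pos rfl, if_pos rfl, if_neg (by omega), mul_sub, two_smul, add_comm k s]
    abel
  · intro k
    rw [sub_mul]
    exact sub_mem (hv.diag _ _ (by omega)) (hv.diag _ _ (by omega))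

/-! ### Nilpotency -/

theorem pow_mul_of_commutator {B : Type*} [Ring B] {f x y : B} (hx : f * x = x * f + y) (hy : f * y = y * f) (n : ℕ) :
    f ^ (n + 1) * x = x * f ^ (n + 1) + (n + 1) • (y * f ^ n) := by
  have hyn : ∀ n, f ^ n * y = y * f ^ n := fun n => (show Commute f y from hy).pow_left n
  induction n with
  | zero => simpa using hx
  | succ n ih =>
    rw [pow_succ, mul_assoc, hx, mul_add, ← mul_assoc, ih, add_mul, hyn, mul_assoc, ← pow_succ,
      smul_mul_assoc, mul_assoc, ← pow_succ, succ_nsmul _ (n + 1)]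
    abel

/-- The representation theory of `sl₂`: on a vector of highest weight `n` on which `f` is nilpotent,
`f ^ (n + 1)` vanishes. -/
theorem pow_mul_mem_of_highest {e f h : A} (hef : e * f = f * e + h)
    (hhf : h * f = f * h - (2 : ℂ) • f) (W : Submodule ℂ A) (hWe : ∀ w ∈ W, e * w ∈ W)
    (hWf : ∀ w ∈ W, f * w ∈ W) {v : A} {n : ℕ} (hev : e * v ∈ W) (hhv : h * v - (n : ℂ) • v ∈ W)
    {N : ℕ} (hN : f ^ N * v ∈ W) : f ^ (n + 1) * v ∈ W := by
  have hh : ∀ k : ℕ, h * (f ^ k * v) - ((n : ℂ) - 2 * k) • (f ^ k * v) ∈ W := by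
    intro k
    induction k with
    | zero => simpa using hhv
    | succ k ih =>
      convert hWf _ ih using 1
      rw [pow_succ', mul_assoc, ← mul_assoc h, hhf, sub_mul, smul_mul_assoc, mul_sub, mul_smul_comm,
        mul_assoc f h]
      push_cast
      module
  have he : ∀ k : ℕ, e * (f ^ (k + 1) * v) - ((k + 1 : ℂ) * (n - k)) • (f ^ k * v) ∈ W := by
    intro k
    induction k with
    | zero =>
      convert add_mem (hWf _ hev) hhv using 1
      simp only [zero_add, pow_one, pow_zero, one_mul, Nat.cast_zero, sub_zero, ← mul_assoc, hef]
      rw [add_mul, mul_assoc]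
      abel
    | succ k ih =>
      convert add_mem (hWf _ ih) (hh (k + 1)) using 1
      rw [pow_succ' f (k + 1), mul_assoc, ← mul_assoc e, hef, add_mul, mul_sub f,
        mul_smul_comm, ← mul_assoc f (f ^ k), ← pow_succ', mul_assoc f e]
      push_cast
      module
  by_contra hcon
  -- The coefficient `(k+1)(n-k)` vanishes only at `k = n`, so beyond `n` the operator `e` recovers
  -- each power from the next; a nonzero `f^(n+1) v` would contradict nilpotency.
  have hstep : ∀ k, n + 1 ≤ k → f ^ k * v ∉ W := by
    intro k hk
    induction k, hk using Nat.le_induction with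
    | base => exact hcon
    | succ k hk ih =>
      intro hmem
      have h1 := sub_mem (hWe _ hmem) (he k)
      rw [sub_sub_cancel] at h1
      have h0 : ((k + 1 : ℂ) * (n - k)) ≠ 0 := by
        refine mul_ne_zero (by exact_mod_cast Nat.succ_ne_zero k) (sub_ne_zero.2 ?_)
        exact_mod_cast (by omega : n ≠ k)
      have h2 := W.smul_mem ((k + 1 : ℂ) * (n - k))⁻¹ h1
      rw [smul_smul, inv_mul_cancel₀ h0, one_smul] at h2
      exact ih h2
  refine hstep (N + n + 1) (by omega) ?_
  have : ∀ k, f ^ (k + N) * v ∈ W := by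
    intro k
    induction k with
    | zero => simpa using hN
    | succ k ih => rw [show k + 1 + N = (k + N) + 1 by omega, pow_succ', mul_assoc]; exact hWf _ ih
  have h := this (n + 1)
  rwa [show n + 1 + N = N + n + 1 by omega] at h

/-! ### The last row -/

/-- The part of a multiset of pairs lying over `i`. -/
def part (i : ℕ) (σ : Multiset (ℕ × ℕ)) : Multiset ℕ := (σ.filter (fun x => x.1 = i)).map Prod.snd

@[simp] theorem part_add (i : ℕ) (σ τ : Multiset (ℕ × ℕ)) : part i (σ + τ) = part i σ + part i τ := by
  simp [part]

@[simp] theorem part_zero (i : ℕ) : part i 0 = 0 := rfl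

theorem part_cons (i : ℕ) (x : ℕ × ℕ) (σ : Multiset (ℕ × ℕ)) :
    part i (x ::ₘ σ) = (if x.1 = i then {x.2} else 0) + part i σ := by
  unfold part
  split_ifs with h
  · rw [Multiset.filter_cons_of_pos (p := fun y : ℕ × ℕ => y.1 = i) _ h]; simp
  · rw [Multiset.filter_cons_of_neg (p := fun y : ℕ × ℕ => y.1 = i) _ h]; simp

theorem part_map (i i' : ℕ) (s : Multiset ℕ) :
    part i (s.map (Prod.mk i')) = if i' = i then s else 0 := by
  induction s using Multiset.induction_on with
  | empty => simp
  | cons a s ih =>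
    rw [Multiset.map_cons, part_cons, ih]
    split_ifs <;> simp

theorem part_filter (i : ℕ) (σ : Multiset (ℕ × ℕ)) :
    (part i σ).map (Prod.mk i) = σ.filter fun x => x.1 = i := by
  rw [part, Multiset.map_map]
  conv_rhs => rw [← Multiset.map_id (σ.filter fun x => x.1 = i)]
  refine Multiset.map_congr rfl ?_
  rintro ⟨a, b⟩ h
  simp at h
  simp [h.2]

/-- The span of the monomials of degree `n`, with given sum of first and second indices. -/
def rowHomog (j n : ℕ) (κ : ℤ) (d : ℕ) : Submodule ℂ (MvPolynomial (ℕ × ℕ) ℂ) :=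
  Submodule.span ℂ {p | ∃ σ : Multiset (ℕ × ℕ), (∀ x ∈ σ, x.1 ≤ j) ∧ σ.card = n ∧
    (σ.map fun x => (x.1 : ℤ)).sum = κ ∧ (σ.map Prod.snd).sum = d ∧ p = monom σ}

theorem monom_mem_rowHomog {j : ℕ} {σ : Multiset (ℕ × ℕ)} (h : ∀ x ∈ σ, x.1 ≤ j) :
    monom σ ∈ rowHomog j σ.card (σ.map fun x => (x.1 : ℤ)).sum (σ.map Prod.snd).sum :=
  Submodule.subset_span ⟨σ, h, rfl, rfl, rfl, rfl⟩

theorem X_mul_mem_rowHomog {j n : ℕ} {κ : ℤ} {d : ℕ} {p : MvPolynomial (ℕ × ℕ) ℂ}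
    (hp : p ∈ rowHomog j n κ d) {x : ℕ × ℕ} (hx : x.1 ≤ j) {n' : ℕ} {κ' : ℤ} {d' : ℕ} 
    (hn : n' = n + 1) (hκ : κ' = κ + x.1) (hd : d' = d + x.2) :
    X x * p ∈ rowHomog j n' κ' d' := by
  induction hp using Submodule.span_induction with
  | mem p hp =>
    obtain ⟨s, hs, rfl, rfl, rfl, rfl⟩ := hp
    refine Submodule.subset_span ⟨x ::ₘ s, ?_, by simp [hn], by simp [hκ, add_comm], by simp [hd, add_comm], by simp⟩
    intro y hy
    rcases Multiset.mem_cons.1 hy with rfl | hy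
    exacts [hx, hs _ hy]
  | zero => simp
  | add p q _ _ h1 h2 => rw [mul_add]; exact add_mem h1 h2
  | smul c p _ h => rw [mul_smul_comm]; exact Submodule.smul_mem _ _ h

/-- The derivation by which `E a b k` acts on polynomials in the elements of the last row. -/
def rowDer (a b k : ℕ) : Derivation ℂ (MvPolynomial (ℕ × ℕ) ℂ) (MvPolynomial (ℕ × ℕ) ℂ) :=
  mkDerivation ℂ fun x => if x.1 = a then -X (b, x.2 + k) else 0

@[simp] theorem rowDer_X (a b k : ℕ) (x : ℕ × ℕ) :
    rowDer a b k (X x) = if x.1 = a then -X (b, x.2 + k) else 0 := mkDerivation_X _ _ _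

/-- The gradings `κ` and `d` order the straightening: raising operators (`a < b`) increase `κ`, and
diagonal ones with a positive power of `t` keep `κ` and increase `d`. -/
theorem rowDer_mem_rowHomog {j n : ℕ} {κ : ℤ} {d : ℕ} {p : MvPolynomial (ℕ × ℕ) ℂ}
    (hp : p ∈ rowHomog j n κ d) {a b : ℕ} (hb : b ≤ j) (k : ℕ) :
    rowDer a b k p ∈ rowHomog j n (κ - a + b) (d + k) := by
  induction hp using Submodule.span_induction with
  | mem p hp =>
    obtain ⟨σ, hs, rfl, rfl, rfl, rfl⟩ := hp
    induction σ using Multiset.induction_on with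
    | empty => simp
    | cons x σ ih =>
      have hσ : ∀ y ∈ σ, y.1 ≤ j := fun y hy => hs y (Multiset.mem_cons_of_mem hy)
      rw [monom_cons, Derivation.leibniz, smul_eq_mul, smul_eq_mul, rowDer_X]
      refine add_mem (X_mul_mem_rowHomog (ih hσ) (hs x (Multiset.mem_cons_self _ _)) (by simp)
        (by simp; ring) (by simp; ring)) ?_
      split_ifs with h
      · rw [mul_neg, neg_mem_iff, mul_comm]
        exact X_mul_mem_rowHomog (monom_mem_rowHomog hσ) hb (by simp)
          (by simp [h]) (by simp; ring)
      · simp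
  | zero => simp
  | add p q _ _ h1 h2 => rw [map_add]; exact add_mem h1 h2
  | smul c p _ h => rw [Derivation.map_smul]; exact Submodule.smul_mem _ _ h

theorem rowDer_diag_monom (a : ℕ) (σ : Multiset (ℕ × ℕ)) :
    rowDer a a 0 (monom σ) = -((part a σ).card : ℂ) • monom σ := by
  induction σ using Multiset.induction_on with
  | empty => simp
  | cons x σ ih =>
    rw [monom_cons, Derivation.leibniz, smul_eq_mul, smul_eq_mul, rowDer_X, ih, part_cons]
    split_ifs with h
    · subst h
      simp [smul_eq_C_mul]
      ring
    · simp

/-- The elements `E_{j+1,i} ⊗ tᵃ` for `i ≤ j`. -/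
def rowElt (E : ℕ → ℕ → ℕ → A) (j : ℕ) (x : ℕ × ℕ) : A := if x.1 ≤ j then E (j + 1) x.1 x.2 else 0

theorem rowElt_comm {B : Type*} [Ring B] {E : ℕ → ℕ → ℕ → B} {r j : ℕ} (hE : IsCurrent E r) (hj : j + 1 ≤ r)
    (x y : ℕ × ℕ) : rowElt E j x * rowElt E j y = rowElt E j y * rowElt E j x := by
  unfold rowElt
  by_cases hx : x.1 ≤ j <;> by_cases hy : y.1 ≤ j <;> simp only [hx, hy, if_true, if_false, zero_mul, mul_zero]
  rw [hE _ _ _ _ hj (by omega) hj (by omega), if_neg (by omega), if_neg (by omega), sub_zero,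
    add_zero]

/-- Polynomials in the elements `E_{j+1,i} ⊗ tᵃ`, `i ≤ j`. -/
def rowHom {E : ℕ → ℕ → ℕ → A} {r j : ℕ} (hE : IsCurrent E r) (hj : j + 1 ≤ r) :
    MvPolynomial (ℕ × ℕ) ℂ →ₐ[ℂ] A :=
  commHom (rowElt E j) (rowElt_comm hE hj)

section

variable {E : ℕ → ℕ → ℕ → A} {r j : ℕ} (hE : IsCurrent E r) (hj : j + 1 ≤ r)

theorem rowHom_X {i a : ℕ} (hi : i ≤ j) : rowHom hE hj (X (i, a)) = E (j + 1) i a := by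
  rw [rowHom, commHom_X, rowElt, if_pos hi]

theorem mul_rowHom {a b : ℕ} (ha : a ≤ j) (hb : b ≤ j) (k : ℕ) (p : MvPolynomial (ℕ × ℕ) ℂ) :
    E a b k * rowHom hE hj p = rowHom hE hj p * E a b k + rowHom hE hj (rowDer a b k p) := by
  refine mul_commHom_of_derivation _ _ _ _ (fun x => ?_) p
  rw [rowDer_X]
  by_cases hx : x.1 ≤ j
  · rw [rowElt, if_pos hx, hE _ _ _ _ (by omega) (by omega) (by omega) (by omega),
      if_neg (by omega)]
    split_ifs
    · rw [map_neg, commHom_X, rowElt, if_pos hb, zero_sub, add_comm k]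
    · simp
  · rw [if_neg (by omega), rowElt, if_neg hx]
    simp

theorem rowHom_mul_mem {Z : Submodule ℂ A} (hZ : IsStable E (j + 1) Z) (p : MvPolynomial (ℕ × ℕ) ℂ)
    {z : A} (hz : z ∈ Z) : rowHom hE hj p * z ∈ Z := by
  refine monom_commHom_mul_mem _ _ Z (fun x z hz => ?_) p hz
  unfold rowElt
  split_ifs with h
  · exact hZ _ _ _ le_rfl (by omega) _ hz
  · simp

end

end WeylBasis
end

/-! ### Transfer between adjacent columns: leading terms and errors. -/

noncomputable section
namespace WeylBasis

open MvPolynomial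

/-! ### Lowering operators on polynomials in two adjacent columns -/

/-- The monomial in the variables over `i`. -/
def colMonom (i : ℕ) (s : Multiset ℕ) : MvPolynomial (ℕ × ℕ) ℂ := monom (s.map (Prod.mk i))

@[simp] theorem colMonom_zero (i : ℕ) : colMonom i 0 = 1 := by simp [colMonom]

@[simp] theorem colMonom_cons (i a : ℕ) (s : Multiset ℕ) :
    colMonom i (a ::ₘ s) = X (i, a) * colMonom i s := by simp [colMonom]

/-- The span of the products `P * (monomial over i) * (monomial over i + 1)` of given degrees `k`,
`l` in the two columns, given total weight `d` and weight less than `e` in the second column. -/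
def lowSpan (P : MvPolynomial (ℕ × ℕ) ℂ) (i k l d e : ℕ) : Submodule ℂ (MvPolynomial (ℕ × ℕ) ℂ) :=
  Submodule.span ℂ {p | ∃ s t : Multiset ℕ, s.card = k ∧ t.card = l ∧ s.sum + t.sum = d ∧
    t.sum < e ∧ p = P * colMonom i s * colMonom (i + 1) t}

/-- The derivation `X (i + 1, s) ↦ X (i, s + a)`. -/
def lower (i a : ℕ) : Derivation ℂ (MvPolynomial (ℕ × ℕ) ℂ) (MvPolynomial (ℕ × ℕ) ℂ) :=
  -rowDer (i + 1) i a

theorem lower_X_of_ne {i a : ℕ} {x : ℕ × ℕ} (hx : x.1 ≠ i + 1) : lower i a (X x) = 0 := by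
  simp [lower, hx]

theorem lower_X_succ (i a b : ℕ) : lower i a (X (i + 1, b)) = X (i, b + a) := by
  simp [lower]

theorem lower_monom_eq_zero {i a : ℕ} {σ : Multiset (ℕ × ℕ)} (h : ∀ x ∈ σ, x.1 ≠ i + 1) :
    lower i a (monom σ) = 0 := by
  induction σ using Multiset.induction_on with
  | empty => simp
  | cons x σ ih =>
    rw [monom_cons, Derivation.leibniz, ih fun y hy => h y (Multiset.mem_cons_of_mem hy),
      lower_X_of_ne (h x (Multiset.mem_cons_self _ _))]
    simp

theorem lower_colMonom (i a : ℕ) (s : Multiset ℕ) : lower i a (colMonom i s) = 0 :=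
  lower_monom_eq_zero fun x hx => by
    obtain ⟨b, -, rfl⟩ := Multiset.mem_map.1 hx
    simp

/-- Each term moves one factor `X (i+1, b)` to column `i`, so the weight of column `i+1` drops by
`b`. The drop is strict when `t` contains no `0`; this makes the error terms smaller. -/
theorem lower_colMonom_succ_mem (i a : ℕ) (t : Multiset ℕ) :
    lower i a (colMonom (i + 1) t) ∈ Submodule.span ℂ {p | ∃ (c : ℕ) (t' : Multiset ℕ),
      c + t'.sum = t.sum + a ∧ t'.card + 1 = t.card ∧ t'.sum ≤ t.sum ∧ (0 ∉ t → t'.sum < t.sum) ∧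
      p = X (i, c) * colMonom (i + 1) t'} := by
  induction t using Multiset.induction_on with
  | empty => simp
  | cons b t ih =>
    rw [colMonom_cons, Derivation.leibniz, smul_eq_mul, smul_eq_mul, lower_X_succ]
    refine add_mem ?_ (Submodule.subset_span ⟨b + a, t, ?_, by simp, by simp, ?_, mul_comm _ _⟩)
    · suffices h : ∀ q ∈ Submodule.span ℂ {p | ∃ (c : ℕ) (t' : Multiset ℕ),
          c + t'.sum = t.sum + a ∧ t'.card + 1 = t.card ∧ t'.sum ≤ t.sum ∧ (0 ∉ t → t'.sum < t.sum) ∧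
          p = X (i, c) * colMonom (i + 1) t'}, X (i + 1, b) * q ∈ Submodule.span ℂ {p |
          ∃ (c : ℕ) (t' : Multiset ℕ), c + t'.sum = (b ::ₘ t).sum + a ∧ t'.card + 1 = (b ::ₘ t).card ∧
          t'.sum ≤ (b ::ₘ t).sum ∧ (0 ∉ b ::ₘ t → t'.sum < (b ::ₘ t).sum) ∧
          p = X (i, c) * colMonom (i + 1) t'} from h _ ih
      intro q hq
      induction hq using Submodule.span_induction with
      | mem q hq =>
        obtain ⟨c, t', h1, h2, h3, h4, rfl⟩ := hq
        refine Submodule.subset_span ⟨c, b ::ₘ t', ?_, ?_, ?_, ?_, ?_⟩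
        · simp only [Multiset.sum_cons]; omega
        · simp only [Multiset.card_cons]; omega
        · simp only [Multiset.sum_cons]; omega
        · intro h
          simp only [Multiset.mem_cons, not_or] at h
          have := h4 h.2
          simp only [Multiset.sum_cons]; omega
        · rw [colMonom_cons]; ring
      | zero => simp
      | add p q _ _ h1 h2 => rw [mul_add]; exact add_mem h1 h2
      | smul c p _ h => rw [mul_smul_comm]; exact Submodule.smul_mem _ _ h
    · simp only [Multiset.sum_cons]; omega
    · intro h
      simp only [Multiset.mem_cons, not_or] at h
      simp only [Multiset.sum_cons]; omega

/-- Error terms of a lowering operator. -/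
theorem lower_mul_mem {P : MvPolynomial (ℕ × ℕ) ℂ} {i a : ℕ} (hP : lower i a P = 0)
    (s t : Multiset ℕ) {k l d e : ℕ} (hk : k = s.card + 1) (hl : l + 1 = t.card)
    (hd : d = s.sum + t.sum + a) (he : t.sum < e ∨ (0 ∉ t ∧ t.sum ≤ e)) (n : ℕ) :
    lower i a (P * colMonom i s * (X (i + 1, 0) ^ n * colMonom (i + 1) t)) -
      n • (P * colMonom i (a ::ₘ s) * (X (i + 1, 0) ^ (n - 1) * colMonom (i + 1) t)) ∈
      lowSpan P i k (n + l) d e := by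
  -- The subtracted term is exactly what the derivation produces on `X (i+1, 0) ^ n`; what is left
  -- comes from the factors over `t`.
  have h1 : lower i a (P * colMonom i s * (X (i + 1, 0) ^ n * colMonom (i + 1) t)) -
      n • (P * colMonom i (a ::ₘ s) * (X (i + 1, 0) ^ (n - 1) * colMonom (i + 1) t)) =
      P * colMonom i s * X (i + 1, 0) ^ n * lower i a (colMonom (i + 1) t) := by
    simp only [Derivation.leibniz, hP, lower_colMonom, Derivation.leibniz_pow, lower_X_succ,
      smul_eq_mul, nsmul_eq_mul, colMonom_cons, zero_add]
    ring
  rw [h1]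
  suffices h : ∀ q ∈ Submodule.span ℂ {p | ∃ (c : ℕ) (t' : Multiset ℕ),
      c + t'.sum = t.sum + a ∧ t'.card + 1 = t.card ∧ t'.sum ≤ t.sum ∧ (0 ∉ t → t'.sum < t.sum) ∧
      p = X (i, c) * colMonom (i + 1) t'}, P * colMonom i s * X (i + 1, 0) ^ n * q ∈
      lowSpan P i k (n + l) d e from h _ (lower_colMonom_succ_mem i a t)
  intro q hq
  induction hq using Submodule.span_induction with
  | mem q hq =>
    obtain ⟨c, t', h1, h2, h3, h4, rfl⟩ := hq
    refine Submodule.subset_span ⟨c ::ₘ s, Multiset.replicate n 0 + t', by simp [hk], ?_, ?_, ?_, ?_⟩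
    · simp only [Multiset.card_add, Multiset.card_replicate]; omega
    · simp only [Multiset.sum_cons, Multiset.sum_add, Multiset.sum_replicate, smul_zero]; omega
    · simp only [Multiset.sum_add, Multiset.sum_replicate, smul_zero]
      rcases he with he | ⟨he, he'⟩
      · omega
      · have := h4 he; omega
    · rw [colMonom_cons, colMonom, colMonom, colMonom, Multiset.map_add, monom_add,
        Multiset.map_replicate, monom_replicate]
      ring
  | zero => simp
  | add p q _ _ h1 h2 => rw [mul_add]; exact add_mem h1 h2
  | smul c p _ h => rw [mul_smul_comm]; exact Submodule.smul_mem _ _ h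

theorem lower_lowSpan {P : MvPolynomial (ℕ × ℕ) ℂ} {i a : ℕ} (hP : lower i a P = 0)
    {k l d e : ℕ} {p : MvPolynomial (ℕ × ℕ) ℂ} (hp : p ∈ lowSpan P i k (l + 1) d e) :
    lower i a p ∈ lowSpan P i (k + 1) l (d + a) e := by
  induction hp using Submodule.span_induction with
  | mem p hp =>
    obtain ⟨s, t, rfl, hl, rfl, he, rfl⟩ := hp
    simpa using lower_mul_mem hP s t (k := s.card + 1) (l := l) rfl hl.symm rfl (Or.inl he) 0
  | zero => simp
  | add p q _ _ h1 h2 => rw [map_add]; exact add_mem h1 h2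
  | smul c p _ h => rw [Derivation.map_smul]; exact Submodule.smul_mem _ _ h

/-- Successive application of lowering operators. -/
def lowerList (i : ℕ) : List ℕ → MvPolynomial (ℕ × ℕ) ℂ → MvPolynomial (ℕ × ℕ) ℂ
  | [], p => p
  | a :: q, p => lowerList i q (lower i a p)

theorem lowerList_sub (i : ℕ) (q : List ℕ) (p p' : MvPolynomial (ℕ × ℕ) ℂ) :
    lowerList i q (p - p') = lowerList i q p - lowerList i q p' := by
  induction q generalizing p p' with
  | nil => rfl
  | cons a q ih => simp only [lowerList, map_sub, ih]

theorem lowerList_nsmul (i : ℕ) (q : List ℕ) (n : ℕ) (p : MvPolynomial (ℕ × ℕ) ℂ) :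
    lowerList i q (n • p) = n • lowerList i q p := by
  induction q generalizing p with
  | nil => rfl
  | cons a q ih => simp only [lowerList, map_nsmul, ih]

theorem lowerList_lowSpan {P : MvPolynomial (ℕ × ℕ) ℂ} {i : ℕ} (hP : ∀ a, lower i a P = 0)
    (q : List ℕ) {k l d e : ℕ} {p : MvPolynomial (ℕ × ℕ) ℂ}
    (hp : p ∈ lowSpan P i k (l + q.length) d e) :
    lowerList i q p ∈ lowSpan P i (k + q.length) l (d + q.sum) e := by
  induction q generalizing k d p with
  | nil => simpa [lowerList] using hp
  | cons a q ih =>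
    have := ih (lower_lowSpan (hP a) (l := l + q.length) (by simpa [add_assoc] using hp))
    simpa [lowerList, add_assoc, add_comm, add_left_comm] using this

/-- The leading term of the result of lowering. -/
theorem lowerList_mem {P : MvPolynomial (ℕ × ℕ) ℂ} {i : ℕ} (hP : ∀ a, lower i a P = 0)
    (q : List ℕ) (n : ℕ) (s t : Multiset ℕ) (ht : 0 ∉ t) :
    lowerList i q (P * colMonom i s * (X (i + 1, 0) ^ (n + q.length) * colMonom (i + 1) t)) -
      ((n + q.length).descFactorial q.length) •
        (P * colMonom i (s + q) * (X (i + 1, 0) ^ n * colMonom (i + 1) t)) ∈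
      lowSpan P i (s.card + q.length) (n + t.card) (s.sum + q.sum + t.sum) t.sum := by
  induction q generalizing s with
  | nil => simp [lowerList]
  | cons a q ih =>
    rcases Multiset.empty_or_exists_mem t with rfl | ⟨b, hb⟩
    -- For empty `t` the error space has bound `0` and is trivial, so the formula has to hold
    -- exactly.
    · have h1 : lower i a (P * colMonom i s * (X (i + 1, 0) ^ (n + (q.length + 1)) * colMonom (i + 1) 0)) =
          (n + (q.length + 1)) • (P * colMonom i (a ::ₘ s) * (X (i + 1, 0) ^ (n + q.length) * colMonom (i + 1) 0)) := by
        simp only [Derivation.leibniz, hP, lower_colMonom, Derivation.leibniz_pow, lower_X_succ,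
          smul_eq_mul, nsmul_eq_mul, colMonom_cons, zero_add, colMonom_zero, Derivation.map_one_eq_zero]
        rw [show n + (q.length + 1) - 1 = n + q.length by omega]
        ring
      have h2 := ih (a ::ₘ s)
      have e1 : (a ::ₘ s).card + q.length = s.card + (q.length + 1) := by simp; ring
      have e2 : (a ::ₘ s).sum + q.sum + (0 : Multiset ℕ).sum =
          s.sum + (a :: q).sum + (0 : Multiset ℕ).sum := by simp; ring
      rw [e1, e2] at h2
      rw [List.length_cons, lowerList, h1, lowerList_nsmul,
        show n + (q.length + 1) = n + q.length + 1 from rfl, Nat.succ_descFactorial_succ,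
        mul_smul, ← smul_sub, ← Multiset.cons_coe, Multiset.add_cons, ← Multiset.cons_add]
      exact nsmul_mem h2 (n + q.length + 1)
    · obtain ⟨l, hl⟩ : ∃ l, l + 1 = t.card := ⟨t.card - 1, by
        have := Multiset.card_pos_iff_exists_mem.2 ⟨b, hb⟩; omega⟩
      have h1 := lower_mul_mem (hP a) s t (k := s.card + 1) (l := l) rfl hl rfl
        (Or.inr ⟨ht, le_rfl⟩) (n + q.length + 1)
      have h2 := nsmul_mem (ih (a ::ₘ s)) (n + q.length + 1)
      rw [show n + q.length + 1 + l = (n + t.card) + q.length by omega] at h1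
      have h3 := lowerList_lowSpan hP q h1
      rw [lowerList_sub, lowerList_nsmul, Nat.add_sub_cancel] at h3
      have e1 : s.card + 1 + q.length = s.card + (a :: q).length := by simp; ring
      have e2 : s.sum + t.sum + a + q.sum = s.sum + (a :: q).sum + t.sum := by simp; ring
      have e3 : (a ::ₘ s).card + q.length = s.card + (a :: q).length := by simp; ring
      have e4 : (a ::ₘ s).sum + q.sum + t.sum = s.sum + (a :: q).sum + t.sum := by simp; ring
      rw [e1, e2] at h3
      rw [e3, e4] at h2
      convert add_mem h3 h2 using 1
      rw [List.length_cons, lowerList, ← add_assoc, Nat.succ_descFactorial_succ, mul_smul, smul_sub,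
        sub_add_sub_cancel, ← Multiset.cons_coe, Multiset.add_cons, Multiset.cons_add]

end WeylBasis
end

/-! ### Reducing the last row to good monomials. -/

noncomputable section
namespace WeylBasis

open MvPolynomial

variable {A : Type*} [Ring A] [Algebra ℂ A]

/-! ### Straightening of the last row -/

/-- The condition on the exponents in one place of a basis monomial. -/
def InF (m : ℕ) (s : Multiset ℕ) : Prop := ∀ a ∈ s, a + s.card ≤ m

theorem InF.card_le {m : ℕ} {s : Multiset ℕ} (h : InF m s) : s.card ≤ m := by
  rcases Multiset.empty_or_exists_mem s with rfl | ⟨a, ha⟩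
  · simp
  · exact le_trans (Nat.le_add_left _ _) (h a ha)

theorem lower_mem_rowHomog {j n : ℕ} {κ : ℤ} {d : ℕ} {p : MvPolynomial (ℕ × ℕ) ℂ}
    (hp : p ∈ rowHomog j n κ d) {i : ℕ} (hi : i ≤ j) (a : ℕ) :
    lower i a p ∈ rowHomog j n (κ - 1) (d + a) := by
  have := neg_mem (rowDer_mem_rowHomog hp hi (a := i + 1) a)
  rwa [show κ - (i + 1 : ℕ) + i = κ - 1 by push_cast; ring] at this

theorem lowerList_mem_rowHomog {j n : ℕ} {κ : ℤ} {d : ℕ} {p : MvPolynomial (ℕ × ℕ) ℂ}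
    (hp : p ∈ rowHomog j n κ d) {i : ℕ} (hi : i ≤ j) (q : List ℕ) :
    lowerList i q p ∈ rowHomog j n (κ - q.length) (d + q.sum) := by
  induction q generalizing κ d p with
  | nil => simpa [lowerList] using hp
  | cons a q ih =>
    have := ih (lower_mem_rowHomog hp hi a)
    rw [lowerList, List.length_cons, List.sum_cons]
    convert this using 1
    push_cast
    congr 1 <;> ring

section

variable {E : ℕ → ℕ → ℕ → A} {r j : ℕ} (hE : IsCurrent E r) (hj : j + 1 ≤ r) {m : ℕ → ℕ}
  {Z W : Submodule ℂ A} {v : A}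

/-- Moving a lowering operator to the left past a row polynomial `p` either applies `lower` to `p`
or leaves the operator in front. In the second case fewer lowerings reach `p`, so `κ` stays larger,
and the term lies in `W` by `IH` and stability. -/
theorem rowHom_mul_prod_sub_mem (hW : IsStable E j W) {i : ℕ} (hi : i < j) (q : List ℕ) {n : ℕ}
    {κ : ℤ} {d : ℕ} {p : MvPolynomial (ℕ × ℕ) ℂ} (hp : p ∈ rowHomog j n κ d)
    (IH : ∀ κ' > κ - q.length, ∀ d, ∀ p ∈ rowHomog j n κ' d, rowHom hE hj p * v ∈ W) :
    rowHom hE hj p * ((q.map (E (i + 1) i)).prod * v) - rowHom hE hj (lowerList i q p) * v ∈ W := by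
  induction q generalizing κ d p with
  | nil => simp [lowerList]
  | cons a q ih =>
    have hlen : κ - (a :: q).length < κ - q.length := by simp
    have h1 := ih hp fun κ' hκ => IH κ' (hlen.trans hκ)
    have h2 := IH _ hlen _ _ (lowerList_mem_rowHomog hp hi.le q)
    have h3 := hW (i + 1) i a (by omega) (by omega) _ (add_mem h1 h2)
    rw [sub_add_cancel] at h3
    have h4 := ih (lower_mem_rowHomog hp hi.le a) fun κ' hκ => IH κ' (by
      rw [List.length_cons]; push_cast; linarith)
    have h5 := mul_rowHom hE hj (show i + 1 ≤ j by omega) hi.le a p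
    have h6 : rowHom hE hj p * E (i + 1) i a =
        E (i + 1) i a * rowHom hE hj p + rowHom hE hj (lower i a p) := by
      rw [h5, lower, Derivation.neg_apply, map_neg]
      abel
    convert add_mem h3 h4 using 1
    rw [List.map_cons, List.prod_cons, mul_assoc (E _ _ _), ← mul_assoc (rowHom hE hj p), h6, lowerList,
      add_mul, mul_assoc]
    abel

theorem rowHom_rename {i : ℕ} (hi : i ≤ j)
    (hc : ∀ a b, E (j + 1) i a * E (j + 1) i b = E (j + 1) i b * E (j + 1) i a)
    (p : MvPolynomial ℕ ℂ) :
    rowHom hE hj (rename (Prod.mk i) p) = commHom (E (j + 1) i) hc p := by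
  induction p using MvPolynomial.induction_on with
  | C a => simp [← algebraMap_eq]
  | add p q h1 h2 => rw [map_add, map_add, map_add, h1, h2]
  | mul_X p k ih => rw [map_mul, map_mul, map_mul, ih, rename_X, rowHom_X _ _ hi, commHom_X]

theorem commHom_monom {σ : Type*} (x : σ → A) (h : ∀ i j, x i * x j = x j * x i) (q : List σ) :
    commHom x h (monom (q : Multiset σ)) = (q.map x).prod := by
  induction q with
  | nil => simp
  | cons a q ih => rw [← Multiset.cons_coe, monom_cons, map_mul, ih, commHom_X, List.map_cons, List.prod_cons]

theorem lower_comm {B : Type*} [Ring B] {E : ℕ → ℕ → ℕ → B} {r : ℕ} (hE : IsCurrent E r) {i : ℕ} (hi : i < r) (a b : ℕ) :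
    E (i + 1) i a * E (i + 1) i b = E (i + 1) i b * E (i + 1) i a := by
  rw [hE _ _ _ _ (by omega) (by omega) (by omega) (by omega), if_neg (by omega)]
  simp

theorem colMonom_sum_fst (i : ℕ) (s : Multiset ℕ) :
    ((s.map (Prod.mk i)).map fun x => (x.1 : ℤ)).sum = i * s.card := by
  simp [mul_comm]

/-- The spare `q.length` copies of `X (i+1, 0)` absorb the lowering operators: each turns one copy
into `X (i, a)`, which writes the monomial of `q` into column `i`. -/
theorem rowHom_mul_prod_sub_smul_mem (hW : IsStable E j W) {i : ℕ} (hi : i < j)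
    {π : Multiset (ℕ × ℕ)} (hπ : ∀ x ∈ π, x.1 ≤ j ∧ x.1 ≠ i + 1) (q : List ℕ) (n : ℕ)
    {t : Multiset ℕ} (ht : 0 ∉ t)
    (IH : ∀ κ' > (π.map fun x => (x.1 : ℤ)).sum + i * q.length + (i + 1) * (n + t.card), ∀ d,
      ∀ p ∈ rowHomog j (π.card + q.length + (n + t.card)) κ' d, rowHom hE hj p * v ∈ W) :
    rowHom hE hj (monom π * (X (i + 1, 0) ^ (n + q.length) * colMonom (i + 1) t)) *
        ((q.map (E (i + 1) i)).prod * v) -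
      ((n + q.length).descFactorial q.length : ℂ) •
        (rowHom hE hj (monom π * colMonom i q * (X (i + 1, 0) ^ n * colMonom (i + 1) t)) * v) ∈
      W ⊔ (lowSpan (monom π) i q.length (n + t.card) (q.sum + t.sum) t.sum).map
        ((LinearMap.mulRight ℂ v).comp (rowHom hE hj).toLinearMap) := by
  have hP : ∀ a, lower i a (monom π) = 0 := fun a => lower_monom_eq_zero fun x hx => (hπ x hx).2
  have hyσ : monom π * (X (i + 1, 0) ^ (n + q.length) * colMonom (i + 1) t) =
      monom (π + (Multiset.replicate (n + q.length) (i + 1, 0) + t.map (Prod.mk (i + 1)))) := by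
    rw [monom_add, monom_add, monom_replicate, colMonom]
  have hyhom := monom_mem_rowHomog (j := j)
      (σ := π + (Multiset.replicate (n + q.length) (i + 1, 0) + t.map (Prod.mk (i + 1)))) (by
    intro x hx
    rcases Multiset.mem_add.1 hx with hx | hx
    · exact (hπ x hx).1
    · rcases Multiset.mem_add.1 hx with hx | hx
      · rw [Multiset.eq_of_mem_replicate hx]; exact hi
      · obtain ⟨b, -, rfl⟩ := Multiset.mem_map.1 hx
        exact hi)
  rw [← hyσ] at hyhom
  have h1 := rowHom_mul_prod_sub_mem hE hj hW hi q hyhom (v := v) (by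
    intro κ' hκ d p hp
    refine IH κ' ?_ d p ?_
    · refine lt_of_eq_of_lt ?_ hκ
      simp
      ring
    · convert hp using 2
      simp
      ring)
  have h2 := lowerList_mem hP q n 0 t ht
  simp only [colMonom_zero, mul_one, zero_add, Multiset.card_zero, Multiset.sum_zero] at h2
  have h3 := Submodule.mem_map_of_mem (f := (LinearMap.mulRight ℂ v).comp (rowHom hE hj).toLinearMap) h2
  have h4 := Submodule.add_mem_sup h1 h3
  rw [LinearMap.comp_apply, AlgHom.toLinearMap_apply, LinearMap.mulRight_apply, map_sub, map_nsmul,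
    sub_mul, smul_mul_assoc, sub_add_sub_cancel, ← Nat.cast_smul_eq_nsmul ℂ] at h4
  exact h4

/-- The relations in the column `i` of the last row. -/
theorem rowHom_relSpan_mul_mem (hZ : IsStable E (j + 1) Z) (hv : IsHighest E (j + 1) m Z v)
    (hZW : Z ≤ W) (hW : IsStable E j W) {i : ℕ} (hi : i < j) {π : Multiset (ℕ × ℕ)}
    (hπ : ∀ x ∈ π, x.1 ≤ j ∧ x.1 ≠ i + 1) {k d : ℕ} {t : Multiset ℕ}
    (IH : ∀ κ' > (π.map fun x => (x.1 : ℤ)).sum + i * k + (i + 1) * t.card, ∀ d,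
      ∀ p ∈ rowHomog j (π.card + k + t.card) κ' d, rowHom hE hj p * v ∈ W)
    {p : MvPolynomial ℕ ℂ} (hp : p ∈ relSpan (m i) k d) :
    rowHom hE hj (monom π * rename (Prod.mk i) p * colMonom (i + 1) t) * v ∈
      W ⊔ (lowSpan (monom π) i k t.card (d + t.sum) t.sum).map
        ((LinearMap.mulRight ℂ v).comp (rowHom hE hj).toLinearMap) := by
  obtain ⟨N, hN⟩ : ∃ N, N = W ⊔ (lowSpan (monom π) i k t.card (d + t.sum) t.sum).map
        ((LinearMap.mulRight ℂ v).comp (rowHom hE hj).toLinearMap) := ⟨_, rfl⟩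
  rw [← hN]
  obtain ⟨n, t₀, ht₀, rfl⟩ := exists_eq_replicate_zero_add t
  have hcol : colMonom (i + 1) (Multiset.replicate n 0 + t₀) = X (i + 1, 0) ^ n * colMonom (i + 1) t₀ := by
    rw [colMonom, Multiset.map_add, monom_add, Multiset.map_replicate, monom_replicate, colMonom]
  simp only [Multiset.card_add, Multiset.card_replicate, Multiset.sum_add, Multiset.sum_replicate,
    smul_zero, zero_add, Nat.cast_add] at IH hN
  rw [hcol]
  have hc := lower_comm hE (show i < r by omega)
  -- Column `i+1` is padded with `k` extra factors `X (i+1, 0)`, one for each lowering operator;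
  -- this factor counts the ways they are consumed and can be divided out.
  have hc0 : ((n + k).descFactorial k : ℂ) ≠ 0 :=
    Nat.cast_ne_zero.2 (Nat.descFactorial_eq_zero_iff_lt.not.2 (by omega))
  -- The comparison between operators applied to `v` and monomials written in column `i` is linear,
  -- so it extends from monomials to the relation `p`, for which the operator side lies in `Z`.
  have key : bihom k d ≤ N.comap
      (((LinearMap.mulLeft ℂ (rowHom hE hj (monom π * (X (i + 1, 0) ^ (n + k) * colMonom (i + 1) t₀)))).comp
        ((LinearMap.mulRight ℂ v).comp (commHom _ hc).toLinearMap)) -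
      ((n + k).descFactorial k : ℂ) • ((LinearMap.mulRight ℂ v).comp ((rowHom hE hj).toLinearMap.comp
        ((LinearMap.mulRight ℂ (X (i + 1, 0) ^ n * colMonom (i + 1) t₀)).comp
          ((LinearMap.mulLeft ℂ (monom π)).comp (rename (Prod.mk i)).toLinearMap))))) := by
    refine Submodule.span_le.2 ?_
    rintro _ ⟨s, hs, hd, rfl⟩
    induction s using Quotient.inductionOn with | h q => ?_
    change (q : Multiset ℕ).card = k at hs
    change (q : Multiset ℕ).sum = d at hd
    rw [Multiset.coe_card] at hs
    rw [Multiset.sum_coe] at hd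
    subst hs hd
    have h1 := rowHom_mul_prod_sub_smul_mem hE hj hW hi hπ q n ht₀ IH
    rw [← hN, ← commHom_monom _ hc,
      show colMonom i q = rename (Prod.mk i) (monom (q : Multiset ℕ)) from monom_map _ _] at h1
    exact h1
  have h1 := key (relSpan_le_bihom _ _ _ hp)
  have h2 : rowHom hE hj (monom π * (X (i + 1, 0) ^ (n + k) * colMonom (i + 1) t₀)) *
      (commHom _ hc p * v) ∈ N := hN ▸ Submodule.mem_sup_left (hZW
    (rowHom_mul_mem hE hj hZ _ (hv.mul_relSpan_mem hE hj hZ (by omega) hc hp)))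
  have h3 := N.smul_mem ((n + k).descFactorial k : ℂ)⁻¹ (sub_mem h2 h1)
  simp only [LinearMap.sub_apply, LinearMap.comp_apply, LinearMap.smul_apply,
    AlgHom.toLinearMap_apply, LinearMap.mulLeft_apply, LinearMap.mulRight_apply] at h3
  rwa [sub_sub_cancel, smul_smul, inv_mul_cancel₀ hc0, one_smul] at h3

theorem filter_eq_of_two (i : ℕ) (σ : Multiset (ℕ × ℕ)) :
    σ = (σ.filter fun x => x.1 ≠ i ∧ x.1 ≠ i + 1) + (part i σ).map (Prod.mk i) +
      (part (i + 1) σ).map (Prod.mk (i + 1)) := by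
  rw [part_filter, part_filter]
  ext x
  simp only [Multiset.count_add, Multiset.count_filter]
  by_cases h1 : x.1 = i
  · have h2 : x.1 ≠ i + 1 := by omega
    simp [h1]
  · by_cases h2 : x.1 = i + 1 <;> simp [h1, h2]

/-- If the monomials satisfying the basis conditions in the last row act into `W`, then so do all
monomials of the same degrees. -/
theorem rowHom_monom_mul_mem (hZ : IsStable E (j + 1) Z) (hv : IsHighest E (j + 1) m Z v)
    (hZW : Z ≤ W) (hW : IsStable E j W) {n : ℕ} {κ : ℤ} {d : ℕ}
    (IH : ∀ κ' > κ, ∀ d, ∀ p ∈ rowHomog j n κ' d, rowHom hE hj p * v ∈ W)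
    (hgood : ∀ σ : Multiset (ℕ × ℕ), (∀ x ∈ σ, x.1 ≤ j) → σ.card = n →
      (σ.map fun x => (x.1 : ℤ)).sum = κ → (σ.map Prod.snd).sum = d →
      (∀ i ≤ j, InF (m i) (part i σ)) → rowHom hE hj (monom σ) * v ∈ W)
    (i : ℕ) (hi : i ≤ j + 1) (σ : Multiset (ℕ × ℕ)) (hσ : ∀ x ∈ σ, x.1 ≤ j) (hn : σ.card = n)
    (hκ : (σ.map fun x => (x.1 : ℤ)).sum = κ) (hd : (σ.map Prod.snd).sum = d)
    (hσi : ∀ i' < i, InF (m i') (part i' σ)) : rowHom hE hj (monom σ) * v ∈ W := by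
  -- The columns are made good from left to right: those below `i` already are, and correcting
  -- column `i` disturbs only columns `i` and `i+1`.
  induction hi using Nat.decreasingInduction generalizing σ with
  | self => exact hgood σ hσ hn hκ hd fun i hi => hσi i (by omega)
  | of_succ i hi ih =>
    -- Replacing a relation in column `i` leaves monomials of strictly smaller weight in column
    -- `i+1`.
    induction hT : (part (i + 1) σ).sum using Nat.strong_induction_on generalizing σ with
    | _ T ihT =>
    set π := σ.filter fun x => x.1 ≠ i ∧ x.1 ≠ i + 1 with hπ
    have hσeq := filter_eq_of_two i σ
    rw [← hπ] at hσeq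
    set s := part i σ with hs
    set t := part (i + 1) σ with ht
    have hparts : ∀ s' t' : Multiset ℕ, ∀ i' : ℕ,
        part i' (π + s'.map (Prod.mk i) + t'.map (Prod.mk (i + 1))) =
          if i' = i then s' else if i' = i + 1 then t' else part i' σ := by
      intro s' t' i'
      rw [part_add, part_add, part_map, part_map]
      have h0 : part i' π = if i' = i ∨ i' = i + 1 then 0 else part i' σ := by
        unfold part
        rw [hπ, Multiset.filter_filter]
        split_ifs with h
        · rw [Multiset.filter_eq_nil.2]
          · rfl
          · rintro a - ⟨h1, h2, h3⟩
            omega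
        · congr 1
          refine Multiset.filter_congr fun x _ => ?_
          constructor
          · exact fun h => h.1
          · exact fun h' => ⟨h', by omega⟩
      rw [h0]
      by_cases h1 : i' = i
      · subst h1; simp
      · by_cases h2 : i' = i + 1
        · subst h2; simp
        · simp [h1, h2, Ne.symm h1, Ne.symm h2]
    have hnew : ∀ s' t' : Multiset ℕ, s'.card = s.card → t'.card = t.card →
        s'.sum + t'.sum = s.sum + t.sum → (i + 1 ≤ j ∨ t' = 0) →
        (∀ x ∈ π + s'.map (Prod.mk i) + t'.map (Prod.mk (i + 1)), x.1 ≤ j) ∧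
        (π + s'.map (Prod.mk i) + t'.map (Prod.mk (i + 1))).card = n ∧
        ((π + s'.map (Prod.mk i) + t'.map (Prod.mk (i + 1))).map fun x => (x.1 : ℤ)).sum = κ ∧
        ((π + s'.map (Prod.mk i) + t'.map (Prod.mk (i + 1))).map Prod.snd).sum = d := by
      intro s' t' h1 h2 h3 h4
      refine ⟨?_, ?_, ?_, ?_⟩
      · intro x hx
        rcases Multiset.mem_add.1 hx with hx | hx
        · rcases Multiset.mem_add.1 hx with hx | hx
          · exact hσ x (Multiset.mem_of_mem_filter hx)
          · obtain ⟨b, -, rfl⟩ := Multiset.mem_map.1 hx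
            exact Nat.lt_succ_iff.1 hi
        · rcases h4 with h4 | rfl
          · obtain ⟨b, -, rfl⟩ := Multiset.mem_map.1 hx
            exact h4
          · simp at hx
      · rw [← hn]
        conv_rhs => rw [hσeq]
        simp [h1, h2]
      · rw [← hκ]
        conv_rhs => rw [hσeq]
        simp only [Multiset.map_add, Multiset.sum_add, colMonom_sum_fst, h1, h2]
      · rw [← hd]
        conv_rhs => rw [hσeq]
        simp only [Multiset.map_add, Multiset.sum_add, Multiset.map_map, Function.comp_def,
          Multiset.map_id']
        omega
    have hmon : ∀ s' t' : Multiset ℕ, monom (π + s'.map (Prod.mk i) + t'.map (Prod.mk (i + 1))) =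
        monom π * rename (Prod.mk i) (monom s') * colMonom (i + 1) t' := by
      intro s' t'
      rw [monom_add, monom_add, monom_map _ s', colMonom]
    have ht0 : i + 1 ≤ j ∨ t = 0 := by
      by_contra! h
      obtain ⟨b, hb⟩ := Multiset.exists_mem_of_ne_zero h.2
      rw [ht, part] at hb
      obtain ⟨x, hx, -⟩ := Multiset.mem_map.1 hb
      have h1 := hσ x (Multiset.mem_of_mem_filter hx)
      have h2 := (Multiset.mem_filter.1 hx).2
      omega
    rw [hσeq, hmon]
    obtain ⟨g, hg, q, hq, hgq⟩ := Submodule.mem_sup.1 (bihom_le_goodSpan_sup_relSpan (m i) s.card s.sum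
      (Submodule.subset_span ⟨s, rfl, rfl, rfl⟩))
    rw [← hgq, map_add, mul_add, add_mul, map_add, add_mul]
    refine add_mem ?_ ?_
    · clear hgq
      induction hg using Submodule.span_induction with
      | mem g hg =>
        obtain ⟨s', h1, h2, h3, rfl⟩ := hg
        rw [← hmon]
        obtain ⟨n1, n2, n3, n4⟩ := hnew s' t h1 rfl (by rw [h2]) ht0
        refine ih _ n1 n2 n3 n4 fun i' hi' => ?_
        rw [hparts]
        rcases Nat.lt_succ_iff_lt_or_eq.1 hi' with hi' | rfl
        · rw [if_neg (by omega), if_neg (by omega)]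
          exact hσi i' hi'
        · rw [if_pos rfl]
          intro a ha
          rw [h1]
          exact h3 a ha
      | zero => simp
      | add p q _ _ h1 h2 => simp only [map_add, mul_add, add_mul]; exact add_mem h1 h2
      | smul c p _ h => simp only [map_smul, mul_smul_comm, smul_mul_assoc]; exact W.smul_mem _ h
    · rcases Nat.lt_or_ge i j with hij | hij
      · have hπ' : ∀ x ∈ π, x.1 ≤ j ∧ x.1 ≠ i + 1 := fun x hx =>
          ⟨hσ x (Multiset.mem_of_mem_filter hx), (Multiset.mem_filter.1 hx).2.2⟩
        have h1 := rowHom_relSpan_mul_mem hE hj hZ hv hZW hW hij hπ' (k := s.card) (t := t) (by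
          intro κ' hκ' d p hp
          refine IH κ' ?_ d p ?_
          · refine lt_of_eq_of_lt ?_ hκ'
            rw [← hκ]
            conv_lhs => rw [hσeq]
            simp only [Multiset.map_add, Multiset.sum_add, colMonom_sum_fst]
            push_cast
            ring
          · convert hp using 2
            rw [← hn]
            conv_lhs => rw [hσeq]
            simp) hq
        refine (sup_le le_rfl ?_ : W ⊔ _ ≤ W) h1
        rw [Submodule.map_le_iff_le_comap]
        refine Submodule.span_le.2 ?_
        rintro _ ⟨s', t', h1, h2, h3, h4, rfl⟩
        change rowHom hE hj (monom π * monom (s'.map (Prod.mk i)) * colMonom (i + 1) t') * v ∈ W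
        rw [monom_map, ← hmon]
        obtain ⟨n1, n2, n3, n4⟩ := hnew s' t' h1 h2 h3 (Or.inl hij)
        refine ihT t'.sum (hT ▸ h4) _ n1 n2 n3 n4 (fun i' hi' => ?_) ?_
        · rw [hparts, if_neg (by omega), if_neg (by omega)]
          exact hσi i' hi'
        · rw [hparts, if_neg (by omega), if_pos rfl]
      -- In the last column the row elements are themselves the simple root vectors, and Garland's
      -- relations apply directly to `v`.
      · obtain rfl : i = j := by omega
        rcases ht0 with h | h
        · omega
        rw [h, colMonom_zero, mul_one, map_mul, mul_assoc,
          rowHom_rename hE hj le_rfl (lower_comm hE (by omega))]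
        exact hZW (rowHom_mul_mem hE hj hZ _ (hv.mul_relSpan_mem hE hj hZ (by omega) _ hq))

end

end WeylBasis
end

/-! ### From last-row monomials to highest weight vectors of the smaller algebra. -/

noncomputable section
namespace WeylBasis

open MvPolynomial

variable {A : Type*} [Ring A] [Algebra ℂ A]

/-- The highest weight for the remaining rows when the entries of the last row have degrees `l`. -/
def nextWeight (m l : ℕ → ℕ) (i : ℕ) : ℕ := m i - l i + l (i + 1)

/-- The monomial in the elements of the last row. -/
def rowProd (E : ℕ → ℕ → ℕ → A) (j : ℕ) (s : ℕ → Multiset ℕ) : A :=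
  ((List.range (j + 1)).map fun i => (((s i).sort (· ≤ ·)).map (E (j + 1) i)).prod).prod

/-- The basis monomials for the first `j` rows. -/
def basisMon (E : ℕ → ℕ → ℕ → A) : ℕ → (ℕ → ℕ) → Set A
  | 0, _ => {1}
  | j + 1, m => {x | ∃ s : ℕ → Multiset ℕ, (∀ i ≤ j, InF (m i) (s i)) ∧
      ∃ b ∈ basisMon E j (nextWeight m fun i => (s i).card), x = b * rowProd E j s}

section

variable {E : ℕ → ℕ → ℕ → A} {r j : ℕ} (hE : IsCurrent E r) (hj : j + 1 ≤ r) {m : ℕ → ℕ}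
  {Z W : Submodule ℂ A} {v : A}

theorem rowHom_colMonom {i : ℕ} (hi : i ≤ j) (t : Multiset ℕ) :
    rowHom hE hj (colMonom i t) = ((t.sort (· ≤ ·)).map (E (j + 1) i)).prod := by
  have hc : ∀ a b, E (j + 1) i a * E (j + 1) i b = E (j + 1) i b * E (j + 1) i a := by
    intro a b
    rw [← rowHom_X hE hj hi, ← rowHom_X hE hj hi, ← map_mul, mul_comm, map_mul]
  rw [colMonom, monom_map, rowHom_rename hE hj hi hc, ← commHom_monom _ hc, Multiset.sort_eq]

theorem monom_eq_prod_colMonom {N : ℕ} {σ : Multiset (ℕ × ℕ)} (hσ : ∀ x ∈ σ, x.1 < N) :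
    monom σ = ((List.range N).map fun i => colMonom i (part i σ)).prod := by
  have h1 : σ = ∑ i ∈ Finset.range N, (part i σ).map (Prod.mk i) := by
    simp only [part_filter]
    ext x
    rw [Multiset.count_sum']
    simp only [Multiset.count_filter]
    rw [Finset.sum_ite_eq]
    split_ifs with h
    · rfl
    · rw [Multiset.count_eq_zero]
      exact fun hx => h (Finset.mem_range.2 (hσ x hx))
  have h2 : ∀ N (s : ℕ → Multiset ℕ), monom (∑ i ∈ Finset.range N, (s i).map (Prod.mk i)) =
      ((List.range N).map fun i => colMonom i (s i)).prod := by
    intro N s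
    induction N with
    | zero => simp
    | succ N ih => rw [Finset.sum_range_succ, monom_add, ih, List.range_succ]; simp [colMonom]
  rw [← h2, ← h1]

theorem rowHom_monom_eq {σ : Multiset (ℕ × ℕ)} (hσ : ∀ x ∈ σ, x.1 ≤ j) :
    rowHom hE hj (monom σ) = rowProd E j fun i => part i σ := by
  rw [monom_eq_prod_colMonom (N := j + 1) fun x hx => Nat.lt_succ_iff.2 (hσ x hx), map_list_prod,
    List.map_map, rowProd]
  congr 1
  refine List.map_congr_left fun i hi => ?_
  exact rowHom_colMonom hE hj (Nat.lt_succ_iff.1 (List.mem_range.1 hi)) _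

/-- A crude bound that makes `sl₂` theory applicable: bracketing twice with `E_{i+1,i}` kills every
row element, so each further factor costs one more power. -/
theorem exists_pow_mul_rowHom_monom_mem (hZ : IsStable E (j + 1) Z) {i : ℕ} (hi : i < j) {k : ℕ}
    (hk : E (i + 1) i 0 ^ k * v ∈ Z) (σ : Multiset (ℕ × ℕ)) :
    ∃ N, E (i + 1) i 0 ^ N * (rowHom hE hj (monom σ) * v) ∈ Z := by
  induction σ using Multiset.induction_on with
  | empty => exact ⟨k, by simpa using hk⟩
  | cons x σ ih =>
    obtain ⟨N, hN⟩ := ih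
    have h1 := mul_rowHom hE hj (show i + 1 ≤ j by omega) hi.le 0 (X x)
    have h2 := mul_rowHom hE hj (show i + 1 ≤ j by omega) hi.le 0 (rowDer (i + 1) i 0 (X x))
    have h3 : rowDer (i + 1) i 0 (rowDer (i + 1) i 0 (X x)) = 0 := by
      rw [rowDer_X (x := x)]
      split_ifs <;> simp
    rw [h3, map_zero, add_zero] at h2
    refine ⟨N + 1, ?_⟩
    rw [monom_cons, map_mul, mul_assoc, ← mul_assoc, pow_mul_of_commutator h1 h2, add_mul, mul_assoc,
      smul_mul_assoc, mul_assoc]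
    refine add_mem (rowHom_mul_mem hE hj hZ _ ?_) (nsmul_mem (rowHom_mul_mem hE hj hZ _ hN) _)
    rw [pow_succ', mul_assoc]
    exact hZ _ _ _ (by omega) (by omega) _ hN

/-- A basis monomial in the last row yields a highest weight vector for the remaining rows. -/
theorem isHighest_rowHom_monom (hZ : IsStable E (j + 1) Z) (hv : IsHighest E (j + 1) m Z v)
    (hZW : Z ≤ W) (hW : IsStable E j W) {n : ℕ} {κ : ℤ} {d : ℕ}
    (IH : ∀ κ' > κ, ∀ d, ∀ p ∈ rowHomog j n κ' d, rowHom hE hj p * v ∈ W)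
    (IH' : ∀ d' > d, ∀ p ∈ rowHomog j n κ d', rowHom hE hj p * v ∈ W)
    {σ : Multiset (ℕ × ℕ)} (hσ : monom σ ∈ rowHomog j n κ d)
    (hgood : ∀ i ≤ j, InF (m i) (part i σ)) :
    IsHighest E j (nextWeight m fun i => (part i σ).card) W (rowHom hE hj (monom σ) * v) := by
  have hmul : ∀ a b k, a ≤ j → b ≤ j → E a b k * (rowHom hE hj (monom σ) * v) =
      rowHom hE hj (monom σ) * (E a b k * v) + rowHom hE hj (rowDer a b k (monom σ)) * v := by
    intro a b k ha hb
    rw [← mul_assoc, mul_rowHom hE hj ha hb, add_mul, mul_assoc]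
  have hraise : ∀ a b k, a < b → b ≤ j → E a b k * (rowHom hE hj (monom σ) * v) ∈ W := by
    intro a b k hab hb
    rw [hmul _ _ _ (by omega) hb]
    refine add_mem (hZW (rowHom_mul_mem hE hj hZ _ (hv.raise _ _ _ hab (by omega)))) ?_
    refine IH _ ?_ _ _ (rowDer_mem_rowHomog hσ hb k)
    have : (a : ℤ) < b := by exact_mod_cast hab
    linarith
  obtain ⟨μ, hμ, hμm⟩ := hv.weight
  have hweight : ∀ a ≤ j, E a a 0 * (rowHom hE hj (monom σ) * v) -
      (μ a - (part a σ).card) • (rowHom hE hj (monom σ) * v) ∈ W := by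
    intro a ha
    rw [hmul _ _ _ ha ha, rowDer_diag_monom]
    have := hZW (rowHom_mul_mem hE hj hZ (monom σ) (hμ a (by omega)))
    convert this using 1
    rw [mul_sub, mul_smul_comm, map_smul, smul_mul_assoc]
    module
  -- The truncated subtraction in `nextWeight` is a true one here, since a good column has at most
  -- `m i` entries.
  have hdiff : ∀ i < j, μ i - (part i σ).card - (μ (i + 1) - (part (i + 1) σ).card) =
      (nextWeight m (fun i => (part i σ).card) i : ℂ) := by
    intro i hi
    have := hμm i (by omega)
    rw [nextWeight, Nat.cast_add, Nat.cast_sub (hgood i hi.le).card_le, ← this]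
    ring
  refine ⟨hraise, ?_, ⟨_, hweight, hdiff⟩, ?_⟩
  · intro a k ha
    rw [hmul _ _ _ ha ha]
    refine add_mem (hZW (rowHom_mul_mem hE hj hZ _ (hv.diag _ _ (by omega)))) ?_
    have := rowDer_mem_rowHomog hσ ha (a := a) (k + 1)
    rw [sub_add_cancel] at this
    exact IH' _ (by omega) _ this
  -- Some power already kills the vector; its `sl₂` weight then sharpens the exponent to `nextWeight
  -- + 1`.
  · intro i hi
    obtain ⟨N, hN⟩ := exists_pow_mul_rowHom_monom_mem hE hj hZ hi (hv.nilp i (by omega)) σ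
    refine pow_mul_mem_of_highest (e := E i (i + 1) 0) (h := E i i 0 - E (i + 1) (i + 1) 0) ?_ ?_ W
      (hW _ _ _ (by omega) (by omega)) (hW _ _ _ (by omega) (by omega))
      (hraise _ _ _ (by omega) (by omega)) ?_ (hZW hN)
    · rw [hE _ _ _ _ (by omega) (by omega) (by omega) (by omega), if_pos rfl, if_pos rfl]
    · rw [sub_mul, hE i i (i + 1) i (by omega) (by omega) (by omega) (by omega),
        hE (i + 1) (i + 1) (i + 1) i (by omega) (by omega) (by omega) (by omega), if_neg (by omega),
        if_pos rfl, if_pos rfl, if_neg (by omega), mul_sub, two_smul]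
      abel
    · convert sub_mem (hweight i hi.le) (hweight (i + 1) hi) using 1
      rw [← hdiff i hi, sub_mul]
      module

theorem sum_snd_le_of_InF {M : ℕ} {σ : Multiset (ℕ × ℕ)} (hσ : ∀ x ∈ σ, x.1 ≤ j)
    (hM : ∀ i ≤ j, m i ≤ M) (hgood : ∀ i ≤ j, InF (m i) (part i σ)) :
    (σ.map Prod.snd).sum ≤ σ.card * M := by
  have : ∀ y ∈ σ.map Prod.snd, y ≤ M := by
    intro y hy
    obtain ⟨x, hx, rfl⟩ := Multiset.mem_map.1 hy
    have h1 := hgood x.1 (hσ x hx) x.2 (Multiset.mem_map.2 ⟨x, Multiset.mem_filter.2 ⟨hx, rfl⟩, rfl⟩)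
    have h2 := hM x.1 (hσ x hx)
    omega
  have := Multiset.sum_le_card_nsmul _ _ this
  simpa using this

/-- If highest weight vectors obtained from basis monomials in the last row lie in `W`, then all
polynomials in the last row act into `W`. -/
theorem rowHom_mul_mem_of_isHighest (hZ : IsStable E (j + 1) Z) (hv : IsHighest E (j + 1) m Z v)
    (hZW : Z ≤ W) (hW : IsStable E j W)
    (hhigh : ∀ σ : Multiset (ℕ × ℕ), (∀ x ∈ σ, x.1 ≤ j) → (∀ i ≤ j, InF (m i) (part i σ)) →
      IsHighest E j (nextWeight m fun i => (part i σ).card) W (rowHom hE hj (monom σ) * v) →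
      rowHom hE hj (monom σ) * v ∈ W)
    {σ : Multiset (ℕ × ℕ)} (hσ : ∀ x ∈ σ, x.1 ≤ j) : rowHom hE hj (monom σ) * v ∈ W := by
  obtain ⟨M, hM⟩ : ∃ M, ∀ i ≤ j, m i ≤ M :=
    ⟨∑ i ∈ Finset.range (j + 1), m i, fun i hi =>
      Finset.single_le_sum (f := m) (fun _ _ => Nat.zero_le _) (Finset.mem_range.2 (by omega))⟩
  -- Descending induction on `κ`, counted by `K`: no monomial of degree `n` has column sum above `n
  -- * j`.
  have main : ∀ (n K : ℕ) (κ : ℤ), (n : ℤ) * j < κ + K → ∀ d, ∀ p ∈ rowHomog j n κ d,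
      rowHom hE hj p * v ∈ W := by
    intro n K
    induction K with
    | zero =>
      intro κ hκ d
      change rowHomog j n κ d ≤ W.comap ((LinearMap.mulRight ℂ v).comp (rowHom hE hj).toLinearMap)
      refine Submodule.span_le.2 ?_
      rintro _ ⟨σ, hσ, rfl, rfl, rfl, rfl⟩
      exfalso
      have : ∀ y ∈ σ.map (fun x => (x.1 : ℤ)), y ≤ j := by
        intro y hy
        obtain ⟨x, hx, rfl⟩ := Multiset.mem_map.1 hy
        exact_mod_cast hσ x hx
      have := Multiset.sum_le_card_nsmul _ _ this
      simp at this hκ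
      omega
    | succ K ihK =>
      intro κ hκ
      have IH : ∀ κ' > κ, ∀ d, ∀ p ∈ rowHomog j n κ' d, rowHom hE hj p * v ∈ W :=
        fun κ' hκ' => ihK κ' (by push_cast at hκ; omega)
      -- For fixed `κ`, descending induction on `d`: good monomials have total exponent at most `n *
      -- M`, so above that straightening leaves nothing.
      have inner : ∀ (D d : ℕ), n * M < d + D → ∀ p ∈ rowHomog j n κ d, rowHom hE hj p * v ∈ W := by
        intro D
        induction D with
        | zero =>
          intro d hd
          change rowHomog j n κ d ≤ W.comap ((LinearMap.mulRight ℂ v).comp (rowHom hE hj).toLinearMap)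
          refine Submodule.span_le.2 ?_
          rintro _ ⟨σ, hσ, hn, hκ, hd', rfl⟩
          refine rowHom_monom_mul_mem hE hj hZ hv hZW hW IH ?_ 0 (by omega) σ hσ hn hκ hd' (by simp)
          intro τ hτ hn _ hd' hg
          exfalso
          have := sum_snd_le_of_InF hτ hM hg
          rw [hn, hd'] at this
          omega
        | succ D ihD =>
          intro d hd
          change rowHomog j n κ d ≤ W.comap ((LinearMap.mulRight ℂ v).comp (rowHom hE hj).toLinearMap)
          refine Submodule.span_le.2 ?_
          rintro _ ⟨σ, hσ, hn, hκ, hd', rfl⟩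
          refine rowHom_monom_mul_mem hE hj hZ hv hZW hW IH ?_ 0 (by omega) σ hσ hn hκ hd' (by simp)
          intro τ hτ hn hκ hd' hg
          refine hhigh τ hτ hg (isHighest_rowHom_monom hE hj hZ hv hZW hW IH
            (d := d) (fun d' hd' => ihD d' (by omega)) ?_ hg)
          exact Submodule.subset_span ⟨τ, hτ, hn, hκ, hd', rfl⟩
      exact fun d => inner (n * M + 1) d (by omega)
  refine main _ ((σ.card : ℤ) * j - (σ.map fun x => (x.1 : ℤ)).sum + 1).toNat _ ?_ _ _ (monom_mem_rowHomog hσ)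
  have := Int.self_le_toNat ((σ.card : ℤ) * j - (σ.map fun x => (x.1 : ℤ)).sum + 1)
  linarith

end

/-! ### The spanning theorem -/

/-- The subalgebra generated by the current algebra of `gl_{j+1}`. -/
def levelAlg (E : ℕ → ℕ → ℕ → A) (j : ℕ) : Subalgebra ℂ A :=
  Algebra.adjoin ℂ {x | ∃ a b k, a ≤ j ∧ b ≤ j ∧ x = E a b k}

theorem IsStable.levelAlg_mul_mem {E : ℕ → ℕ → ℕ → A} {j : ℕ} {Z : Submodule ℂ A}
    (hZ : IsStable E j Z) {u z : A} (hu : u ∈ levelAlg E j) (hz : z ∈ Z) : u * z ∈ Z := by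
  induction hu using Algebra.adjoin_induction generalizing z with
  | mem x hx => obtain ⟨a, b, k, ha, hb, rfl⟩ := hx; exact hZ a b k ha hb z hz
  | algebraMap c => rw [← Algebra.smul_def]; exact Z.smul_mem _ hz
  | add x y _ _ h1 h2 => rw [add_mul]; exact add_mem (h1 hz) (h2 hz)
  | mul x y _ _ h1 h2 => rw [mul_assoc]; exact h1 (h2 hz)

theorem mem_levelAlg (E : ℕ → ℕ → ℕ → A) {j a b : ℕ} (ha : a ≤ j) (hb : b ≤ j) (k : ℕ) :
    E a b k ∈ levelAlg E j := Algebra.subset_adjoin ⟨a, b, k, ha, hb, rfl⟩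

end WeylBasis
end

/-! ### Closure under the full algebra and the induction on the rank. -/

noncomputable section
namespace WeylBasis

open MvPolynomial

variable {A : Type*} [Ring A] [Algebra ℂ A]

section

variable {E : ℕ → ℕ → ℕ → A} {r j : ℕ} (hE : IsCurrent E r) (hj : j + 1 ≤ r) {m : ℕ → ℕ}
  {Z : Submodule ℂ A} {v : A}

/-- The subspace generated, under the current algebra of `gl_{j+1}`, by `Z` and the polynomials in
the last row applied to `v`. -/
def rowHull (hE : IsCurrent E r) (hj : j + 1 ≤ r) (Z : Submodule ℂ A) (v : A) : Submodule ℂ A :=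
  Submodule.span ℂ {x | ∃ u ∈ levelAlg E j, ∃ p, x = u * (rowHom hE hj p * v)} ⊔ Z

theorem rowHom_mul_mem_rowHull (p : MvPolynomial (ℕ × ℕ) ℂ) :
    rowHom hE hj p * v ∈ rowHull hE hj Z v :=
  Submodule.mem_sup_left (Submodule.subset_span ⟨1, one_mem _, p, (one_mul _).symm⟩)

theorem isStable_rowHull (hZ : IsStable E (j + 1) Z) : IsStable E j (rowHull hE hj Z v) := by
  intro a b k ha hb
  change rowHull hE hj Z v ≤ (rowHull hE hj Z v).comap (LinearMap.mulLeft ℂ (E a b k))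
  refine sup_le (Submodule.span_le.2 ?_) fun z hz => Submodule.mem_sup_right
    (hZ a b k (by omega) (by omega) z hz)
  rintro _ ⟨u, hu, p, rfl⟩
  exact Submodule.mem_sup_left (Submodule.subset_span
    ⟨E a b k * u, mul_mem (mem_levelAlg E ha hb k) hu, p, (mul_assoc _ _ _).symm⟩)

/-- Since commutators of `C` with the smaller algebra stay in the span of `C`, elements of `C` can
be pushed through `levelAlg E j`; stability need only be tested on row polynomials applied to `v`
and on `Z`. -/
theorem mul_mem_rowHull (hZ : IsStable E (j + 1) Z) (C : Set A)
    (hC : ∀ x ∈ C, ∀ a b k, a ≤ j → b ≤ j → ∃ x' ∈ Submodule.span ℂ C,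
      x * E a b k = E a b k * x + x')
    (hbase : ∀ x ∈ C, ∀ p, x * (rowHom hE hj p * v) ∈ rowHull hE hj Z v)
    (hCZ : ∀ x ∈ C, ∀ z ∈ Z, x * z ∈ Z) {x h : A} (hx : x ∈ C) (hh : h ∈ rowHull hE hj Z v) :
    x * h ∈ rowHull hE hj Z v := by
  have key : ∀ u ∈ levelAlg E j, ∀ h ∈ rowHull hE hj Z v,
      (∀ x ∈ C, x * h ∈ rowHull hE hj Z v) → ∀ x ∈ C, x * (u * h) ∈ rowHull hE hj Z v := by
    intro u hu
    induction hu using Algebra.adjoin_induction with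
    | mem u hu =>
      obtain ⟨a, b, k, ha, hb, rfl⟩ := hu
      intro h hh hCh x hx
      obtain ⟨x', hx', hxx'⟩ := hC x hx a b k ha hb
      rw [← mul_assoc, hxx', add_mul, mul_assoc]
      refine add_mem (isStable_rowHull hE hj hZ a b k ha hb _ (hCh x hx)) ?_
      have : Submodule.span ℂ C ≤ (rowHull hE hj Z v).comap (LinearMap.mulRight ℂ h) :=
        Submodule.span_le.2 hCh
      exact this hx'
    | algebraMap c =>
      intro h _ hCh x hx
      rw [← Algebra.smul_def, mul_smul_comm]
      exact Submodule.smul_mem _ _ (hCh x hx)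
    | add u u' _ _ h1 h2 =>
      intro h hh hCh x hx
      rw [add_mul, mul_add]
      exact add_mem (h1 h hh hCh x hx) (h2 h hh hCh x hx)
    | mul u u' _ hu' h1 h2 =>
      intro h hh hCh x hx
      rw [mul_assoc]
      exact h1 _ ((isStable_rowHull hE hj hZ).levelAlg_mul_mem hu' hh) (h2 h hh hCh) x hx
  suffices rowHull hE hj Z v ≤ (rowHull hE hj Z v).comap (LinearMap.mulLeft ℂ x) from this hh
  refine sup_le (Submodule.span_le.2 ?_) fun z hz => Submodule.mem_sup_right (hCZ x hx z hz)
  rintro _ ⟨u, hu, p, rfl⟩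
  exact key u hu _ (rowHom_mul_mem_rowHull hE hj p) (fun x hx => hbase x hx p) x hx

/-- The derivation `X (c, s) ↦ X (c, s + k)`. -/
def rowTranslate (k : ℕ) : Derivation ℂ (MvPolynomial (ℕ × ℕ) ℂ) (MvPolynomial (ℕ × ℕ) ℂ) :=
  mkDerivation ℂ fun x => X (x.1, x.2 + k)

theorem corner_mul_rowHom (k : ℕ) (p : MvPolynomial (ℕ × ℕ) ℂ) :
    E (j + 1) (j + 1) k * rowHom hE hj p =
      rowHom hE hj p * E (j + 1) (j + 1) k + rowHom hE hj (rowTranslate k p) := by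
  refine mul_commHom_of_derivation _ _ _ _ (fun x => ?_) p
  rw [rowTranslate, mkDerivation_X, commHom_X, rowElt, rowElt]
  by_cases hx : x.1 ≤ j
  · rw [if_pos hx, if_pos hx, hE _ _ _ _ (by omega) (by omega) (by omega) (by omega), if_pos rfl,
      if_neg (by omega), sub_zero, add_comm k]
  · simp [hx]

/-- A triangular decomposition without the Poincaré–Birkhoff–Witt theorem. Row elements multiply
polynomials, the corner acts by a derivation, and raising elements `E_{c,j+1}` are removed by
induction on the polynomial, as their brackets with row elements involve only the cases already
settled. -/
theorem isStable_succ_rowHull (hZ : IsStable E (j + 1) Z) (hv : IsHighest E (j + 1) m Z v) :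
    IsStable E (j + 1) (rowHull hE hj Z v) := by
  have hlow : ∀ c k, c ≤ j → ∀ h ∈ rowHull hE hj Z v, E (j + 1) c k * h ∈ rowHull hE hj Z v := by
    intro c k hc h hh
    refine mul_mem_rowHull hE hj hZ {x | ∃ c k, c ≤ j ∧ x = E (j + 1) c k} ?_ ?_ ?_
      ⟨c, k, hc, rfl⟩ hh
    · rintro _ ⟨c, k, hc, rfl⟩ a b l ha hb
      refine ⟨_, ?_, hE _ _ _ _ (by omega) (by omega) (by omega) (by omega) _ _⟩
      rw [if_neg (show ¬ b = j + 1 by omega), sub_zero]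
      split_ifs
      · exact Submodule.subset_span ⟨b, _, hb, rfl⟩
      · exact zero_mem _
    · rintro _ ⟨c, k, hc, rfl⟩ p
      rw [← mul_assoc, ← rowHom_X hE hj hc, ← map_mul]
      exact rowHom_mul_mem_rowHull hE hj _
    · rintro _ ⟨c, k, hc, rfl⟩ z hz
      exact hZ _ _ _ le_rfl (by omega) z hz
  have hcorner_base : ∀ k p, E (j + 1) (j + 1) k * (rowHom hE hj p * v) ∈ rowHull hE hj Z v := by
    intro k p
    rw [← mul_assoc, corner_mul_rowHom, add_mul, mul_assoc]
    refine add_mem ?_ (rowHom_mul_mem_rowHull hE hj _)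
    cases k with
    | zero =>
      obtain ⟨μ, hμ, -⟩ := hv.weight
      have h1 := rowHom_mul_mem hE hj hZ p (hμ (j + 1) le_rfl)
      rw [← sub_add_cancel (E (j + 1) (j + 1) 0 * v) (μ (j + 1) • v), mul_add, mul_smul_comm]
      exact add_mem (Submodule.mem_sup_right h1)
        (Submodule.smul_mem _ _ (rowHom_mul_mem_rowHull hE hj p))
    | succ k => exact Submodule.mem_sup_right (rowHom_mul_mem hE hj hZ p (hv.diag _ k le_rfl))
  have hcorner : ∀ k, ∀ h ∈ rowHull hE hj Z v, E (j + 1) (j + 1) k * h ∈ rowHull hE hj Z v := by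
    intro k h hh
    refine mul_mem_rowHull hE hj hZ {x | ∃ k, x = E (j + 1) (j + 1) k} ?_ ?_ ?_ ⟨k, rfl⟩ hh
    · rintro _ ⟨k, rfl⟩ a b l ha hb
      refine ⟨_, ?_, hE _ _ _ _ (by omega) (by omega) (by omega) (by omega) _ _⟩
      rw [if_neg (show ¬ j + 1 = a by omega), if_neg (show ¬ b = j + 1 by omega), sub_zero]
      exact zero_mem _
    · rintro _ ⟨k, rfl⟩ p
      exact hcorner_base k p
    · rintro _ ⟨k, rfl⟩ z hz
      exact hZ _ _ _ le_rfl le_rfl z hz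
  have hhigh : ∀ c k, c ≤ j → ∀ h ∈ rowHull hE hj Z v, E c (j + 1) k * h ∈ rowHull hE hj Z v := by
    intro c k hc h hh
    refine mul_mem_rowHull hE hj hZ {x | ∃ c k, c ≤ j ∧ x = E c (j + 1) k} ?_ ?_ ?_
      ⟨c, k, hc, rfl⟩ hh
    · rintro _ ⟨c, k, hc, rfl⟩ a b l ha hb
      refine ⟨_, ?_, hE _ _ _ _ (by omega) (by omega) (by omega) (by omega) _ _⟩
      rw [if_neg (show ¬ j + 1 = a by omega), zero_sub]
      refine neg_mem ?_
      split_ifs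
      · exact Submodule.subset_span ⟨a, _, ha, rfl⟩
      · exact zero_mem _
    · rintro _ ⟨c, k, hc, rfl⟩ p
      induction p using MvPolynomial.induction_on with
      | C a =>
        rw [← algebraMap_eq, AlgHom.commutes, ← Algebra.smul_def, mul_smul_comm]
        exact Submodule.smul_mem _ _ (Submodule.mem_sup_right (hv.raise _ _ _ (by omega) le_rfl))
      | add p q h1 h2 => rw [map_add, add_mul, mul_add]; exact add_mem h1 h2
      | mul_X p x ih =>
        rw [mul_comm, map_mul, mul_assoc, ← mul_assoc]
        by_cases hx : x.1 ≤ j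
        · rw [show x = (x.1, x.2) from rfl, rowHom_X hE hj hx,
            hE _ _ _ _ (by omega) (by omega) (by omega) (by omega), if_pos rfl, add_mul, mul_assoc,
            sub_mul]
          refine add_mem (hlow _ _ hx _ ih) (sub_mem ?_ ?_)
          · exact isStable_rowHull hE hj hZ _ _ _ hc hx _ (rowHom_mul_mem_rowHull hE hj p)
          · split_ifs
            · exact hcorner_base _ p
            · simp
        · rw [rowHom, commHom_X, rowElt, if_neg hx]
          simp
    · rintro _ ⟨c, k, hc, rfl⟩ z hz
      exact hZ _ _ _ (by omega) le_rfl z hz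
  intro a b k ha hb h hh
  rcases Nat.lt_succ_iff_lt_or_eq.1 (Nat.lt_succ_iff.2 ha) with ha | rfl
  · rcases Nat.lt_succ_iff_lt_or_eq.1 (Nat.lt_succ_iff.2 hb) with hb | rfl
    · exact isStable_rowHull hE hj hZ a b k (by omega) (by omega) h hh
    · exact hhigh a k (by omega) h hh
  · rcases Nat.lt_succ_iff_lt_or_eq.1 (Nat.lt_succ_iff.2 hb) with hb | rfl
    · exact hlow b k (by omega) h hh
    · exact hcorner k h hh

end

theorem rowHom_mul_mem_of_monom {E : ℕ → ℕ → ℕ → A} {r j : ℕ} (hE : IsCurrent E r) (hj : j + 1 ≤ r)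
    {W : Submodule ℂ A} {v : A}
    (h : ∀ σ : Multiset (ℕ × ℕ), (∀ x ∈ σ, x.1 ≤ j) → rowHom hE hj (monom σ) * v ∈ W)
    (p : MvPolynomial (ℕ × ℕ) ℂ) : rowHom hE hj p * v ∈ W := by
  rw [p.as_sum, map_sum, Finset.sum_mul]
  refine sum_mem fun u _ => ?_
  rw [← mul_one (coeff u p), ← smul_eq_mul (coeff u p), ← smul_monomial, map_smul, smul_mul_assoc,
    monomial_eq_monom]
  refine W.smul_mem _ ?_
  by_cases hu : ∀ x ∈ Finsupp.toMultiset u, x.1 ≤ j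
  · exact h _ hu
  -- Variables over columns beyond `j` are sent to `0` by `rowElt`.
  · push Not at hu
    obtain ⟨x, hx, hxj⟩ := hu
    obtain ⟨τ, hτ⟩ := Multiset.exists_cons_of_mem hx
    rw [hτ, monom_cons, map_mul, rowHom, commHom_X, rowElt, if_neg (by omega)]
    simp

/-- A highest weight vector generates the span of the basis monomials applied to it. -/
theorem levelAlg_mul_mem {E : ℕ → ℕ → ℕ → A} {r : ℕ} (hE : IsCurrent E r) {j : ℕ} (hj : j ≤ r)
    {m : ℕ → ℕ} {Z : Submodule ℂ A} {v : A} (hZ : IsStable E j Z) (hv : IsHighest E j m Z v)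
    {u : A} (hu : u ∈ levelAlg E j) :
    u * v ∈ Z ⊔ Submodule.span ℂ ((fun b => b * v) '' basisMon E j m) := by
  induction j generalizing m Z v u with
  | zero =>
    set G := Z ⊔ Submodule.span ℂ ((fun b => b * v) '' basisMon E 0 m) with hG
    have hvG : v ∈ G := Submodule.mem_sup_right (Submodule.subset_span ⟨1, rfl, one_mul v⟩)
    have hst : IsStable E 0 G := by
      intro a b k ha hb
      obtain rfl : a = 0 := by omega
      obtain rfl : b = 0 := by omega
      change G ≤ G.comap (LinearMap.mulLeft ℂ (E 0 0 k))
      refine sup_le (fun z hz => Submodule.mem_sup_left (hZ 0 0 k le_rfl le_rfl z hz))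
        (Submodule.span_le.2 ?_)
      rintro _ ⟨b, hb, rfl⟩
      obtain rfl : b = 1 := hb
      change E 0 0 k * (1 * v) ∈ G
      rw [one_mul]
      cases k with
      | zero =>
        obtain ⟨μ, hμ, -⟩ := hv.weight
        rw [← sub_add_cancel (E 0 0 0 * v) (μ 0 • v)]
        exact add_mem (Submodule.mem_sup_left (hμ 0 le_rfl)) (G.smul_mem _ hvG)
      | succ k => exact Submodule.mem_sup_left (hv.diag 0 k le_rfl)
    exact hst.levelAlg_mul_mem hu hvG
  | succ j ih =>
    set G := Z ⊔ Submodule.span ℂ ((fun b => b * v) '' basisMon E (j + 1) m) with hG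
    -- The largest subspace of `G` stable under the smaller algebra. A highest weight vector modulo
    -- `W` whose basis monomials land in `G` is then itself in `W`, by the induction hypothesis.
    let W : Submodule ℂ A :=
      { carrier := {x | ∀ u ∈ levelAlg E j, u * x ∈ G}
        zero_mem' := fun u _ => by rw [mul_zero]; exact zero_mem _
        add_mem' := fun h1 h2 u hu => by rw [mul_add]; exact add_mem (h1 u hu) (h2 u hu)
        smul_mem' := fun c x h u hu => by rw [mul_smul_comm]; exact G.smul_mem c (h u hu) }
    have hZj : IsStable E j Z := fun a b k ha hb => hZ a b k (by omega) (by omega)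
    have hZW : Z ≤ W := fun z hz u hu => Submodule.mem_sup_left (hZj.levelAlg_mul_mem hu hz)
    have hWG : W ≤ G := fun x hx => by simpa using hx 1 (one_mem _)
    have hW : IsStable E j W := fun a b k ha hb x hx u hu => by
      rw [← mul_assoc]
      exact hx _ (mul_mem hu (mem_levelAlg E ha hb k))
    have hrow : ∀ p, rowHom hE hj p * v ∈ W := by
      refine rowHom_mul_mem_of_monom hE hj fun σ hσ =>
        rowHom_mul_mem_of_isHighest hE hj hZ hv hZW hW ?_ hσ
      intro τ hτ hg hhigh u hu
      refine sup_le hWG ?_ (ih (by omega) hW hhigh hu)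
      refine Submodule.span_le.2 ?_
      rintro _ ⟨b, hb, rfl⟩
      refine Submodule.mem_sup_right (Submodule.subset_span ⟨_, ⟨_, hg, b, hb, rfl⟩, ?_⟩)
      change b * _ * v = b * (_ * v)
      rw [rowHom_monom_eq hE hj hτ, mul_assoc]
    have hH : rowHull hE hj Z v ≤ G := by
      refine sup_le (Submodule.span_le.2 ?_) le_sup_left
      rintro _ ⟨u, hu, p, rfl⟩
      exact hrow p u hu
    refine hH ((isStable_succ_rowHull hE hj hZ hv).levelAlg_mul_mem hu ?_)
    simpa using rowHom_mul_mem_rowHull hE hj (Z := Z) (v := v) 1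

end WeylBasis
end

/-! ### The upper bound for the number of monomials. -/

noncomputable section
namespace WeylBasis

/-! ### The number of basis monomials -/

/-- The finite set of all `s` with `InF m s`. -/
def finsetF (m : ℕ) : Finset (Multiset ℕ) :=
  (Finset.range (m + 1)).biUnion fun l =>
    (Finset.univ : Finset (Sym (Fin (m - l + 1)) l)).image fun t => t.toMultiset.map Fin.val

theorem mem_finsetF_of_InF {m : ℕ} {s : Multiset ℕ} (h : InF m s) : s ∈ finsetF m := by
  refine Finset.mem_biUnion.2 ⟨s.card, Finset.mem_range.2 (Nat.lt_succ_iff.2 h.card_le), ?_⟩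
  refine Finset.mem_image.2 ⟨⟨s.map (Fin.ofNat _), by simp⟩, Finset.mem_univ _, ?_⟩
  change (s.map (Fin.ofNat _)).map Fin.val = s
  rw [Multiset.map_map]
  conv_rhs => rw [← Multiset.map_id s]
  refine Multiset.map_congr rfl fun a ha => ?_
  have := h a ha
  exact Nat.mod_eq_of_lt (by omega)

/-- Multisets of size `l` on `m - l + 1` values number `binom(m, l)`, so the binomial theorem bounds
the sum. -/
theorem sum_finsetF_le (m x y : ℕ) :
    ∑ s ∈ finsetF m, x ^ (m - s.card) * y ^ s.card ≤ (x + y) ^ m := by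
  have hmaps : ∀ s ∈ finsetF m, s.card ∈ Finset.range (m + 1) := by
    intro s hs
    obtain ⟨l, hl, hs⟩ := Finset.mem_biUnion.1 hs
    obtain ⟨t, -, rfl⟩ := Finset.mem_image.1 hs
    rwa [Multiset.card_map, show Multiset.card t.toMultiset = l from t.2]
  rw [← Finset.sum_fiberwise_of_maps_to hmaps, add_comm x y, add_pow]
  refine Finset.sum_le_sum fun l hl => ?_
  rw [Finset.sum_congr rfl (g := fun _ => x ^ (m - l) * y ^ l)
    fun s hs => by rw [(Finset.mem_filter.1 hs).2], Finset.sum_const, smul_eq_mul, mul_comm]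
  have hcard : (Finset.filter (fun s => Multiset.card s = l) (finsetF m)).card ≤ m.choose l := by
    have hsub : Finset.filter (fun s => Multiset.card s = l) (finsetF m) ⊆
        (Finset.univ : Finset (Sym (Fin (m - l + 1)) l)).image fun t => t.toMultiset.map Fin.val := by
      intro s hs
      obtain ⟨hs, hsl⟩ := Finset.mem_filter.1 hs
      obtain ⟨l', hl', hs'⟩ := Finset.mem_biUnion.1 hs
      obtain ⟨t, ht, rfl⟩ := Finset.mem_image.1 hs'
      obtain rfl : l' = l := by rw [← hsl, Multiset.card_map]; exact t.2.symm
      exact hs'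
    refine (Finset.card_le_card hsub).trans (Finset.card_image_le.trans ?_)
    rw [Finset.card_univ, Sym.card_sym_eq_multichoose, Fintype.card_fin, Nat.multichoose_eq]
    have := Finset.mem_range.1 hl
    rw [show m - l + 1 + l - 1 = m by omega]
  calc x ^ (m - l) * y ^ l * _ ≤ x ^ (m - l) * y ^ l * m.choose l := Nat.mul_le_mul_left _ hcard
    _ = _ := by rw [Nat.cast_id, mul_comm (x ^ _)]

section

variable {A : Type*} [Ring A] (E : ℕ → ℕ → ℕ → A)

theorem rowProd_congr (j : ℕ) {s s' : ℕ → Multiset ℕ} (h : ∀ i ≤ j, s i = s' i) :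
    rowProd E j s = rowProd E j s' := by
  unfold rowProd
  congr 1
  refine List.map_congr_left fun i hi => ?_
  rw [h i (Nat.lt_succ_iff.1 (List.mem_range.1 hi))]

theorem basisMon_subset_of_eq (j : ℕ) {m m' : ℕ → ℕ} (h : ∀ i < j, m i = m' i) :
    basisMon E j m ⊆ basisMon E j m' := by
  induction j generalizing m m' with
  | zero => exact subset_rfl
  | succ j ih =>
    rintro _ ⟨s, hs, b, hb, rfl⟩
    refine ⟨s, fun i hi => h i (by omega) ▸ hs i hi, b, ih (fun i hi => ?_) hb, rfl⟩
    rw [nextWeight, nextWeight, h i (by omega)]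

/-- Only an upper bound is needed, so coincidences among the monomials do not matter. The sum over
the last row of the bounds for the smaller rank factors over the columns. -/
theorem exists_finset_basisMon (j : ℕ) (m : ℕ → ℕ) : ∃ T : Finset A, basisMon E j m ⊆ ↑T ∧
    T.card ≤ ∏ i ∈ Finset.range j, (j + 1).choose (i + 1) ^ m i := by
  classical
  induction j generalizing m with
  | zero => exact ⟨{1}, by simp [basisMon], by simp⟩
  | succ j ih =>
    choose T hT hTcard using ih
    let ext : (Fin (j + 1) → Multiset ℕ) → ℕ → Multiset ℕ :=
      fun t i => if h : i < j + 1 then t ⟨i, h⟩ else 0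
    refine ⟨(Fintype.piFinset fun i : Fin (j + 1) => finsetF (m i)).biUnion fun t =>
      (T (nextWeight m fun i => (ext t i).card)).image (· * rowProd E j (ext t)), ?_, ?_⟩
    · rintro _ ⟨s, hs, b, hb, rfl⟩
      have hext : ∀ i ≤ j, s i = ext (fun i => s i) i := fun i hi => by
        simp only [ext, dif_pos (Nat.lt_succ_iff.2 hi)]
      rw [Finset.mem_coe, Finset.mem_biUnion]
      refine ⟨fun i => s i, Fintype.mem_piFinset.2 fun i => mem_finsetF_of_InF
        (hs i (Nat.lt_succ_iff.1 i.2)), Finset.mem_image.2 ⟨b, hT _ (basisMon_subset_of_eq E j ?_ hb), ?_⟩⟩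
      · intro i hi
        simp only [nextWeight]
        rw [← hext i hi.le, ← hext (i + 1) hi]
      · rw [rowProd_congr E j hext]
    · refine Finset.card_biUnion_le.trans ((Finset.sum_le_sum fun t _ =>
        Finset.card_image_le.trans (hTcard _)).trans ?_)
      have hprod : ∀ t : Fin (j + 1) → Multiset ℕ,
          ∏ i ∈ Finset.range j, (j + 1).choose (i + 1) ^ nextWeight m (fun i => (ext t i).card) i =
          ∏ i : Fin (j + 1), ((j + 1).choose (i + 1) ^ (m i - (t i).card) *
            (j + 1).choose i ^ (t i).card) := by
        intro t
        have h1 : ∏ i : Fin (j + 1), ((j + 1).choose (i + 1) ^ (m i - (t i).card) *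
            (j + 1).choose i ^ (t i).card) =
            ∏ i ∈ Finset.range (j + 1), ((j + 1).choose (i + 1) ^ (m i - (ext t i).card) *
            (j + 1).choose i ^ (ext t i).card) := by
          rw [Finset.prod_range]
          exact Finset.prod_congr rfl fun i _ => by simp only [ext, dif_pos i.2]
        -- The part of the exponent coming from `l_{i+1}` is moved from column `i` to column `i+1`;
        -- the boundary factors are powers of `binom(j+1, j+1)` and `binom(j+1, 0)`.
        rw [h1, Finset.prod_mul_distrib, Finset.prod_range_succ, Finset.prod_range_succ' _ j]
        simp only [Nat.choose_self, Nat.choose_zero_right, one_pow, mul_one]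
        rw [← Finset.prod_mul_distrib]
        exact Finset.prod_congr rfl fun i _ => by rw [nextWeight, pow_add]
      simp only [hprod]
      rw [← Finset.prod_univ_sum (fun i : Fin (j + 1) => finsetF (m i))
        (fun i s => (j + 1).choose (i + 1) ^ (m i - s.card) * (j + 1).choose i ^ s.card),
        Finset.prod_range]
      refine Finset.prod_le_prod' fun i _ => (sum_finsetF_le _ _ _).trans_eq ?_
      -- Pascal's rule passes from rank `j` to rank `j + 1`.
      rw [add_comm, ← Nat.choose_succ_succ]

end

end WeylBasis
end

/-! ### Matching the recursive monomials and abstract relations with the Weyl module. -/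

noncomputable section
namespace WeylBasis

/-! ### The basis monomials in terms of all rows -/

section

variable {A : Type*} [Ring A] (E : ℕ → ℕ → ℕ → A)

/-- The coefficient `m_{i,j}` of `ω_i` in the weight that bounds the entry `(i, j)`, when there are
`J` rows of multisets `t`. -/
def rowWeight (m : ℕ → ℕ) (t : ℕ → ℕ → Multiset ℕ) (J j i : ℕ) : ℤ :=
  m i + ∑ s ∈ Finset.Ioo j J, (((t s (i + 1)).card : ℤ) - (t s i).card)

/-- The condition `(ℓ, s) ∈ 𝐅(M)` for multisets. -/
def MemF (M : ℤ) (s : Multiset ℕ) : Prop := 0 ≤ M ∧ ∀ a ∈ s, (a : ℤ) ≤ M - s.card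

theorem memF_natCast {m : ℕ} {s : Multiset ℕ} : MemF m s ↔ InF m s := by
  refine ⟨fun h a ha => ?_, fun h => ⟨by positivity, fun a ha => ?_⟩⟩
  · have := h.2 a ha; omega
  · have := h a ha; omega

/-- The last row contributes the summand `s = J`, absorbed into `nextWeight`; `hm` keeps the natural
subtraction there from truncating. -/
theorem rowWeight_succ {m : ℕ → ℕ} {t t' : ℕ → ℕ → Multiset ℕ} {J j i : ℕ} (hj : j < J)
    (ht : ∀ s < J, t s = t' s) (hm : (t J i).card ≤ m i) :
    rowWeight m t (J + 1) j i =
      rowWeight (nextWeight m fun i => (t J i).card) t' J j i := by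
  have h1 : Finset.Ioo j (J + 1) = insert J (Finset.Ioo j J) := by
    ext; simp; omega
  rw [rowWeight, rowWeight, h1, Finset.sum_insert (by simp), nextWeight]
  have h2 : ∑ s ∈ Finset.Ioo j J, (((t s (i + 1)).card : ℤ) - (t s i).card) =
      ∑ s ∈ Finset.Ioo j J, (((t' s (i + 1)).card : ℤ) - (t' s i).card) :=
    Finset.sum_congr rfl fun s hs => by rw [ht s (Finset.mem_Ioo.1 hs).2]
  rw [h2]
  push_cast [hm]
  ring

theorem mem_basisMon_iff (J : ℕ) (m : ℕ → ℕ) (x : A) : x ∈ basisMon E J m ↔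
    ∃ t : ℕ → ℕ → Multiset ℕ, (∀ j < J, ∀ i ≤ j, MemF (rowWeight m t J j i) (t j i)) ∧
      x = ((List.range J).map fun j => rowProd E j (t j)).prod := by
  induction J generalizing m x with
  | zero => simp [basisMon]
  | succ J ih =>
    have hlast : ∀ t i, rowWeight m t (J + 1) J i = m i := by
      intro t i
      rw [rowWeight, show Finset.Ioo J (J + 1) = ∅ by ext; simp]
      simp
    constructor
    · rintro ⟨s, hs, b, hb, rfl⟩
      obtain ⟨t', ht', rfl⟩ := (ih _ _).1 hb
      have htt : ∀ s' < J, Function.update t' J s s' = t' s' := fun s' h =>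
        Function.update_of_ne h.ne _ _
      refine ⟨Function.update t' J s, ?_, ?_⟩
      · intro j hj i hi
        rcases Nat.lt_succ_iff_lt_or_eq.1 hj with hj | rfl
        · rw [rowWeight_succ hj htt (by simpa using (hs i (by omega)).card_le), htt j hj]
          simpa using ht' j hj i hi
        · rw [hlast, memF_natCast]
          simpa using hs i hi
      · rw [List.range_succ, List.map_append, List.prod_append]
        congr 1
        · congr 1
          refine List.map_congr_left fun j hj => ?_
          rw [htt j (List.mem_range.1 hj)]
        · simp
    · rintro ⟨t, ht, rfl⟩
      have hs : ∀ i ≤ J, InF (m i) (t J i) := fun i hi => by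
        have := ht J (by omega) i hi
        rwa [hlast, memF_natCast] at this
      refine ⟨t J, hs, _, (ih _ _).2 ⟨t, fun j hj i hi => ?_, rfl⟩, ?_⟩
      · have := ht j (by omega) i hi
        rwa [rowWeight_succ hj (fun _ _ => rfl) (hs i (by omega)).card_le] at this
      · rw [List.range_succ, List.map_append, List.prod_append]
        simp

end

/-! ### Weights -/

/-- The sum of simple roots telescopes. The contributions at its upper end sit at `s` and `s + 1`,
outside the range `k < s`. -/
theorem posRoot_apply {r : ℕ} {i s k : Fin r} (hi : i ≤ s) (hk : k < s) :
    posRoot i s k = (if i = k then 1 else 0) - (if (i : ℕ) = k + 1 then 1 else 0) := by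
  have h1 : ∀ l : Fin r, CartanMatrix.A r k l = 2 * (if l = k then 1 else 0) -
      (if (l : ℕ) = k + 1 then 1 else 0) - (if (l : ℕ) + 1 = k then 1 else 0) := by
    intro l
    simp only [CartanMatrix.A, Matrix.of_apply, Fin.ext_iff]
    split_ifs <;> omega
  have hval : ∀ n : ℕ, ∑ l ∈ Finset.Icc i s, (if (l : ℕ) = n then (1 : ℤ) else 0) =
      if (i : ℕ) ≤ n ∧ n ≤ s then 1 else 0 := by
    intro n
    split_ifs with h
    · rw [Finset.sum_eq_single ⟨n, by omega⟩]
      · simp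
      · intro l _ hl
        rw [if_neg fun h => hl (Fin.ext h)]
      · intro hn
        exact absurd (Finset.mem_Icc.2 ⟨Fin.le_def.2 h.1, Fin.le_def.2 h.2⟩) hn
    · refine Finset.sum_eq_zero fun l hl => if_neg ?_
      rintro rfl
      exact h ⟨Fin.le_def.1 (Finset.mem_Icc.1 hl).1, Fin.le_def.1 (Finset.mem_Icc.1 hl).2⟩
  have hval' : ∑ l ∈ Finset.Icc i s, (if (l : ℕ) + 1 = k then (1 : ℤ) else 0) =
      if (i : ℕ) + 1 ≤ k then 1 else 0 := by
    rcases Nat.eq_zero_or_pos (k : ℕ) with h | h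
    · rw [if_neg (by omega)]
      exact Finset.sum_eq_zero fun l _ => if_neg (by omega)
    · rw [Finset.sum_congr rfl (g := fun l : Fin r => if (l : ℕ) = k - 1 then (1 : ℤ) else 0)
        fun l _ => by simp only [show ((l : ℕ) + 1 = k) = ((l : ℕ) = k - 1) by ext; omega], hval]
      have : (k : ℕ) < s := hk
      congr 1
      ext
      omega
  have hk' : (k : ℕ) < s := hk
  rw [posRoot, Finset.sum_apply]
  simp only [simpleRoot, h1, Finset.sum_sub_distrib, ← Finset.mul_sum, Fin.ext_iff, hval, hval']
  split_ifs <;> omega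

theorem eta_apply {r : ℕ} {s k : Fin r} (d : ExpRow s) (hk : k < s) :
    eta s d k = ((d ⟨k, Nat.lt_succ_of_lt hk⟩).len : ℤ) - (d ⟨k + 1, Nat.succ_lt_succ hk⟩).len := by
  have h1 : ∀ i : Fin (s.val + 1), (((d i).len : ℤ) • posRoot (idx s i) s) k =
      (if i = ⟨k, Nat.lt_succ_of_lt hk⟩ then ((d i).len : ℤ) else 0) -
      (if i = ⟨k + 1, Nat.succ_lt_succ hk⟩ then ((d i).len : ℤ) else 0) := by
    intro i
    rw [Pi.smul_apply, posRoot_apply (idx_le s i) hk, smul_eq_mul]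
    have e1 : (idx s i = k) = (i = ⟨k, Nat.lt_succ_of_lt hk⟩) := by
      simp [Fin.ext_iff, idx]
    have e2 : ((idx s i : Fin r) : ℕ) = i := rfl
    simp only [e1, e2, Fin.ext_iff]
    split_ifs <;> simp
  rw [eta, Finset.sum_apply, Finset.sum_congr rfl fun i _ => h1 i, Finset.sum_sub_distrib]
  simp

/-! ### The elements of the current algebra of `sl` -/

/-- The image of the matrix unit `E_{a,b}` under the projection of `gl_{r+1}` to `sl_{r+1}`. -/
def unitSl {r : ℕ} (a b : Fin (r + 1)) : Sl r :=
  ⟨Matrix.single a b 1 - (if a = b then ((r : ℂ) + 1)⁻¹ else 0) • 1, by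
    change Matrix.trace (Matrix.single a b (1 : ℂ) -
      (if a = b then ((r : ℂ) + 1)⁻¹ else 0) • (1 : Matrix (Fin (r + 1)) (Fin (r + 1)) ℂ)) = 0
    rw [Matrix.trace_sub, Matrix.trace_smul, Matrix.trace_one]
    have : (r : ℂ) + 1 ≠ 0 := by exact_mod_cast Nat.succ_ne_zero r
    split_ifs with h
    · subst h
      simp [this]
    · simp [h]⟩

theorem unitSl_val {r : ℕ} (a b : Fin (r + 1)) : (unitSl a b).val =
    Matrix.single a b 1 - (if a = b then ((r : ℂ) + 1)⁻¹ else 0) • 1 := rfl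

/-- Subtracting a scalar matrix does not change brackets, so the projected matrix units satisfy the
`gl` relations and the index-uniform arguments apply to `sl`. -/
theorem unitSl_lie {r : ℕ} (a b c d : Fin (r + 1)) : ⁅unitSl a b, unitSl c d⁆ =
    (if b = c then unitSl a d else 0) - if d = a then unitSl c b else 0 := by
  apply Subtype.ext
  rw [LieAlgebra.SpecialLinear.sl_bracket]
  have h1 : ∀ p : Prop, ∀ [Decidable p], ∀ x : Sl r, (if p then x else 0 : Sl r).val = if p then x.val else 0 := by
    intro p _ x; split_ifs <;> rfl
  change _ = (if b = c then unitSl a d else 0 : Sl r).val - (if d = a then unitSl c b else 0 : Sl r).val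
  rw [h1, h1]
  simp only [unitSl_val, sub_mul, mul_sub, smul_mul_assoc, mul_smul_comm, one_mul, mul_one]
  have hm : ∀ a b c d : Fin (r + 1), Matrix.single a b (1 : ℂ) * Matrix.single c d (1 : ℂ) =
      if b = c then Matrix.single a d 1 else 0 := by
    intro a b c d
    split_ifs with h
    · subst h; simp
    · rw [Matrix.single_mul_single_of_ne _ _ _ _ h]
  rw [hm, hm]
  by_cases h1 : b = c <;> by_cases h2 : d = a
  · subst h1 h2
    simp only [if_true]
    module
  · have h3 : ¬ a = d := fun h => h2 h.symm
    simp only [h1, h2, h3, if_true, if_false]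
    module
  · have h3 : ¬ c = b := fun h => h1 h.symm
    simp only [h1, h2, h3, if_true, if_false]
    module
  · simp only [h1, h2, if_false]
    module

theorem unitSl_of_ne {r : ℕ} {a b : Fin (r + 1)} (h : a ≠ b) :
    unitSl a b = LieAlgebra.SpecialLinear.single a b h 1 := by
  apply Subtype.ext
  rw [unitSl_val, if_neg h, zero_smul, sub_zero]
  rfl

attribute [local instance] LieRing.ofAssociativeRing

theorem cur_mul_cur {r : ℕ} (x y : Sl r) (f g : Polynomial ℂ) :
    cur x f * cur y g = cur y g * cur x f + cur ⁅x, y⁆ (f * g) := by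
  have : cur ⁅x, y⁆ (f * g) = cur x f * cur y g - cur y g * cur x f := by
    rw [cur, ← LieAlgebra.ExtendScalars.bracket_tmul, LieHom.map_lie]
    rfl
  rw [this]
  abel

/-- The element `E_{a,b} ⊗ tᵏ` of the enveloping algebra, projected to `sl_{r+1}[t]`. -/
def curUnit (r a b k : ℕ) : UCurrent r :=
  if h : a < r + 1 ∧ b < r + 1 then cur (unitSl ⟨a, h.1⟩ ⟨b, h.2⟩) (Polynomial.X ^ k) else 0

theorem curUnit_of_lt {r a b : ℕ} (ha : a < r + 1) (hb : b < r + 1) (k : ℕ) :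
    curUnit r a b k = cur (unitSl ⟨a, ha⟩ ⟨b, hb⟩) (Polynomial.X ^ k) := dif_pos ⟨ha, hb⟩

theorem cur_sub {r : ℕ} (x y : Sl r) (f : Polynomial ℂ) : cur (x - y) f = cur x f - cur y f := by
  rw [cur, TensorProduct.tmul_sub, map_sub]; rfl

theorem cur_zero {r : ℕ} (f : Polynomial ℂ) : cur (0 : Sl r) f = 0 := by
  rw [cur, TensorProduct.tmul_zero, map_zero]

theorem isCurrent_curUnit (r : ℕ) : IsCurrent (curUnit r) r := by
  intro a b c d ha hb hc hd k l
  rw [curUnit_of_lt (by omega) (by omega), curUnit_of_lt (a := c) (by omega) (by omega),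
    curUnit_of_lt (a := a) (b := d) (by omega) (by omega),
    curUnit_of_lt (a := c) (b := b) (by omega) (by omega), cur_mul_cur, unitSl_lie, cur_sub, pow_add]
  simp only [Fin.mk.injEq]
  split_ifs <;> simp [cur_zero]

end WeylBasis
end

noncomputable section
namespace WeylBasis

attribute [local instance] LieRing.ofAssociativeRing

/-! ### The generator of the Weyl module -/

/-- By the universal property `ι` lifts to `S`, and the lift followed by the inclusion is the
identity. -/
theorem mem_of_forall_ι_mem {r : ℕ} (S : Subalgebra ℂ (UCurrent r))
    (hS : ∀ x : Current r, UniversalEnvelopingAlgebra.ι ℂ x ∈ S) (u : UCurrent r) : u ∈ S := by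
  let f : Current r →ₗ⁅ℂ⁆ S :=
    { toLinearMap := (UniversalEnvelopingAlgebra.ι ℂ : Current r →ₗ⁅ℂ⁆ UCurrent r).toLinearMap.codRestrict
        (Subalgebra.toSubmodule S) hS
      map_lie' := fun {x y} => Subtype.ext (by
        change UniversalEnvelopingAlgebra.ι ℂ ⁅x, y⁆ = _
        rw [LieHom.map_lie]
        rfl) }
  have h : S.val.comp (UniversalEnvelopingAlgebra.lift ℂ f) = AlgHom.id ℂ (UCurrent r) := by
    apply UniversalEnvelopingAlgebra.hom_ext
    ext x
    change (UniversalEnvelopingAlgebra.lift ℂ f (UniversalEnvelopingAlgebra.ι ℂ x)).val = _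
    rw [UniversalEnvelopingAlgebra.lift_ι_apply]
    rfl
  have := congrArg (fun g => g u) h
  change (UniversalEnvelopingAlgebra.lift ℂ f u).val = u at this
  rw [← this]
  exact Subtype.property _

/-- The scalar corrections in the `unitSl a a` add up to a multiple of the trace, which is zero. -/
theorem sl_eq_sum {r : ℕ} (x : Sl r) : x = ∑ a, ∑ b, x.val a b • unitSl a b := by
  apply Subtype.ext
  have h1 : (∑ a, ∑ b, x.val a b • unitSl a b : Sl r).val =
      ∑ a, ∑ b, x.val a b • (unitSl a b).val := by
    rw [AddSubmonoidClass.coe_finsetSum]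
    refine Finset.sum_congr rfl fun a _ => ?_
    rw [AddSubmonoidClass.coe_finsetSum]
    rfl
  rw [h1]
  simp only [unitSl_val, smul_sub, Finset.sum_sub_distrib, smul_smul, ← Finset.sum_smul, mul_ite,
    mul_zero, Finset.sum_ite_eq, Finset.mem_univ, if_true]
  rw [← Finset.sum_mul]
  have h2 : ∑ a, x.val a a = 0 := x.2
  rw [h2, zero_mul, zero_smul, sub_zero]
  conv_lhs => rw [Matrix.matrix_eq_sum_single x.val]
  simp

theorem levelAlg_curUnit (r : ℕ) (u : UCurrent r) : u ∈ levelAlg (curUnit r) r := by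
  refine mem_of_forall_ι_mem _ (fun x => ?_) u
  induction x using TensorProduct.induction_on with
  | zero => rw [map_zero]; exact zero_mem _
  | add x y h1 h2 => rw [map_add]; exact add_mem h1 h2
  | tmul f x =>
    induction f using Polynomial.induction_on' with
    | add f g h1 h2 => rw [TensorProduct.add_tmul, map_add]; exact add_mem h1 h2
    | monomial n c =>
      rw [sl_eq_sum x, TensorProduct.tmul_sum, map_sum]
      refine sum_mem fun a _ => ?_
      rw [TensorProduct.tmul_sum, map_sum]
      refine sum_mem fun b _ => ?_
      generalize (x.val : Matrix _ _ ℂ) a b = y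
      have h : (Polynomial.monomial n c) ⊗ₜ[ℂ] (y • unitSl a b) =
          (y * c) • ((Polynomial.X ^ n : Polynomial ℂ) ⊗ₜ[ℂ] unitSl a b) := by
        rw [TensorProduct.tmul_smul, ← Polynomial.smul_X_eq_monomial, ← TensorProduct.smul_tmul',
          smul_smul]
      rw [h, map_smul]
      refine Subalgebra.smul_mem _ ?_ _
      have := mem_levelAlg (curUnit r) (Nat.lt_succ_iff.1 a.2) (Nat.lt_succ_iff.1 b.2) n
      rwa [curUnit_of_lt a.2 b.2] at this

/-- The left ideal of the defining relations, as a complex vector space. -/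
def weylIdeal {r : ℕ} (m : Fin r → ℕ) : Submodule ℂ (UCurrent r) :=
  (Submodule.span (UCurrent r) (weylRelations m)).restrictScalars ℂ

theorem mul_mem_weylIdeal {r : ℕ} {m : Fin r → ℕ} (u : UCurrent r) {z : UCurrent r}
    (hz : z ∈ weylIdeal m) : u * z ∈ weylIdeal m :=
  Submodule.smul_mem (Submodule.span (UCurrent r) (weylRelations m)) u hz

theorem subset_weylIdeal {r : ℕ} {m : Fin r → ℕ} {z : UCurrent r} (hz : z ∈ weylRelations m) :
    z ∈ weylIdeal m := Submodule.subset_span hz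

/-- The extension of a highest weight by zero. -/
def extend {r : ℕ} (m : Fin r → ℕ) (i : ℕ) : ℕ := if h : i < r then m ⟨i, h⟩ else 0

theorem unitSl_mem_cartan {r : ℕ} (a : Fin (r + 1)) : unitSl a a ∈ cartan r := by
  intro i j hij
  rw [unitSl_val, Matrix.sub_apply, Matrix.smul_apply, Matrix.one_apply_ne hij, smul_zero, sub_zero]
  exact Matrix.single_apply_of_ne _ _ _ _ _ (by rintro ⟨rfl, rfl⟩; exact hij rfl)

theorem eval_unitSl_sub {r : ℕ} (μ : Weight r) (i : Fin r) :
    μ.eval (unitSl i.castSucc i.castSucc) - μ.eval (unitSl i.succ i.succ) = μ i := by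
  have h : ∀ k : Fin r, fundWeight k (unitSl i.castSucc i.castSucc) -
      fundWeight k (unitSl i.succ i.succ) = if k = i then 1 else 0 := by
    intro k
    rw [fundWeight, fundWeight, ← Finset.sum_sub_distrib]
    have h1 : ∀ l : Fin (r + 1), (unitSl i.castSucc i.castSucc).val l l -
        (unitSl i.succ i.succ).val l l =
        (if i.castSucc = l then (1 : ℂ) else 0) - if i.succ = l then 1 else 0 := by
      intro l
      simp [unitSl_val, Matrix.single_apply]
    rw [Finset.sum_congr rfl fun l _ => h1 l, Finset.sum_sub_distrib, Finset.sum_ite_eq,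
      Finset.sum_ite_eq]
    simp only [Finset.mem_Iic, Fin.le_def, Fin.val_castSucc, Fin.val_succ, Fin.ext_iff]
    split_ifs <;> first | omega | simp
  rw [Weight.eval, Weight.eval, ← Finset.sum_sub_distrib]
  simp only [← mul_sub, h]
  simp

theorem isHighest_one {r : ℕ} (m : Fin r → ℕ) :
    IsHighest (curUnit r) r (extend m) (weylIdeal m) 1 := by
  refine ⟨?_, ?_, ?_, ?_⟩
  · intro a b k hab hb
    rw [mul_one, curUnit_of_lt (by omega) (by omega)]
    refine subset_weylIdeal (Or.inl (Or.inl (Or.inl ⟨_, Submodule.subset_span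
      ⟨⟨a, by omega⟩, ⟨b - 1, by omega⟩, Fin.le_def.2 (by simp; omega), ?_⟩, _, rfl⟩)))
    rw [unitSl_of_ne (by simp; omega), xPlus]
    apply Subtype.ext
    simp only [LieAlgebra.SpecialLinear.val_single]
    congr 1
    ext
    simp
    omega
  · intro a k ha
    rw [mul_one, curUnit_of_lt (by omega) (by omega), pow_succ']
    exact subset_weylIdeal (Or.inl (Or.inl (Or.inr ⟨_, unitSl_mem_cartan _, _, rfl⟩)))
  · refine ⟨fun a => if h : a < r + 1 then (dominant m).eval (unitSl ⟨a, h⟩ ⟨a, h⟩) else 0, ?_, ?_⟩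
    · intro a ha
      beta_reduce
      rw [mul_one, curUnit_of_lt (by omega) (by omega), pow_zero, dif_pos (by omega)]
      refine subset_weylIdeal (Or.inl (Or.inr ⟨_, unitSl_mem_cartan ⟨a, by omega⟩, ?_⟩))
      rw [Algebra.algebraMap_eq_smul_one]
    · intro i hi
      beta_reduce
      rw [dif_pos (by omega), dif_pos (by omega)]
      have := eval_unitSl_sub (dominant m) ⟨i, hi⟩
      simp only [dominant] at this
      rw [extend, dif_pos hi]
      exact_mod_cast this
  · intro i hi
    rw [mul_one, curUnit_of_lt (by omega) (by omega), extend, dif_pos hi, pow_zero]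
    refine subset_weylIdeal (Or.inr ⟨⟨i, hi⟩, ?_⟩)
    rw [unitSl_of_ne (by simp)]
    rfl

theorem isStable_weylIdeal {r : ℕ} (m : Fin r → ℕ) : IsStable (curUnit r) r (weylIdeal m) :=
  fun _ _ _ _ _ _ hz => mul_mem_weylIdeal _ hz

theorem mem_weylIdeal_sup_span {r : ℕ} (m : Fin r → ℕ) (u : UCurrent r) :
    u ∈ weylIdeal m ⊔ Submodule.span ℂ (basisMon (curUnit r) r (extend m)) := by
  have := levelAlg_mul_mem (isCurrent_curUnit r) le_rfl (isStable_weylIdeal m) (isHighest_one m)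
    (levelAlg_curUnit r u)
  simpa using this

/-! ### Comparison of the sets of monomials -/

theorem sort_eq_of_sortedLE {l : List ℕ} (h : l.SortedLE) :
    (l : Multiset ℕ).sort (· ≤ ·) = l := by
  rw [Multiset.coe_sort]
  exact List.mergeSort_eq_self _ h.pairwise

theorem cur_xMinus {r : ℕ} {i j : Fin r} (h : i ≤ j) (a : ℕ) :
    cur (xMinus i j h) (Polynomial.X ^ a) = curUnit r (j + 1) i a := by
  have h1 : (i : ℕ) ≤ j := h
  rw [curUnit_of_lt (by omega) (by omega), unitSl_of_ne (by simp; omega)]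
  rfl

theorem ofFn_eq_map_range {α : Type*} {n : ℕ} (f : Fin n → α) (g : ℕ → α)
    (h : ∀ i : Fin n, f i = g i) : List.ofFn f = (List.range n).map g :=
  List.ext_getElem (by simp) (by intro i h1 h2; simp [h])

theorem rowMono_eq_rowProd {r : ℕ} (j : Fin r) (d : ExpRow j) (s : ℕ → Multiset ℕ)
    (hs : ∀ i : Fin (j.val + 1), s i = ((d i).val : Multiset ℕ)) :
    rowMono j d = rowProd (curUnit r) j s := by
  rw [rowMono, rowProd]
  congr 1
  refine ofFn_eq_map_range _ _ fun i => ?_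
  rw [xMono, hs, sort_eq_of_sortedLE (d i).2]
  congr 1
  refine List.map_congr_left fun a _ => ?_
  rw [cur_xMinus]
  rfl

theorem mono_eq_prod_rowProd {r : ℕ} (d : (j : Fin r) → ExpRow j) (t : ℕ → ℕ → Multiset ℕ)
    (ht : ∀ (j : Fin r) (i : Fin (j.val + 1)), t j i = ((d j i).val : Multiset ℕ)) :
    mono d = ((List.range r).map fun j => rowProd (curUnit r) j (t j)).prod := by
  rw [mono]
  congr 1
  exact ofFn_eq_map_range _ _ fun j => rowMono_eq_rowProd j (d j) (t j) (ht j)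

theorem sum_Ioi_eq_sum_Ioo {r : ℕ} (j : Fin r) (f : Fin r → ℤ) (g : ℕ → ℤ)
    (h : ∀ s : Fin r, j < s → f s = g s) :
    ∑ s ∈ Finset.Ioi j, f s = ∑ s ∈ Finset.Ioo (j : ℕ) r, g s := by
  refine Finset.sum_bij (fun s _ => (s : ℕ)) ?_ ?_ ?_ ?_
  · intro s hs
    simp only [Finset.mem_Ioi, Fin.lt_def] at hs
    simp [hs]
  · intro a _ b _ hab
    exact Fin.ext hab
  · intro b hb
    rw [Finset.mem_Ioo] at hb
    exact ⟨⟨b, hb.2⟩, by simp [Fin.lt_def, hb.1], rfl⟩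
  · intro s hs
    exact h s (Finset.mem_Ioi.1 hs)

theorem dominant_sub_sum_eta {r : ℕ} (m : Fin r → ℕ) (d : (j : Fin r) → ExpRow j)
    (t : ℕ → ℕ → Multiset ℕ)
    (ht : ∀ (j : Fin r) (i : Fin (j.val + 1)), t j i = ((d j i).val : Multiset ℕ))
    (j : Fin r) (i : Fin (j.val + 1)) :
    (dominant m - ∑ s ∈ Finset.Ioi j, eta s (d s)) (idx j i) =
      rowWeight (extend m) t r j i := by
  have hi : (i : ℕ) < r := (Nat.le_of_lt_succ i.2).trans_lt j.2
  have hm : (dominant m (idx j i) : ℤ) = extend m i := by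
    rw [extend, dif_pos hi]
    rfl
  rw [Pi.sub_apply, Finset.sum_apply, hm, rowWeight, sub_eq_add_neg, ← Finset.sum_neg_distrib]
  congr 1
  refine sum_Ioi_eq_sum_Ioo j _ _ fun s hs => ?_
  have hs' : (j : ℕ) < s := hs
  have hi' : (idx j i : ℕ) = i := rfl
  have hk : idx j i < s := Fin.lt_def.2 (by omega)
  have h1 := ht s ⟨i, by omega⟩
  have h2 := ht s ⟨i + 1, by omega⟩
  simp only at h1 h2
  rw [eta_apply _ hk, h1, h2, neg_sub]
  rfl

theorem mem_iff_memF (s : ExpF) (M : ℤ) : s.Mem M ↔ MemF M (s.val : Multiset ℕ) := by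
  rw [ExpF.Mem, MemF]
  simp [ExpF.len]

theorem basisSet_eq {r : ℕ} (m : Fin r → ℕ) :
    basisSet m = basisMon (curUnit r) r (extend m) := by
  ext x
  rw [mem_basisMon_iff]
  constructor
  · rintro ⟨d, hd, rfl⟩
    let t : ℕ → ℕ → Multiset ℕ := fun j i =>
      if h : ∃ h : j < r, i < j + 1 then ((d ⟨j, h.1⟩ ⟨i, h.2⟩).val : Multiset ℕ) else 0
    have ht : ∀ (j : Fin r) (i : Fin (j.val + 1)), t j i = ((d j i).val : Multiset ℕ) :=
      fun j i => dif_pos ⟨j.2, i.2⟩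
    refine ⟨t, fun j hj i hi => ?_, mono_eq_prod_rowProd d t ht⟩
    have := hd ⟨j, hj⟩ ⟨i, Nat.lt_succ_of_le hi⟩
    rw [dominant_sub_sum_eta m d t ht, mem_iff_memF, ← ht] at this
    exact this
  · rintro ⟨t, h, rfl⟩
    let d : (j : Fin r) → ExpRow j := fun j i =>
      ⟨(t j i).sort (· ≤ ·), (Multiset.pairwise_sort _ _).sortedLE⟩
    have ht : ∀ (j : Fin r) (i : Fin (j.val + 1)), t j i = ((d j i).val : Multiset ℕ) :=
      fun j i => (Multiset.sort_eq _ _).symm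
    refine ⟨d, fun j i => ?_, (mono_eq_prod_rowProd d t ht).symm⟩
    rw [dominant_sub_sum_eta m d t ht, mem_iff_memF, ← ht]
    exact h j j.2 i (Nat.le_of_lt_succ i.2)

end WeylBasis
end

/-! ### The lower bound: a deformation of tensor products of exterior powers. -/

noncomputable section
namespace WeylBasis

attribute [local instance] LieRing.ofAssociativeRing

/-! ### A family of modules of the current algebra

The current algebra acts by derivations on the polynomials in the entries of a family of matrices,
the variable `(a, k, c)` being the entry in the row `a` and the column `c` of the matrix with the
index `k`. A coefficient function `g` scales the action on the matrix with the index `k` by `g k`. -/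

section Rep

variable {B : Type*} [CommRing B] [Algebra ℂ B] {n : ℕ} {ι : Type*}

/-- The derivation by which the matrix `x`, scaled by `g k` on the index `k`, acts. -/
def der (x : Matrix (Fin n) (Fin n) ℂ) (g : ι → B) :
    Derivation B (MvPolynomial (Fin n × ι × ℕ) B) (MvPolynomial (Fin n × ι × ℕ) B) :=
  MvPolynomial.mkDerivation B fun p =>
    ∑ a, (algebraMap ℂ B (x a p.1) * g p.2.1) • MvPolynomial.X (a, p.2)

theorem der_X (x : Matrix (Fin n) (Fin n) ℂ) (g : ι → B) (b : Fin n) (p : ι × ℕ) :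
    der x g (MvPolynomial.X (b, p)) =
      ∑ a, (algebraMap ℂ B (x a b) * g p.1) • MvPolynomial.X (a, p) :=
  MvPolynomial.mkDerivation_X _ _ _

theorem der_add_left (x y : Matrix (Fin n) (Fin n) ℂ) (g : ι → B) :
    der (x + y) g = der x g + der y g := by
  apply MvPolynomial.derivation_ext
  rintro ⟨b, p⟩
  simp [der_X, add_mul, add_smul, Finset.sum_add_distrib]

theorem der_add_right (x : Matrix (Fin n) (Fin n) ℂ) (g h : ι → B) :
    der x (g + h) = der x g + der x h := by
  apply MvPolynomial.derivation_ext
  rintro ⟨b, p⟩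
  simp [der_X, mul_add, add_smul, Finset.sum_add_distrib]

theorem der_smul_right (x : Matrix (Fin n) (Fin n) ℂ) (c : B) (g : ι → B) :
    der x (c • g) = c • der x g := by
  apply MvPolynomial.derivation_ext
  rintro ⟨b, p⟩
  simp only [der_X, Derivation.smul_apply, Finset.smul_sum, smul_smul, Pi.smul_apply, smul_eq_mul]
  exact Finset.sum_congr rfl fun a _ => by rw [mul_left_comm]

theorem der_smul_left (c : ℂ) (x : Matrix (Fin n) (Fin n) ℂ) (g : ι → B) :
    der (c • x) g = algebraMap ℂ B c • der x g := by
  apply MvPolynomial.derivation_ext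
  rintro ⟨b, p⟩
  simp only [der_X, Derivation.smul_apply, Finset.smul_sum, smul_smul, Matrix.smul_apply,
    smul_eq_mul, map_mul, mul_assoc]

theorem der_der_X (x y : Matrix (Fin n) (Fin n) ℂ) (g h : ι → B) (b : Fin n) (p : ι × ℕ) :
    der x g (der y h (MvPolynomial.X (b, p))) =
      ∑ a, (algebraMap ℂ B ((x * y) a b) * (g p.1 * h p.1)) • MvPolynomial.X (a, p) := by
  rw [der_X, map_sum]
  simp only [Derivation.map_smul, der_X, Finset.smul_sum, smul_smul]
  rw [Finset.sum_comm]
  refine Finset.sum_congr rfl fun a _ => ?_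
  rw [← Finset.sum_smul, Matrix.mul_apply, map_sum, Finset.sum_mul]
  congr 1
  refine Finset.sum_congr rfl fun c _ => ?_
  rw [map_mul]
  ring

theorem lie_der (x y : Matrix (Fin n) (Fin n) ℂ) (g h : ι → B) :
    ⁅der x g, der y h⁆ = der (x * y - y * x) (g * h) := by
  apply MvPolynomial.derivation_ext
  rintro ⟨b, p⟩
  rw [Derivation.commutator_apply, der_der_X, der_der_X, der_X, ← Finset.sum_sub_distrib]
  refine Finset.sum_congr rfl fun a _ => ?_
  rw [← sub_smul, Matrix.sub_apply, map_sub, Pi.mul_apply]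
  congr 1
  ring

/-- The element `x ⊗ f` of the current algebra acts as this derivation if `t` acts by `α k` on the
matrix with the index `k`. -/
def derEval {r : ℕ} (α : ι → B) (f : Polynomial ℂ) (x : Sl r) :
    Module.End B (MvPolynomial (Fin (r + 1) × ι × ℕ) B) :=
  (der x.val fun k => Polynomial.aeval (α k) f).toLinearMap

theorem derEval_apply {r : ℕ} (α : ι → B) (f : Polynomial ℂ) (x : Sl r)
    (y : MvPolynomial (Fin (r + 1) × ι × ℕ) B) :
    derEval α f x y = der x.val (fun k => Polynomial.aeval (α k) f) y := rfl

theorem derEval_add_left {r : ℕ} (α : ι → B) (f g : Polynomial ℂ) (x : Sl r) :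
    derEval α (f + g) x = derEval α f x + derEval α g x := by
  have : (fun k => Polynomial.aeval (α k) (f + g)) =
      (fun k => Polynomial.aeval (α k) f) + fun k => Polynomial.aeval (α k) g := by
    ext k; simp
  refine LinearMap.ext fun y => ?_
  rw [LinearMap.add_apply, derEval_apply, derEval_apply, derEval_apply, this, der_add_right,
    Derivation.add_apply]

theorem derEval_add_right {r : ℕ} (α : ι → B) (f : Polynomial ℂ) (x y : Sl r) :
    derEval α f (x + y) = derEval α f x + derEval α f y := by
  have : (x + y).val = x.val + y.val := rfl
  refine LinearMap.ext fun z => ?_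
  rw [LinearMap.add_apply, derEval_apply, derEval_apply, derEval_apply, this, der_add_left,
    Derivation.add_apply]

theorem derEval_smul_left {r : ℕ} (α : ι → B) (c : ℂ) (f : Polynomial ℂ) (x : Sl r) :
    derEval α (c • f) x = c • derEval α f x := by
  have : (fun k => Polynomial.aeval (α k) (c • f)) =
      algebraMap ℂ B c • fun k => Polynomial.aeval (α k) f := by
    ext k; simp [Algebra.smul_def]
  refine LinearMap.ext fun y => ?_
  rw [LinearMap.smul_apply, derEval_apply, derEval_apply, this, der_smul_right,
    Derivation.smul_apply, algebraMap_smul]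

theorem derEval_smul_right {r : ℕ} (α : ι → B) (c : ℂ) (f : Polynomial ℂ) (x : Sl r) :
    derEval α f (c • x) = c • derEval α f x := by
  have : (c • x).val = c • x.val := rfl
  refine LinearMap.ext fun y => ?_
  rw [LinearMap.smul_apply, derEval_apply, derEval_apply, this, der_smul_left,
    Derivation.smul_apply, algebraMap_smul]

theorem derEval_lie {r : ℕ} (α : ι → B) (f g : Polynomial ℂ) (x y : Sl r) :
    derEval α (f * g) ⁅x, y⁆ = ⁅derEval α f x, derEval α g y⁆ := by
  have h1 : (⁅x, y⁆ : Sl r).val = x.val * y.val - y.val * x.val := rfl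
  have h2 : (fun k => Polynomial.aeval (α k) (f * g)) =
      (fun k => Polynomial.aeval (α k) f) * fun k => Polynomial.aeval (α k) g := by
    ext k; simp
  refine LinearMap.ext fun z => ?_
  rw [derEval_apply, h1, h2, ← lie_der, Derivation.commutator_apply,
    LieRing.of_associative_ring_bracket, LinearMap.sub_apply, Module.End.mul_apply, Module.End.mul_apply]
  rfl

/-- The action of the current algebra for which `t` acts by `α k` on the matrix with the
index `k`, as a linear map. -/
def repLin (r : ℕ) (α : ι → B) :
    Current r →ₗ[ℂ] Module.End B (MvPolynomial (Fin (r + 1) × ι × ℕ) B) :=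
  TensorProduct.lift (LinearMap.mk₂ ℂ (derEval α) (derEval_add_left α) (derEval_smul_left α)
    (derEval_add_right α) (fun c => derEval_smul_right α c))

theorem repLin_tmul {r : ℕ} (α : ι → B) (f : Polynomial ℂ) (x : Sl r) :
    repLin r α (f ⊗ₜ x) = derEval α f x := rfl

theorem repLin_lie {r : ℕ} (α : ι → B) (z w : Current r) :
    repLin r α ⁅z, w⁆ = ⁅repLin r α z, repLin r α w⁆ := by
  induction z using TensorProduct.induction_on with
  | zero =>
    have h : ⁅(0 : Current r), w⁆ = 0 := zero_lie w
    exact (congrArg _ h).trans ((map_zero _).trans (by rw [map_zero, zero_lie]))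
  | add z z' h1 h2 =>
    have h : ⁅z + z', w⁆ = ⁅z, w⁆ + ⁅z', w⁆ := add_lie z z' w
    exact (congrArg _ h).trans ((map_add _ _ _).trans (by rw [h1, h2, map_add, add_lie]))
  | tmul f x =>
    induction w using TensorProduct.induction_on with
    | zero =>
      have h : ⁅(f ⊗ₜ[ℂ] x : Current r), (0 : Current r)⁆ = 0 :=
        (fun p : Current r => (lie_zero p : ⁅p, (0 : Current r)⁆ = 0)) _
      exact (congrArg _ h).trans ((map_zero _).trans (by rw [map_zero, lie_zero]))
    | add z z' h1 h2 =>
      have h : ⁅(f ⊗ₜ[ℂ] x : Current r), z + z'⁆ =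
          ⁅(f ⊗ₜ[ℂ] x : Current r), z⁆ + ⁅(f ⊗ₜ[ℂ] x : Current r), z'⁆ :=
        (fun p : Current r => (lie_add p z z' : ⁅p, z + z'⁆ = ⁅p, z⁆ + ⁅p, z'⁆)) _
      exact (congrArg _ h).trans ((map_add _ _ _).trans (by rw [h1, h2, map_add, lie_add]))
    | tmul g y =>
      rw [LieAlgebra.ExtendScalars.bracket_tmul, repLin_tmul, repLin_tmul, repLin_tmul, derEval_lie]

/-- The action of the enveloping algebra. -/
def rep (r : ℕ) (α : ι → B) :
    UCurrent r →ₐ[ℂ] Module.End B (MvPolynomial (Fin (r + 1) × ι × ℕ) B) :=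
  UniversalEnvelopingAlgebra.lift ℂ
    { repLin r α with map_lie' := fun {x y} => repLin_lie α x y }

theorem rep_cur {r : ℕ} (α : ι → B) (x : Sl r) (f : Polynomial ℂ) :
    rep r α (cur x f) = derEval α f x := by
  rw [rep, cur, UniversalEnvelopingAlgebra.lift_ι_apply]
  exact repLin_tmul α f x

end Rep

end WeylBasis
end

noncomputable section
namespace WeylBasis

/-! ### Products of minors -/

theorem derivation_prod {R A κ : Type*} [CommRing R] [CommRing A] [Algebra R A] [DecidableEq κ]
    (D : Derivation R A A) (s : Finset κ) (f : κ → A) :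
    D (∏ i ∈ s, f i) = ∑ i ∈ s, (∏ j ∈ s.erase i, f j) * D (f i) := by
  induction s using Finset.induction_on with
  | empty => simp
  | insert a s ha ih =>
    rw [Finset.prod_insert ha, Derivation.leibniz, ih, Finset.sum_insert ha,
      Finset.erase_insert ha, smul_eq_mul, smul_eq_mul, Finset.mul_sum, add_comm]
    congr 1
    refine Finset.sum_congr rfl fun i hi => ?_
    have hia : a ≠ i := fun h => ha (h ▸ hi)
    rw [Finset.erase_insert_of_ne hia,
      Finset.prod_insert (fun h => ha (Finset.mem_of_mem_erase h)), mul_assoc]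

/-- Orders of nilpotency add under products. In `exists_rep_eq_X_smul` this gives the exponent `m_i
+ 1` for a product of minors. -/
theorem iterate_derivation_mul_eq_zero {R A : Type*} [CommRing R] [CommRing A] [Algebra R A]
    (D : Derivation R A A) (n : ℕ) : ∀ (a b : ℕ) (x y : A), a + b = n → D^[a + 1] x = 0 →
      D^[b + 1] y = 0 → D^[n + 1] (x * y) = 0 := by
  have hadd : ∀ (k : ℕ) (x y : A), D^[k] (x + y) = D^[k] x + D^[k] y := fun k x y => by
    induction k generalizing x y with
    | zero => rfl
    | succ k ih => rw [Function.iterate_succ_apply, map_add, ih]; rfl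
  have hzero : ∀ k : ℕ, D^[k] (0 : A) = 0 := fun k => by
    induction k with
    | zero => rfl
    | succ k ih => rw [Function.iterate_succ_apply, map_zero, ih]
  induction n with
  | zero =>
    intro a b x y hab hx hy
    obtain ⟨rfl, rfl⟩ : a = 0 ∧ b = 0 := by omega
    simp only [zero_add, Function.iterate_one] at hx hy ⊢
    rw [Derivation.leibniz, hx, hy, smul_zero, smul_zero, add_zero]
  | succ n ih =>
    intro a b x y hab hx hy
    rw [Function.iterate_succ_apply, Derivation.leibniz, hadd, smul_eq_mul, smul_eq_mul]
    have h1 : D^[n + 1] (x * D y) = 0 := by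
      rcases b with - | b
      · simp only [zero_add, Function.iterate_one] at hy
        rw [hy, mul_zero, hzero]
      · exact ih a b x (D y) (by omega) hx hy
    have h2 : D^[n + 1] (y * D x) = 0 := by
      rcases a with - | a
      · simp only [zero_add, Function.iterate_one] at hx
        rw [hx, mul_zero, hzero]
      · exact ih b a y (D x) (by omega) hy hx
    rw [h1, h2, add_zero]

theorem iterate_derivation_prod_eq_zero {R A κ : Type*} [CommRing R] [CommRing A] [Algebra R A]
    (D : Derivation R A A) (s : Finset κ) (f : κ → A) (e : κ → ℕ)
    (h : ∀ i ∈ s, D^[e i + 1] (f i) = 0) : D^[(∑ i ∈ s, e i) + 1] (∏ i ∈ s, f i) = 0 := by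
  classical
  induction s using Finset.induction_on with
  | empty => simp
  | insert a s ha ih =>
    rw [Finset.prod_insert ha, Finset.sum_insert ha]
    exact iterate_derivation_mul_eq_zero D _ _ _ _ _ rfl (h a (Finset.mem_insert_self _ _))
      (ih fun i hi => h i (Finset.mem_insert_of_mem hi))

section Minor

variable {B : Type*} [CommRing B] [Algebra ℂ B] {n : ℕ} {ι : Type*}

/-- The minor of the matrix with the index `k` with the rows `T` and the first columns. -/
def minor (B : Type*) [CommRing B] (k : ι) {e : ℕ} (T : Fin e → Fin n) :
    MvPolynomial (Fin n × ι × ℕ) B :=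
  Matrix.det (Matrix.of fun c' c : Fin e => MvPolynomial.X (T c, k, (c' : ℕ)))

theorem minor_eq_zero {B : Type*} [CommRing B] (k : ι) {e : ℕ} {T : Fin e → Fin n} {c c' : Fin e} (h : c ≠ c')
    (hT : T c = T c') : minor B k T = 0 :=
  Matrix.det_zero_of_column_eq h fun i => by simp [hT]

/-- A minor is multilinear in its rows, so the derivation replaces one row at a time, as in an
exterior power. -/
theorem der_minor (x : Matrix (Fin n) (Fin n) ℂ) (g : ι → B) (k : ι) {e : ℕ}
    (T : Fin e → Fin n) :
    der x g (minor B k T) = ∑ c, ∑ a,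
      (algebraMap ℂ B (x a (T c)) * g k) • minor B k (Function.update T c a) := by
  have h : ∀ T : Fin e → Fin n, minor B k T = ∑ σ : Equiv.Perm (Fin e),
      (Equiv.Perm.sign σ : ℤ) • ∏ c, MvPolynomial.X (T c, k, (σ c : ℕ)) := by
    intro T
    rw [minor, Matrix.det_apply]
    rfl
  simp only [h, Finset.smul_sum, map_sum, map_zsmul]
  rw [Finset.sum_congr rfl fun c _ => Finset.sum_comm, Finset.sum_comm]
  refine Finset.sum_congr rfl fun σ _ => ?_
  rw [derivation_prod, Finset.smul_sum]
  refine Finset.sum_congr rfl fun c _ => ?_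
  rw [der_X, Finset.mul_sum, Finset.smul_sum]
  refine Finset.sum_congr rfl fun a _ => ?_
  have h1 : ∏ j ∈ Finset.univ.erase c,
      (MvPolynomial.X (T j, k, (σ j : ℕ)) : MvPolynomial (Fin n × ι × ℕ) B) =
      ∏ j ∈ Finset.univ.erase c, MvPolynomial.X (Function.update T c a j, k, (σ j : ℕ)) :=
    Finset.prod_congr rfl fun j hj => by rw [Function.update_of_ne (Finset.ne_of_mem_erase hj)]
  rw [mul_smul_comm, smul_comm (Equiv.Perm.sign σ : ℤ),
    ← Finset.mul_prod_erase Finset.univ _ (Finset.mem_univ c), Function.update_self, h1,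
    mul_comm (MvPolynomial.X _)]

theorem der_single_minor (a b : Fin n) (k : ι) {e : ℕ} (T : Fin e → Fin n) :
    der (Matrix.single a b 1) (1 : ι → B) (minor B k T) =
      ∑ c, if T c = b then minor B k (Function.update T c a) else 0 := by
  rw [der_minor]
  refine Finset.sum_congr rfl fun c _ => ?_
  split_ifs with h
  · rw [Finset.sum_eq_single a]
    · simp [h]
    · intro a' _ ha'
      rw [Matrix.single_apply_of_row_ne ha'.symm, map_zero, zero_mul, zero_smul]
    · simp
  · refine Finset.sum_eq_zero fun a' _ => ?_
    rw [Matrix.single_apply_of_col_ne _ _ (Ne.symm h), map_zero, zero_mul, zero_smul]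

variable {d : ι → ℕ}

/-- The family of first rows. -/
def topRows (hd : ∀ k, d k ≤ n) (k : ι) : Fin (d k) → Fin n := Fin.castLE (hd k)

/-- Row `i` is replaced by row `i+1`. If both are present the minor gets equal rows, and if row `i`
is absent nothing happens. Only for `d k = i + 1` is the result nonzero, and then row `i` is gone.
-/
theorem der_single_minor_topRows (hd : ∀ k, d k ≤ n) (i : ℕ) (hi : i + 1 < n) (k : ι) :
    (der (Matrix.single ⟨i + 1, hi⟩ ⟨i, by omega⟩ 1) (1 : ι → B))^[
      (if d k = i + 1 then 1 else 0) + 1] (minor B k (topRows hd k)) = 0 := by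
  have hval : ∀ c : Fin (d k), (topRows hd k c : ℕ) = c := fun c => rfl
  split_ifs with hk
  · simp only [Function.iterate_succ, Function.iterate_zero, Function.comp_apply, id]
    rw [der_single_minor, map_sum]
    refine Finset.sum_eq_zero fun c _ => ?_
    split_ifs with hc
    · rw [der_single_minor]
      refine Finset.sum_eq_zero fun c' _ => if_neg fun h => ?_
      by_cases hcc : c' = c
      · rw [hcc, Function.update_self, Fin.ext_iff] at h
        simp at h
      · rw [Function.update_of_ne hcc, ← hc] at h
        exact hcc (Fin.castLE_injective _ h)
    · exact map_zero _
  · rw [zero_add, Function.iterate_one, der_single_minor]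
    refine Finset.sum_eq_zero fun c _ => ?_
    split_ifs with hc
    · have hc' : (c : ℕ) = i := (hval c).symm.trans (congrArg Fin.val hc)
      have h2 : i + 1 < d k := by have := c.2; omega
      have hne : c ≠ ⟨i + 1, h2⟩ := fun h => by
        have := congrArg Fin.val h
        simp only at this
        omega
      refine minor_eq_zero k hne ?_
      rw [Function.update_self, Function.update_of_ne hne.symm]
      rfl
    · rfl

variable [Fintype ι]

/-- The product over all indices `k` of the minors with the rows `T k`. -/
def minorProd (B : Type*) [CommRing B] (T : (k : ι) → Fin (d k) → Fin n) :
    MvPolynomial (Fin n × ι × ℕ) B :=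
  ∏ k, minor B k (T k)

theorem minorProd_eq_zero {B : Type*} [CommRing B] (T : (k : ι) → Fin (d k) → Fin n) (k : ι)
    {c c' : Fin (d k)} (h : c ≠ c') (hT : T k c = T k c') : minorProd B T = 0 :=
  Finset.prod_eq_zero (Finset.mem_univ k) (minor_eq_zero k h hT)

theorem der_minorProd [DecidableEq ι] (x : Matrix (Fin n) (Fin n) ℂ) (g : ι → B)
    (T : (k : ι) → Fin (d k) → Fin n) :
    der x g (minorProd B T) = ∑ k, ∑ c, ∑ a, (algebraMap ℂ B (x a (T k c)) * g k) •
      minorProd B (Function.update T k (Function.update (T k) c a)) := by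
  rw [minorProd, derivation_prod]
  refine Finset.sum_congr rfl fun k _ => ?_
  rw [der_minor, Finset.mul_sum]
  refine Finset.sum_congr rfl fun c _ => ?_
  rw [Finset.mul_sum]
  refine Finset.sum_congr rfl fun a _ => ?_
  have h : ∏ j ∈ Finset.univ.erase k, minor B j (T j) = ∏ j ∈ Finset.univ.erase k,
      minor B j (Function.update T k (Function.update (T k) c a) j) :=
    Finset.prod_congr rfl fun j hj => by rw [Function.update_of_ne (Finset.ne_of_mem_erase hj)]
  rw [mul_smul_comm, minorProd, ← Finset.mul_prod_erase Finset.univ _ (Finset.mem_univ k),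
    Function.update_self, h, mul_comm (minor B k _)]

/-- Diagonal matrices act on products of minors by scalars. -/
theorem der_minorProd_of_isDiag (x : Matrix (Fin n) (Fin n) ℂ) (hx : x.IsDiag)
    (g : ι → B) (T : (k : ι) → Fin (d k) → Fin n) :
    der x g (minorProd B T) =
      (∑ k, ∑ c, algebraMap ℂ B (x (T k c) (T k c)) * g k) • minorProd B T := by
  classical
  rw [der_minorProd, Finset.sum_smul]
  refine Finset.sum_congr rfl fun k _ => ?_
  rw [Finset.sum_smul]
  refine Finset.sum_congr rfl fun c _ => ?_
  rw [Finset.sum_eq_single (T k c)]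
  · rw [Function.update_eq_self, Function.update_eq_self]
  · intro a _ ha
    rw [hx ha, map_zero, zero_mul, zero_smul]
  · simp

/-- A strictly upper triangular matrix replaces a leading row by an earlier one, which is already in
the minor. -/
theorem der_minorProd_topRows (hd : ∀ k, d k ≤ n) (x : Matrix (Fin n) (Fin n) ℂ)
    (hx : ∀ a b, ¬ a < b → x a b = 0) (g : ι → B) :
    der x g (minorProd B (topRows hd)) = 0 := by
  classical
  rw [der_minorProd]
  refine Finset.sum_eq_zero fun k _ => Finset.sum_eq_zero fun c _ => Finset.sum_eq_zero fun a _ => ?_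
  by_cases h : a < topRows hd k c
  · have h' : (a : ℕ) < c := h
    rw [minorProd_eq_zero _ k (c := c) (c' := ⟨a, h'.trans c.2⟩), smul_zero]
    · intro hc
      rw [hc] at h'
      exact lt_irrefl _ h'
    · rw [Function.update_self, Function.update_self, Function.update_of_ne]
      · rfl
      · intro hc
        rw [← hc] at h'
        exact lt_irrefl _ h'
  · rw [hx _ _ h, map_zero, zero_mul, zero_smul]

end Minor

end WeylBasis
end

noncomputable section
namespace WeylBasis

open Polynomial (X)

/-! ### The cyclic submodule generated by the product of the leading minors -/

theorem derEval_one {r : ℕ} {ι : Type*} (α : ι → Polynomial ℂ) (x : Sl r)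
    (y : MvPolynomial (Fin (r + 1) × ι × ℕ) (Polynomial ℂ)) :
    derEval α 1 x y = der x.val (1 : ι → Polynomial ℂ) y := by
  rw [derEval_apply]
  congr 2
  ext1 k
  simp

section Cyclic

variable {r : ℕ} {ι : Type*} [Fintype ι] {d : ι → ℕ}

/-- The module over the polynomials in the deformation parameter which is generated by the product
of the leading minors under the action of the current algebra. -/
def cyclic (α : ι → Polynomial ℂ) (hd : ∀ k, d k ≤ r + 1) :
    Submodule (Polynomial ℂ) (MvPolynomial (Fin (r + 1) × ι × ℕ) (Polynomial ℂ)) :=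
  Submodule.span (Polynomial ℂ)
    (Set.range fun u => rep r α u (minorProd (Polynomial ℂ) (topRows hd)))

theorem rep_mem_cyclic {α : ι → Polynomial ℂ} {hd : ∀ k, d k ≤ r + 1} (u : UCurrent r)
    {y : MvPolynomial (Fin (r + 1) × ι × ℕ) (Polynomial ℂ)} (hy : y ∈ cyclic α hd) :
    rep r α u y ∈ cyclic α hd := by
  induction hy using Submodule.span_induction with
  | mem x hx =>
    obtain ⟨w, rfl⟩ := hx
    refine Submodule.subset_span ⟨u * w, ?_⟩
    simp only [map_mul, Module.End.mul_apply]
  | zero => rw [map_zero]; exact zero_mem _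
  | add x y _ _ h1 h2 => rw [map_add]; exact add_mem h1 h2
  | smul c x _ h => rw [map_smul]; exact Submodule.smul_mem _ _ h

theorem minorProd_topRows_mem_cyclic (α : ι → Polynomial ℂ) (hd : ∀ k, d k ≤ r + 1) :
    minorProd (Polynomial ℂ) (topRows hd) ∈ cyclic α hd :=
  Submodule.subset_span ⟨1, by simp⟩

theorem apply_eq_zero_of_mem_nPlus {x : Sl r} (hx : x ∈ nPlus r) (a b : Fin (r + 1))
    (hab : ¬ a < b) : x.val a b = 0 := by
  induction hx using Submodule.span_induction with
  | mem x hx =>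
    obtain ⟨i, j, h, rfl⟩ := hx
    rw [xPlus, LieAlgebra.SpecialLinear.val_single]
    refine Matrix.single_apply_of_ne _ _ _ _ _ ?_
    rintro ⟨rfl, rfl⟩
    exact hab (Fin.castSucc_lt_succ_iff.mpr h)
  | zero => rfl
  | add x y _ _ h1 h2 =>
    change x.val a b + y.val a b = 0
    rw [h1, h2, add_zero]
  | smul c x _ h =>
    change c * x.val a b = 0
    rw [h, mul_zero]

/-- The defining relations of the Weyl module hold for the product of the leading minors modulo
the deformation parameter. -/
theorem exists_rep_eq_X_smul {m : Fin r → ℕ} {α : ι → Polynomial ℂ} (hα : ∀ k, X ∣ α k)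
    (hd : ∀ k, d k ≤ r + 1)
    (hcount : ∀ i : Fin r, ∑ k, (if d k = i + 1 then 1 else 0) = m i)
    (hweight : ∀ h ∈ cartan r, ∑ k, ∑ c, h.val (topRows hd k c) (topRows hd k c) =
      (dominant m).eval h)
    {z : UCurrent r} (hz : z ∈ weylIdeal m) :
    ∃ y ∈ cyclic α hd,
      rep r α z (minorProd (Polynomial ℂ) (topRows hd)) = (X : Polynomial ℂ) • y := by
  change z ∈ Submodule.span _ _ at hz
  induction hz using Submodule.span_induction with
  | zero => exact ⟨0, zero_mem _, by simp⟩
  | add z w _ _ h1 h2 =>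
    obtain ⟨y, hy, h1⟩ := h1
    obtain ⟨y', hy', h2⟩ := h2
    exact ⟨y + y', add_mem hy hy', by rw [map_add, LinearMap.add_apply, h1, h2, smul_add]⟩
  | smul u z _ h =>
    obtain ⟨y, hy, h⟩ := h
    refine ⟨rep r α u y, rep_mem_cyclic u hy, ?_⟩
    rw [smul_eq_mul, map_mul, Module.End.mul_apply, h, map_smul]
  | mem z hz =>
    rcases hz with ((⟨x, hx, f, rfl⟩ | ⟨x, hx, f, rfl⟩) | ⟨x, hx, rfl⟩) | ⟨i, rfl⟩
    · refine ⟨0, zero_mem _, ?_⟩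
      rw [rep_cur, derEval_apply, smul_zero]
      exact der_minorProd_topRows hd _ (apply_eq_zero_of_mem_nPlus hx) _
    -- This is the only family of relations that holds merely modulo the parameter: the points `α k`
    -- are divisible by `X`.
    · have h1 : ∀ k, ∃ c, Polynomial.aeval (α k) (X * f) = X * c := fun k => by
        obtain ⟨c, hc⟩ := hα k
        exact ⟨c * Polynomial.aeval (α k) f, by
          rw [map_mul, Polynomial.aeval_X, hc, mul_assoc]⟩
      choose c hc using h1
      have h2 : (fun k => Polynomial.aeval (α k) (X * f)) = (X : Polynomial ℂ) • c := by
        ext1 k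
        exact hc k
      rw [rep_cur, derEval_apply, h2, der_smul_right, Derivation.smul_apply,
        der_minorProd_of_isDiag _ hx]
      exact ⟨_, Submodule.smul_mem _ _ (minorProd_topRows_mem_cyclic α hd), rfl⟩
    · refine ⟨0, zero_mem _, ?_⟩
      have h : ∑ k, ∑ c, algebraMap ℂ (Polynomial ℂ)
          (x.val (topRows hd k c) (topRows hd k c)) * (1 : ι → Polynomial ℂ) k =
          algebraMap ℂ (Polynomial ℂ) ((dominant m).eval x) := by
        rw [← hweight x hx, map_sum]
        refine Finset.sum_congr rfl fun k _ => ?_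
        rw [map_sum]
        exact Finset.sum_congr rfl fun c _ => mul_one _
      rw [map_sub, rep_cur, LinearMap.sub_apply, derEval_one, der_minorProd_of_isDiag _ hx,
        AlgHom.commutes, Module.algebraMap_end_apply, smul_zero, h, algebraMap_smul, sub_self]
    · refine ⟨0, zero_mem _, ?_⟩
      rw [map_pow, rep_cur, smul_zero, ← hcount i, Module.End.pow_apply]
      have h1 : ⇑(derEval α 1 (xMinus i i le_rfl)) =
          der (Matrix.single ⟨i + 1, by omega⟩ ⟨i, by omega⟩ 1) (1 : ι → Polynomial ℂ) := by
        ext1 y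
        rw [derEval_one]
        rfl
      rw [h1]
      exact iterate_derivation_prod_eq_zero _ _ _ _ fun k _ =>
        der_single_minor_topRows hd i (by omega) k

end Cyclic

end WeylBasis
end

noncomputable section
namespace WeylBasis

open Polynomial (X)

/-! ### Multiples of products of minors in the cyclic submodule -/

section Multiple

variable {r : ℕ} {ι : Type*} [Fintype ι] {d : ι → ℕ}

/-- As `cyclic` is a module over `ℂ[X]`, currents may have coefficients in `ℂ[X]`; this permits
interpolation at the points `α k`. -/
theorem der_eval_mem_cyclic {α : ι → Polynomial ℂ} {hd : ∀ k, d k ≤ r + 1} (x : Sl r)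
    (P : Polynomial (Polynomial ℂ)) {y : MvPolynomial (Fin (r + 1) × ι × ℕ) (Polynomial ℂ)}
    (hy : y ∈ cyclic α hd) : der x.val (fun k => P.eval (α k)) y ∈ cyclic α hd := by
  induction P using Polynomial.induction_on' with
  | add P Q h1 h2 =>
    have : (fun k => (P + Q).eval (α k)) = (fun k => P.eval (α k)) + fun k => Q.eval (α k) := by
      ext1 k; simp
    rw [this, der_add_right, Derivation.add_apply]
    exact add_mem h1 h2
  | monomial n c =>
    have : (fun k => (Polynomial.monomial n c).eval (α k)) =
        c • fun k => Polynomial.aeval (α k) (X ^ n : Polynomial ℂ) := by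
      ext1 k; simp
    rw [this, der_smul_right, Derivation.smul_apply, ← derEval_apply, ← rep_cur]
    exact Submodule.smul_mem _ _ (rep_mem_cyclic _ hy)

variable [DecidableEq ι]

/-- If the points `α k` are distinct, every current can be made to act at one point only, up to
a non-zero factor. -/
theorem exists_der_single_mem_cyclic {α : ι → Polynomial ℂ} (hα : Function.Injective α) (k : ι) :
    ∃ p : Polynomial ℂ, p ≠ 0 ∧ ∀ (hd : ∀ k, d k ≤ r + 1) (x : Sl r)
      (y : MvPolynomial (Fin (r + 1) × ι × ℕ) (Polynomial ℂ)), y ∈ cyclic α hd →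
        der x.val (Pi.single k p) y ∈ cyclic α hd := by
  -- The Lagrange interpolation numerator: it vanishes at every point except `α k`.
  let P : Polynomial (Polynomial ℂ) :=
    ∏ l ∈ Finset.univ.erase k, (Polynomial.X - Polynomial.C (α l))
  have h1 : ∀ a, P.eval a = ∏ l ∈ Finset.univ.erase k, (a - α l) := fun a => by
    simp [P, Polynomial.eval_prod]
  refine ⟨P.eval (α k), ?_, fun hd x y hy => ?_⟩
  · rw [h1, Finset.prod_ne_zero_iff]
    intro l hl h
    exact Finset.ne_of_mem_erase hl (hα (sub_eq_zero.1 h)).symm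
  · have h2 : (Pi.single k (P.eval (α k)) : ι → Polynomial ℂ) = fun l => P.eval (α l) := by
      ext1 l
      rcases eq_or_ne l k with rfl | hl
      · rw [Pi.single_eq_same]
      · rw [Pi.single_eq_of_ne hl, h1]
        exact (Finset.prod_eq_zero (Finset.mem_erase.2 ⟨hl, Finset.mem_univ l⟩) (sub_self _)).symm
    rw [h2]
    exact der_eval_mem_cyclic x P hy

/-- A non-zero multiple of the product of minors with the rows `T` is in the cyclic submodule. -/
def IsReached (α : ι → Polynomial ℂ) (hd : ∀ k, d k ≤ r + 1)
    (T : (k : ι) → Fin (d k) → Fin (r + 1)) : Prop :=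
  ∃ p : Polynomial ℂ, p ≠ 0 ∧ p • minorProd (Polynomial ℂ) T ∈ cyclic α hd

/-- A matrix unit with column index `T k c`, acting at the point `k` only, changes row `c` alone,
because the rows `T k` are distinct. -/
theorem IsReached.update {α : ι → Polynomial ℂ} (hα : Function.Injective α)
    {hd : ∀ k, d k ≤ r + 1} {T : (k : ι) → Fin (d k) → Fin (r + 1)} (h : IsReached α hd T) (k : ι)
    (hT : Function.Injective (T k)) (c : Fin (d k)) (a : Fin (r + 1)) :
    IsReached α hd (Function.update T k (Function.update (T k) c a)) := by
  rcases eq_or_ne a (T k c) with rfl | ha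
  · rwa [Function.update_eq_self, Function.update_eq_self]
  · obtain ⟨p, hp, h⟩ := h
    obtain ⟨q, hq, hk⟩ := exists_der_single_mem_cyclic (r := r) (d := d) hα k
    refine ⟨p * q, mul_ne_zero hp hq, ?_⟩
    have := hk hd (LieAlgebra.SpecialLinear.single a (T k c) ha 1) _ h
    rw [Derivation.map_smul, LieAlgebra.SpecialLinear.val_single, der_minorProd,
      Finset.sum_eq_single k, Finset.sum_eq_single c, Finset.sum_eq_single a] at this
    · rwa [Matrix.single_apply_same, map_one, one_mul, Pi.single_eq_same, smul_smul] at this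
    · intro b _ hb
      rw [Matrix.single_apply_of_row_ne hb.symm, map_zero, zero_mul, zero_smul]
    · simp
    · intro c' _ hc'
      refine Finset.sum_eq_zero fun b _ => ?_
      rw [Matrix.single_apply_of_col_ne _ _ (fun h => hc' (hT h.symm)), map_zero, zero_mul,
        zero_smul]
    · simp
    · intro l _ hl
      refine Finset.sum_eq_zero fun _ _ => Finset.sum_eq_zero fun b _ => ?_
      rw [Pi.single_eq_of_ne hl, mul_zero, zero_smul]
    · simp

theorem le_of_strictMono {e n : ℕ} {S : Fin e → Fin n} (hS : StrictMono S) (c : Fin e) :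
    (c : ℕ) ≤ S c := by
  obtain ⟨c, hc⟩ := c
  induction c with
  | zero => exact Nat.zero_le _
  | succ c ih =>
    have h1 := ih (by omega)
    have h2 : S ⟨c, by omega⟩ < S ⟨c + 1, hc⟩ := hS (Fin.lt_def.2 (Nat.lt_succ_self c))
    have h3 := Fin.lt_def.1 h2
    simp only at h1 ⊢
    omega

/-- The rows are exchanged from the last to the first. Since `S c ≥ c`, the exchanged rows never
meet the remaining leading rows, so all intermediate families are injective. -/
theorem IsReached.update_of_eq_topRows {α : ι → Polynomial ℂ} (hα : Function.Injective α)
    {hd : ∀ k, d k ≤ r + 1} {T : (k : ι) → Fin (d k) → Fin (r + 1)} (h : IsReached α hd T) (k : ι)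
    (hT : T k = topRows hd k) {S : Fin (d k) → Fin (r + 1)} (hS : StrictMono S) :
    IsReached α hd (Function.update T k S) := by
  let hyb : ℕ → Fin (d k) → Fin (r + 1) := fun q c => if (c : ℕ) < q then topRows hd k c else S c
  have hval : ∀ c, (topRows hd k c : ℕ) = c := fun c => rfl
  have key : ∀ q ≤ d k, IsReached α hd (Function.update T k (hyb q)) := by
    intro q hq
    induction hq using Nat.decreasingInduction with
    | self =>
      have : hyb (d k) = T k := by
        rw [hT]
        ext1 c
        exact if_pos c.2
      rwa [this, Function.update_eq_self]
    | of_succ q hq ih =>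
      have hinj : Function.Injective (hyb (q + 1)) := by
        intro c c' hcc
        simp only [hyb] at hcc
        have h1 := le_of_strictMono hS c
        have h2 := le_of_strictMono hS c'
        split_ifs at hcc with h3 h4 h4
        · exact Fin.castLE_injective _ hcc
        · have := congrArg Fin.val hcc
          rw [hval] at this
          omega
        · have := congrArg Fin.val hcc
          rw [hval] at this
          omega
        · exact hS.injective hcc
      have := ih.update hα k (by rwa [Function.update_self]) ⟨q, hq⟩ (S ⟨q, hq⟩)
      rw [Function.update_idem, Function.update_self] at this
      convert this using 2
      ext1 c
      rcases eq_or_ne c ⟨q, hq⟩ with rfl | hc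
      · rw [Function.update_self]
        exact if_neg (lt_irrefl _)
      · rw [Function.update_of_ne hc]
        have : (c : ℕ) ≠ q := fun h => hc (Fin.ext h)
        simp only [hyb]
        congr 1
        exact propext ⟨fun h => by omega, fun h => by omega⟩
  have := key 0 (Nat.zero_le _)
  convert this using 2
  ext1 c
  exact (if_neg (Nat.not_lt_zero _)).symm

theorem isReached_of_strictMono {α : ι → Polynomial ℂ} (hα : Function.Injective α)
    (hd : ∀ k, d k ≤ r + 1) {S : (k : ι) → Fin (d k) → Fin (r + 1)} (hS : ∀ k, StrictMono (S k)) :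
    IsReached α hd S := by
  have key : ∀ A : Finset ι, IsReached α hd fun k => if k ∈ A then S k else topRows hd k := by
    intro A
    induction A using Finset.induction_on with
    | empty => exact ⟨1, one_ne_zero, by simpa using minorProd_topRows_mem_cyclic α hd⟩
    | insert k A hk ih =>
      have := ih.update_of_eq_topRows hα k (if_neg hk) (hS k)
      convert this using 1
      ext1 l
      rcases eq_or_ne l k with rfl | hl
      · simp
      · rw [Function.update_of_ne hl]
        simp [hl]
  simpa using key Finset.univ

end Multiple

end WeylBasis
end

noncomputable section
namespace WeylBasis

open Polynomial (X)

/-! ### The lower bound for the dimension -/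

section Evaluation

variable {B : Type*} [CommRing B] {n : ℕ} {ι : Type*} {d : ι → ℕ}

/-- The evaluation at the family of matrices whose first columns are the unit vectors `T`. -/
def evalAt (B : Type*) [CommRing B] (T : (k : ι) → Fin (d k) → Fin n) :
    MvPolynomial (Fin n × ι × ℕ) B →ₐ[B] B :=
  MvPolynomial.aeval fun p =>
    if ∃ h : p.2.2 < d p.2.1, T p.2.1 ⟨p.2.2, h⟩ = p.1 then 1 else 0

theorem evalAt_minor (T : (k : ι) → Fin (d k) → Fin n) (k : ι) (S : Fin (d k) → Fin n) :
    evalAt B T (minor B k S) =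
      Matrix.det (Matrix.of fun c' c : Fin (d k) => if T k c' = S c then (1 : B) else 0) := by
  rw [minor, AlgHom.map_det]
  congr 1
  ext c' c
  simp [evalAt]

/-- The families of sets of rows of the sizes `d k`. -/
abbrev RowSets (n : ℕ) (d : ι → ℕ) := (k : ι) → {s : Finset (Fin n) // s.card = d k}

/-- The increasing enumerations of the sets of a family. -/
def RowSets.rows (s : RowSets n d) (k : ι) : Fin (d k) → Fin n := (s k).val.orderEmbOfFin (s k).2

/-- The evaluations are dual to the minors: equal sets give the identity matrix, and an element of
`s k` outside `t k` gives a zero column. -/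
theorem evalAt_minor_rows [DecidableEq ι] (s t : RowSets n d) (k : ι) :
    evalAt B t.rows (minor B k (s.rows k)) = if s k = t k then 1 else 0 := by
  rw [evalAt_minor]
  split_ifs with h
  · have hr : s.rows k = t.rows k := by
      unfold RowSets.rows
      simp only [h]
    have hi : Function.Injective (t.rows k) := ((t k).val.orderEmbOfFin (t k).2).injective
    have : (Matrix.of fun c' c : Fin (d k) => if t.rows k c' = s.rows k c then (1 : B) else 0) =
        1 := by
      ext c' c
      rw [Matrix.of_apply, Matrix.one_apply, hr]
      simp only [hi.eq_iff]
    rw [this, Matrix.det_one]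
  · have h1 : ¬ (s k).val ⊆ (t k).val := fun hsub =>
      h (Subtype.ext (Finset.eq_of_subset_of_card_le hsub (by rw [(s k).2, (t k).2])))
    obtain ⟨a, ha, hat⟩ := Finset.not_subset.1 h1
    have h2 : a ∈ Set.range (s.rows k) := by
      rw [RowSets.rows, Finset.range_orderEmbOfFin]
      exact ha
    obtain ⟨c, rfl⟩ := h2
    refine Matrix.det_eq_zero_of_column_eq_zero c fun c' => if_neg fun hc => hat ?_
    rw [← hc]
    exact Finset.orderEmbOfFin_mem _ _ _

theorem evalAt_minorProd_rows [Fintype ι] [DecidableEq ι] (s t : RowSets n d) :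
    evalAt B t.rows (minorProd B s.rows) = if s = t then 1 else 0 := by
  rw [minorProd, map_prod]
  simp only [evalAt_minor_rows]
  rw [Finset.prod_ite_zero]
  simp [funext_iff]

end Evaluation

/-- If `L` were smaller, `C * D` would be singular; modulo `X ^ K` its determinant is `p ^ card J`,
which would then be divisible by `X ^ K`. -/
theorem card_le_card_of_mul_add_eq {J L : Type*} [Fintype J] [Fintype L] [DecidableEq J]
    (p : Polynomial ℂ) (K : ℕ) (hp : ¬ X ^ K ∣ p ^ Fintype.card J)
    (C : Matrix J L (Polynomial ℂ)) (D : Matrix L J (Polynomial ℂ)) (Y : Matrix J J (Polynomial ℂ))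
    (h : C * D + (X ^ K : Polynomial ℂ) • Y = p • (1 : Matrix J J (Polynomial ℂ))) :
    Fintype.card J ≤ Fintype.card L := by
  by_contra hlt
  have h1 : (C * D).det = 0 := by
    rw [← Matrix.exists_mulVec_eq_zero_iff]
    have h2 : ¬ Function.Injective D.mulVecLin := fun hi =>
      hlt (card_le_of_injective (Polynomial ℂ) _ hi)
    rw [← LinearMap.ker_eq_bot, Submodule.eq_bot_iff] at h2
    push Not at h2
    obtain ⟨v, hv, hv0⟩ := h2
    refine ⟨v, hv0, ?_⟩
    rw [← Matrix.mulVec_mulVec, show D.mulVec v = 0 from hv, Matrix.mulVec_zero]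
  apply hp
  rw [← Ideal.mem_span_singleton, ← Ideal.Quotient.eq_zero_iff_mem]
  have h2 : (Ideal.Quotient.mk (Ideal.span {(X ^ K : Polynomial ℂ)})) (X ^ K) = 0 :=
    Ideal.Quotient.eq_zero_iff_mem.2 (Ideal.mem_span_singleton_self _)
  have h3 : (Ideal.Quotient.mk (Ideal.span {(X ^ K : Polynomial ℂ)})).mapMatrix (C * D) =
      (Ideal.Quotient.mk (Ideal.span {(X ^ K : Polynomial ℂ)})).mapMatrix
        (p • (1 : Matrix J J (Polynomial ℂ))) := by
    rw [← h]
    ext i j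
    simp only [RingHom.mapMatrix_apply, Matrix.map_apply, Matrix.add_apply, Matrix.smul_apply,
      smul_eq_mul, map_add, map_mul, h2, zero_mul, add_zero]
  have h4 := congrArg Matrix.det h3
  rw [← RingHom.map_det, ← RingHom.map_det, h1, map_zero, Matrix.det_smul, Matrix.det_one,
    mul_one] at h4
  exact h4.symm

section Bound

variable {r : ℕ} {ι : Type*} [Fintype ι] {d : ι → ℕ}

/-- A Nakayama-type iteration: representatives of a spanning set of the Weyl module generate
`cyclic` modulo `X`, hence modulo every power of `X`. -/
theorem exists_eq_add_X_pow_smul {m : Fin r → ℕ} {α : ι → Polynomial ℂ} (hα : ∀ k, X ∣ α k)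
    (hd : ∀ k, d k ≤ r + 1)
    (hcount : ∀ i : Fin r, ∑ k, (if d k = i + 1 then 1 else 0) = m i)
    (hweight : ∀ h ∈ cartan r, ∑ k, ∑ c, h.val (topRows hd k c) (topRows hd k c) =
      (dominant m).eval h)
    {T : Set (UCurrent r)} (hT : ∀ u, u ∈ weylIdeal m ⊔ Submodule.span ℂ T) (K : ℕ)
    {y : MvPolynomial (Fin (r + 1) × ι × ℕ) (Polynomial ℂ)} (hy : y ∈ cyclic α hd) :
    ∃ p ∈ Submodule.span (Polynomial ℂ)
      (Set.range fun b : T => rep r α b.val (minorProd (Polynomial ℂ) (topRows hd))),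
      ∃ y' ∈ cyclic α hd, y = p + (X ^ K : Polynomial ℂ) • y' := by
  induction K generalizing y with
  | zero => exact ⟨0, zero_mem _, y, hy, by simp⟩
  | succ K ih =>
    have hone : ∃ p ∈ Submodule.span (Polynomial ℂ)
        (Set.range fun b : T => rep r α b.val (minorProd (Polynomial ℂ) (topRows hd))),
        ∃ y' ∈ cyclic α hd, y = p + (X : Polynomial ℂ) • y' := by
      clear ih
      induction hy using Submodule.span_induction with
      | zero => exact ⟨0, zero_mem _, 0, zero_mem _, by simp⟩
      | add x y _ _ h1 h2 =>
        obtain ⟨p, hp, x', hx', rfl⟩ := h1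
        obtain ⟨q, hq, y', hy', rfl⟩ := h2
        exact ⟨p + q, add_mem hp hq, x' + y', add_mem hx' hy', by rw [smul_add]; abel⟩
      | smul c x _ h1 =>
        obtain ⟨p, hp, x', hx', rfl⟩ := h1
        exact ⟨c • p, Submodule.smul_mem _ _ hp, c • x', Submodule.smul_mem _ _ hx', by
          rw [smul_add, smul_comm c]⟩
      | mem x hx =>
        obtain ⟨u, rfl⟩ := hx
        obtain ⟨z, hz, w, hw, rfl⟩ := Submodule.mem_sup.1 (hT u)
        obtain ⟨y', hy', h⟩ := exists_rep_eq_X_smul hα hd hcount hweight hz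
        refine ⟨rep r α w (minorProd (Polynomial ℂ) (topRows hd)), ?_, y', hy', ?_⟩
        · clear hz h
          induction hw using Submodule.span_induction with
          | zero => rw [map_zero]; exact zero_mem _
          | add x y _ _ h1 h2 => rw [map_add]; exact add_mem h1 h2
          | smul c x _ h =>
            rw [map_smul, LinearMap.smul_apply, ← algebraMap_smul (Polynomial ℂ)]
            exact Submodule.smul_mem _ _ h
          | mem x hx => exact Submodule.subset_span ⟨⟨x, hx⟩, rfl⟩
        · simp only [map_add, LinearMap.add_apply]
          rw [h]
          exact add_comm _ _
    obtain ⟨p, hp, y', hy', rfl⟩ := hone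
    obtain ⟨q, hq, y'', hy'', rfl⟩ := ih hy'
    refine ⟨p + (X : Polynomial ℂ) • q, add_mem hp (Submodule.smul_mem _ _ hq), y'', hy'', ?_⟩
    rw [smul_add, smul_smul, pow_succ', add_assoc]

theorem card_rowSets_le [DecidableEq ι] {m : Fin r → ℕ} {α : ι → Polynomial ℂ}
    (hα : ∀ k, X ∣ α k) (hinj : Function.Injective α) (hd : ∀ k, d k ≤ r + 1)
    (hcount : ∀ i : Fin r, ∑ k, (if d k = i + 1 then 1 else 0) = m i)
    (hweight : ∀ h ∈ cartan r, ∑ k, ∑ c, h.val (topRows hd k c) (topRows hd k c) =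
      (dominant m).eval h)
    (T : Finset (UCurrent r))
    (hT : ∀ u, u ∈ weylIdeal m ⊔ Submodule.span ℂ (T : Set (UCurrent r))) :
    Fintype.card (RowSets (r + 1) d) ≤ T.card := by
  have h1 : ∀ s : RowSets (r + 1) d, IsReached α hd s.rows := fun s =>
    isReached_of_strictMono hinj hd fun k => ((s k).val.orderEmbOfFin (s k).2).strictMono
  choose p hp hmem using h1
  let q := ∏ s, p s
  have hq : q ≠ 0 := Finset.prod_ne_zero_iff.2 fun s _ => hp s
  have hqmem : ∀ s : RowSets (r + 1) d, q • minorProd (Polynomial ℂ) s.rows ∈ cyclic α hd := by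
    intro s
    have : q = (∏ t ∈ Finset.univ.erase s, p t) * p s :=
      (Finset.prod_erase_mul _ _ (Finset.mem_univ s)).symm
    rw [this, mul_smul]
    exact Submodule.smul_mem _ _ (hmem s)
  -- Any power of `X` exceeding the degree of the nonzero determinant works.
  let K := (q ^ Fintype.card (RowSets (r + 1) d)).natDegree + 1
  have hK : ¬ X ^ K ∣ q ^ Fintype.card (RowSets (r + 1) d) := fun h => by
    have := Polynomial.natDegree_le_of_dvd h (pow_ne_zero _ hq)
    rw [Polynomial.natDegree_X_pow] at this
    omega
  have h2 := fun s => exists_eq_add_X_pow_smul hα hd hcount hweight hT K (hqmem s)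
  choose w hw y hy heq using h2
  have h3 := fun s => (Submodule.mem_span_range_iff_exists_fun _).1 (hw s)
  choose c hc using h3
  have := card_le_card_of_mul_add_eq (L := (T : Set (UCurrent r))) q K hK (Matrix.of c)
    (Matrix.of fun b t => evalAt (Polynomial ℂ) (RowSets.rows t)
      (rep r α b.val (minorProd (Polynomial ℂ) (topRows hd))))
    (Matrix.of fun s t => evalAt (Polynomial ℂ) (RowSets.rows t) (y s)) ?_
  · simpa using this
  · ext1 s t
    have h4 := congrArg (evalAt (Polynomial ℂ) (RowSets.rows t)) (heq s)
    rw [map_smul, evalAt_minorProd_rows, map_add, map_smul, ← hc s, map_sum] at h4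
    simp only [map_smul] at h4
    rw [Matrix.add_apply, Matrix.smul_apply, Matrix.smul_apply, Matrix.one_apply, h4,
      Matrix.mul_apply]
    rfl

end Bound

theorem sum_castLE_eq_fundWeight {r : ℕ} (i : Fin r) (x : Sl r) (hi : (i : ℕ) + 1 ≤ r + 1) :
    ∑ c : Fin ((i : ℕ) + 1), x.val (Fin.castLE hi c) (Fin.castLE hi c) = fundWeight i x := by
  refine Finset.sum_bij (fun c _ => Fin.castLE hi c) ?_ ?_ ?_ ?_
  · intro c _
    rw [Finset.mem_Iic, Fin.le_def]
    exact Nat.le_of_lt_succ c.2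
  · intro c _ c' _ h
    exact Fin.castLE_injective _ h
  · intro b hb
    rw [Finset.mem_Iic, Fin.le_def] at hb
    exact ⟨⟨b, Nat.lt_succ_of_le hb⟩, Finset.mem_univ _, rfl⟩
  · intro _ _
    rfl

/-- A set of representatives which spans the Weyl module of the weight `∑ m i ω_i` has at least
`∏ i, binom (r + 1) i ^ m i` elements. -/
theorem prod_choose_le_card {r : ℕ} (m : Fin r → ℕ) (T : Finset (UCurrent r))
    (hT : ∀ u, u ∈ weylIdeal m ⊔ Submodule.span ℂ (T : Set (UCurrent r))) :
    ∏ i ∈ Finset.range r, (r + 1).choose (i + 1) ^ extend m i ≤ T.card := by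
  let d : (Σ i : Fin r, Fin (m i)) → ℕ := fun k => k.1 + 1
  have hd : ∀ k, d k ≤ r + 1 := fun k => Nat.succ_le_succ k.1.2.le
  -- Distinct positive powers: the points are generically different but all collide at `0` when `X =
  -- 0`.
  let α : (Σ i : Fin r, Fin (m i)) → Polynomial ℂ := fun k =>
    X ^ ((Fintype.equivFin _ k : ℕ) + 1)
  have hα : ∀ k, X ∣ α k := fun k => dvd_pow_self _ (Nat.succ_ne_zero _)
  have hinj : Function.Injective α := fun k l h => by
    have := congrArg Polynomial.natDegree h
    simp only [α, Polynomial.natDegree_X_pow] at this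
    exact (Fintype.equivFin _).injective (Fin.ext (by omega))
  have hcount : ∀ i : Fin r, ∑ k, (if d k = i + 1 then 1 else 0) = m i := fun i => by
    rw [Fintype.sum_sigma]
    simp [d, ← Fin.ext_iff]
  have hweight : ∀ h ∈ cartan r, ∑ k, ∑ c, h.val (topRows hd k c) (topRows hd k c) =
      (dominant m).eval h := fun h _ => by
    rw [Fintype.sum_sigma, Weight.eval]
    refine Finset.sum_congr rfl fun i _ => ?_
    refine (Finset.sum_congr rfl fun p _ => sum_castLE_eq_fundWeight i h (hd ⟨i, p⟩)).trans ?_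
    rw [Finset.sum_const, Finset.card_univ, Fintype.card_fin, nsmul_eq_mul, dominant,
      Int.cast_natCast]
  have := card_rowSets_le hα hinj hd hcount hweight T hT
  refine le_trans (le_of_eq ?_) this
  rw [Fintype.card_pi, Fintype.prod_sigma, Finset.prod_range]
  refine Finset.prod_congr rfl fun i _ => ?_
  simp [extend, d]

end WeylBasis
end

noncomputable section
namespace WeylBasis

/-! ### The basis -/

/-- The projection of the enveloping algebra onto the Weyl module. -/
def weylProj {r : ℕ} (m : Fin r → ℕ) : UCurrent r →ₗ[ℂ] WeylModule m :=
  (Submodule.span (UCurrent r) (weylRelations m)).mkQ.restrictScalars ℂ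

theorem smul_weylGenerator {r : ℕ} (m : Fin r → ℕ) (u : UCurrent r) :
    u • weylGenerator m = weylProj m u := by
  change (Submodule.span (UCurrent r) (weylRelations m)).mkQ (u • 1) = _
  rw [smul_eq_mul, mul_one]
  rfl

theorem weylProj_surjective {r : ℕ} (m : Fin r → ℕ) : Function.Surjective (weylProj m) := by
  intro w
  induction w using Submodule.Quotient.induction_on with
  | H u => exact ⟨u, rfl⟩

theorem weylProj_eq_zero_iff {r : ℕ} {m : Fin r → ℕ} {u : UCurrent r} :
    weylProj m u = 0 ↔ u ∈ weylIdeal m :=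
  Submodule.Quotient.mk_eq_zero _

theorem span_range_eq_top {r : ℕ} (m : Fin r → ℕ) :
    Submodule.span ℂ (Set.range fun b : basisSet m => weylProj m b.val) = ⊤ := by
  rw [eq_top_iff]
  rintro w -
  obtain ⟨u, rfl⟩ := weylProj_surjective m w
  obtain ⟨z, hz, y, hy, rfl⟩ := Submodule.mem_sup.1 (mem_weylIdeal_sup_span m u)
  rw [map_add, weylProj_eq_zero_iff.2 hz, zero_add]
  have h : (Set.range fun b : basisSet m => weylProj m b.val) = weylProj m '' basisSet m := by
    rw [Set.image_eq_range]
  rw [h, Submodule.span_image, basisSet_eq]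
  exact Submodule.mem_map_of_mem hy

theorem prod_choose_le_finrank {r : ℕ} (m : Fin r → ℕ) [FiniteDimensional ℂ (WeylModule m)] :
    ∏ i ∈ Finset.range r, (r + 1).choose (i + 1) ^ extend m i ≤
      Module.finrank ℂ (WeylModule m) := by
  classical
  let e := Module.finBasis ℂ (WeylModule m)
  choose f hf using fun i => weylProj_surjective m (e i)
  refine (prod_choose_le_card m (Finset.univ.image f) fun u => ?_).trans
    (Finset.card_image_le.trans_eq (by simp))
  have h : weylProj m (u - ∑ i, e.repr (weylProj m u) i • f i) = 0 := by
    rw [map_sub, map_sum]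
    simp only [map_smul, hf]
    rw [e.sum_repr, sub_self]
  rw [← sub_add_cancel u (∑ i, e.repr (weylProj m u) i • f i)]
  exact Submodule.add_mem_sup (weylProj_eq_zero_iff.1 h) (Submodule.sum_mem _ fun i _ =>
    Submodule.smul_mem _ _ (Submodule.subset_span (by simp)))

end WeylBasis
end

theorem theorem2p1p3 (r : ℕ) (m : Fin r → ℕ) :
    LinearIndependent ℂ
        (fun b : WeylBasis.basisSet m => b.val • WeylBasis.weylGenerator m) ∧
      Submodule.span ℂ
        (Set.range fun b : WeylBasis.basisSet m => b.val • WeylBasis.weylGenerator m) = ⊤ := by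
  simp only [WeylBasis.smul_weylGenerator]
  have hspan := WeylBasis.span_range_eq_top m
  refine ⟨?_, hspan⟩
  obtain ⟨T, hT, hcard⟩ := WeylBasis.exists_finset_basisMon (WeylBasis.curUnit r) r
    (WeylBasis.extend m)
  rw [← WeylBasis.basisSet_eq] at hT
  have hfin : (WeylBasis.basisSet m).Finite := T.finite_toSet.subset hT
  have := hfin.fintype
  have : FiniteDimensional ℂ (WeylBasis.WeylModule m) :=
    Module.finite_def.2 (hspan ▸ Submodule.fg_span (Set.finite_range _))
  have h1 : Fintype.card (WeylBasis.basisSet m) ≤ T.card := by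
    rw [← Set.toFinset_card]
    exact Finset.card_le_card (by simpa using hT)
  -- The number of monomials is squeezed: at most the product of binomials, hence at most the
  -- dimension, and at least the dimension because they span.
  refine linearIndependent_of_top_le_span_of_card_eq_finrank hspan.ge (le_antisymm ?_ ?_)
  · exact (h1.trans hcard).trans (WeylBasis.prod_choose_le_finrank m)
  · have := finrank_range_le_card (R := ℂ)
      (fun b : WeylBasis.basisSet m => WeylBasis.weylProj m b.val)
    rwa [Set.finrank, hspan, finrank_top] at this
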